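/- Let $\Bbbk$ be an algebraically closed field and let $\mathcal R$ be a locally finite Abelian category over $\Bbbk$, i.e. a (small) $\Bbbk$-linear Abelian category in which all objects have finite length and all morphism spaces are finite-dimensional. A stratification of $\mathcal R$ consists of representatives $L(b)$ ($b\in\mathbf B$) for the isomorphism classes of irreducible objects and a function $\rho:\mathbf B\to\Lambda$ with finite fibers to an interval finite poset $\Lambda$, such that for every $\lambda\in\Lambda$ the Serre subcategory $\mathcal R_{\le\lambda}$ of objects whose composition factors are of the form $L(b)$ with $\rho(b)\le\lambda$ has enough projectives and enough injectives. Let $\mathcal R_\lambda=\mathcal R_{\le\lambda}/\mathcal R_{<\lambda}$ be the Serre quotient, with quotient functor $j^\lambda$ having left adjoint $j^\lambda_!$ and right adjoint $j^\lambda_*$ (where needed below). For $\rho(b)=\lambda$ let $L_\lambda(b)=j^\lambda L(b)$, with projective cover $P_\lambda(b)$ and injective hull $I_\lambda(b)$ in $\mathcal R_\lambda$, and put $$\Delta(b)=j^\lambda_!P_\lambda(b),\quad \bar\Delta(b)=j^\lambda_!L_\lambda(b),\quad \nabla(b)=j^\lambda_*I_\lambda(b),\quad \bar\nabla(b)=j^\lambda_*L_\lambda(b).$$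 Given a sign function $\varepsilon:\Lambda\to\{\pm\}$, let $(\Delta_\varepsilon(b),\nabla_\varepsilon(b))$ be $(\Delta(b),\bar\nabla(b))$ if $\varepsilon(\rho(b))=+$ and $(\bar\Delta(b),\nabla(b))$ if $\varepsilon(\rho(b))=-$. A $\nabla_\varepsilon$-flag of an object of $\mathcal R$ is a finite filtration with sections of the form $\nabla_\varepsilon(c)$, $c\in\mathbf B$. An ascending $\nabla_\varepsilon$-flag in an object $V$ of the ind-completion $\operatorname{Ind}(\mathcal R)$ is a directed system $(V_\omega)_{\omega\in\Omega}$ of subobjects of $V$ with $V=\sum_\omega V_\omega$ such that each $V_\omega$ belongs to $\mathcal R$ and has a $\nabla_\varepsilon$-flag. Assume that $\mathcal R$ is a lower finite $\varepsilon$-stratified category: the poset $\Lambda$ is lower finite (all $(-\infty,\mu]$ are finite), and for each $b\in\mathbf B$ there is a finitely cogenerated injective object $I_b\in\operatorname{Ind}(\mathcal R)$ with an ascending $\nabla_\varepsilon$-flag $(V_\omega)$ in which every $V_\omega$ has a $\nabla_\varepsilon$-flag with $\nabla_\varepsilon(b)$ at the bottom and other sections $\nabla_\varepsilon(c)$ with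 $\rho(c)\ge\rho(b)$. Then the objects $\Delta_\varepsilon(b)$ and $\nabla_\varepsilon(b)$ exist for all $b\in\mathbf B$, and the following hold, where $\operatorname{Hom}$ and $\operatorname{Ext}$ are taken in $\operatorname{Ind}(\mathcal R)$. (1) For $V\in\operatorname{Ind}(\mathcal R)$ such that $\dim\operatorname{Hom}(\Delta_\varepsilon(b),V)<\infty$ for all $b\in\mathbf B$, the following are equivalent: (i) $V$ has an ascending $\nabla_\varepsilon$-flag; (ii) $\operatorname{Ext}^1(\Delta_\varepsilon(b),V)=0$ for all $b\in\mathbf B$; (iii) $\operatorname{Ext}^n(\Delta_\varepsilon(b),V)=0$ for all $b\in\mathbf B$ and $n\ge1$. (2) For every $b\in\mathbf B$, an injective hull $I(b)$ of $L(b)$ in $\operatorname{Ind}(\mathcal R)$ has an ascending $\nabla_\varepsilon$-flag. For every such flag $(V_\omega)$, every choice of a $\nabla_\varepsilon$-flag in each $V_\omega$, and every $c\in\mathbf B$, the supremum $(I(b):\nabla_\varepsilon(c))$ over $\omega$ of the multiplicities of $\nabla_\varepsilon(c)$ as a section of these flags is finite and equals the composition multiplicity $[\Delta_\varepsilon(c):L(b)]$.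 -/

import Mathlib

open CategoryTheory CategoryTheory.Limits ZeroObject

universe w u v u' v' x y

namespace Strat

/-! ### Generalities on abelian categories -/

section General

variable {C : Type u} [Category.{v} C]

/-- `L` is (isomorphic to) a subquotient of `V`. When `L` is irreducible this says that
`[V : L] ≠ 0`, i.e. that `L` is a composition factor of `V`. -/
def IsSubquotient (L V : C) : Prop :=
  ∃ (A : C) (i : A ⟶ V) (p : A ⟶ L), Mono i ∧ Epi p

lemma IsSubquotient.of_mono {L V W : C} (i : V ⟶ W) [Mono i] (h : IsSubquotient L V) :
    IsSubquotient L W := by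
  obtain ⟨A, a, p, ha, hp⟩ := h
  exact ⟨A, a ≫ i, p, mono_comp a i, hp⟩

/-- `p : P ⟶ X` is a projective cover: `P` is projective and `p` is an essential epimorphism. -/
def IsProjectiveCover {P X : C} (p : P ⟶ X) : Prop :=
  Projective P ∧ Epi p ∧ ∀ ⦃Z : C⦄ (f : Z ⟶ P), Epi (f ≫ p) → Epi f

/-- `i : X ⟶ I` is an injective hull: `I` is injective and `i` is an essential monomorphism. -/
def IsInjectiveHull {X I : C} (i : X ⟶ I) : Prop :=
  Injective I ∧ Mono i ∧ ∀ ⦃Z : C⦄ (f : I ⟶ Z), Mono (i ≫ f) → Mono f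

/-- `X` is the value at `P` of a left adjoint of `j`: there is a universal arrow
`P ⟶ j X`, so that `Hom (X, Y) ≃ Hom (P, j Y)` naturally in `Y`. -/
def IsLeftAdjointValue {D : Type u'} [Category.{v'} D] (j : C ⥤ D) (P : D) (X : C) : Prop :=
  ∃ e : P ⟶ j.obj X, ∀ (Y : C) (f : P ⟶ j.obj Y), ∃! g : X ⟶ Y, e ≫ j.map g = f

/-- `X` is the value at `I` of a right adjoint of `j`: there is a universal arrow
`j X ⟶ I`, so that `Hom (Y, X) ≃ Hom (j Y, I)` naturally in `Y`. -/
def IsRightAdjointValue {D : Type u'} [Category.{v'} D] (j : C ⥤ D) (I : D) (X : C) : Prop :=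
  ∃ e : j.obj X ⟶ I, ∀ (Y : C) (f : j.obj Y ⟶ I), ∃! g : Y ⟶ X, j.map g ≫ e = f

variable [Abelian C]

open Classical in
/-- The composition multiplicity `[V : L]`: the supremum, over all finite filtrations
`0 = V₀ < V₁ < ⋯ < Vₙ = V`, of the number of `i` with `Vᵢ / Vᵢ₋₁ ≅ L`. -/
noncomputable def compositionMultiplicity (V L : C) : ℕ∞ :=
  ⨆ s : {s : LTSeries (Subobject V) // s.head = ⊥ ∧ s.last = ⊤},
    ((Finset.univ.filter fun i : Fin s.1.length =>
      Nonempty (cokernel (Subobject.ofLE (s.1 i.castSucc) (s.1 i.succ) (s.1.step i).le) ≅ L)).card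
      : ℕ∞)

/-- An object is finitely cogenerated if every family of subobjects with zero intersection has a
finite subfamily with zero intersection. -/
def IsFinitelyCogenerated (V : C) : Prop :=
  ∀ S : Set (Subobject V), IsGLB S ⊥ →
    ∃ T : Finset (Subobject V), (T : Set (Subobject V)) ⊆ S ∧ IsGLB (T : Set (Subobject V)) ⊥

/-- Given a family of classes of objects `N b`, `HasFlag N X [b₁, …, bₙ]` means that `X` has a
filtration `0 = V₀ < V₁ < ⋯ < Vₙ = X` with `Vₘ / Vₘ₋₁` in the class `N bₘ` for all `m`. Thus the
head of the list is the bottom section; the filtration is built by splitting off the bottom section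
`V₁ ⊆ X` and passing to the induced filtration of `X / V₁`. -/
inductive HasFlag {B : Type x} (N : B → C → Prop) : C → List B → Prop
  | nil (X : C) (hX : IsZero X) : HasFlag N X []
  | cons (S : ShortComplex C) (hS : S.ShortExact) (b : B) (bs : List B)
      (hb : N b S.X₁) (hbs : HasFlag N S.X₃ bs) : HasFlag N S.X₂ (b :: bs)

end General

/-- A locally finite abelian category over `k`: a `k`-linear abelian category in which all objects
have finite length and all morphism spaces are finite-dimensional. -/
class IsLocallyFiniteAbelian (k : Type w) [Field k] (R : Type u) [Category.{v} R] [Abelian R]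
    [Linear k R] : Prop where
  artinian : ∀ X : R, IsArtinianObject X
  noetherian : ∀ X : R, IsNoetherianObject X
  finite_hom : ∀ X Y : R, Module.Finite k (X ⟶ Y)

/-! ### Stratifications -/

section Stratification

variable {R : Type u} [Category.{v} R] [Abelian R]

/-- The Serre subcategory associated to a set `T` of labels of irreducible objects: the objects all
of whose composition factors among the `L b` have label in `T`. -/
def serre {B : Type x} (L : B → R) (T : Set B) : ObjectProperty R :=
  fun V => ∀ b : B, IsSubquotient (L b) V → b ∈ T

lemma IsSubquotient.of_epi {L V W : R} (q : V ⟶ W) [Epi q] (h : IsSubquotient L W) :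
    IsSubquotient L V := by
  obtain ⟨A, a, p, ha, hp⟩ := h
  exact ⟨pullback q a, pullback.fst q a, pullback.snd q a ≫ p, inferInstance, epi_comp _ _⟩

lemma IsSubquotient.of_shortExact {L : R} [Simple L] {S : ShortComplex R} (hS : S.ShortExact)
    (h : IsSubquotient L S.X₂) : IsSubquotient L S.X₁ ∨ IsSubquotient L S.X₃ := by
  obtain ⟨A, a, p, ha, hp⟩ := h
  have := hS.mono_f
  -- the source of `κ` is the intersection of `A` with `S.X₁`
  let κ : kernel (a ≫ S.g) ⟶ A := kernel.ι (a ≫ S.g)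
  by_cases h0 : κ ≫ p = 0
  · right
    refine ⟨Abelian.coimage (a ≫ S.g), Abelian.factorThruCoimage (a ≫ S.g),
      cokernel.desc κ p h0, inferInstance, ?_⟩
    have hq : cokernel.π κ ≫ cokernel.desc κ p h0 = p := cokernel.π_desc _ _ _
    have : Epi (cokernel.π κ ≫ cokernel.desc κ p h0) := by rw [hq]; exact hp
    exact epi_of_epi (cokernel.π κ) _
  · left
    have hk : (κ ≫ a) ≫ S.g = 0 := by
      rw [Category.assoc]; exact kernel.condition _
    have hl : hS.exact.lift (κ ≫ a) hk ≫ S.f = κ ≫ a := hS.exact.lift_f _ _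
    refine ⟨kernel (a ≫ S.g), hS.exact.lift (κ ≫ a) hk, κ ≫ p, ?_, epi_of_nonzero_to_simple h0⟩
    have : Mono (hS.exact.lift (κ ≫ a) hk ≫ S.f) := by rw [hl]; exact mono_comp _ _
    exact mono_of_mono _ S.f

instance serre_isSerreClass {B : Type x} (L : B → R) [∀ b, Simple (L b)] (T : Set B) :
    (serre L T).IsSerreClass where
  exists_zero := by
    refine ⟨0, isZero_zero R, ?_⟩
    rintro b ⟨A, i, p, hi, hp⟩
    have hA : IsZero A := (isZero_zero R).of_mono i
    exact absurd (hA.of_epi p) (Simple.not_isZero (L b))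
  prop_of_mono f _ hY b hb := hY b (hb.of_mono f)
  prop_of_epi f _ hX b hb := hX b (hb.of_epi f)
  prop_X₂_of_shortExact hS h₁ h₃ b hb :=
    (hb.of_shortExact hS).elim (h₁ b) (h₃ b)

/-- The full subcategory of an abelian category defined by a Serre class is closed under finite
products, so it is an abelian category. -/
instance closedUnderFiniteProducts_of_serre (P : ObjectProperty R) [P.IsSerreClass] :
    P.IsClosedUnderFiniteProducts := by
  have : P.IsClosedUnderBinaryProducts := ⟨by
    rintro X ⟨p⟩
    let e : X ≅ (p.diag.obj ⟨WalkingPair.left⟩) ⊞ (p.diag.obj ⟨WalkingPair.right⟩) :=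
      (p.isLimit.conePointUniqueUpToIso (limit.isLimit p.diag)) ≪≫
        HasLimit.isoOfNatIso (diagramIsoPair p.diag) ≪≫ (biprod.isoProd _ _).symm
    exact P.prop_of_iso e.symm (P.prop_biprod (p.prop_diag_obj _) (p.prop_diag_obj _))⟩
  exact ObjectProperty.IsClosedUnderFiniteProducts.mk'

instance preservesFiniteLimits_of_serre (P : ObjectProperty R) [P.IsSerreClass] :
    PreservesFiniteLimits P.ι := by
  have := P.preservesKernels_ι
  exact P.ι.preservesFiniteLimits_of_preservesKernels

instance preservesFiniteColimits_of_serre (P : ObjectProperty R) [P.IsSerreClass] :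
    PreservesFiniteColimits P.ι := by
  have := P.preservesCokernels_ι
  exact P.ι.preservesFiniteColimits_of_preservesCokernels

variable (R) in
/-- A stratification of an abelian category `R`: representatives `L b` of the isomorphism classes of
irreducible objects, and a function `ρ` with finite fibres to an interval finite poset, such that
each Serre subcategory `R_{≤ l}` has enough projectives and enough injectives. -/
structure Stratification (B : Type x) (Λ : Type y) [PartialOrder Λ] where
  L : B → R
  simple : ∀ b, Simple (L b)
  eq_of_iso : ∀ b c, Nonempty (L b ≅ L c) → b = c
  exists_iso : ∀ X : R, Simple X → ∃ b, Nonempty (X ≅ L b)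
  ρ : B → Λ
  interval_finite : ∀ l m : Λ, (Set.Icc l m).Finite
  fibre_finite : ∀ l : Λ, {b | ρ b = l}.Finite
  enoughProjectives : ∀ l : Λ, EnoughProjectives (serre L {b | ρ b ≤ l}).FullSubcategory
  enoughInjectives : ∀ l : Λ, EnoughInjectives (serre L {b | ρ b ≤ l}).FullSubcategory

namespace Stratification

variable {B : Type x} {Λ : Type y} [PartialOrder Λ] (S : Stratification R B Λ)

instance (b : B) : Simple (S.L b) := S.simple b

/-- The objects of `R_{≤ l}`. -/
abbrev le (l : Λ) : ObjectProperty R := serre S.L {b | S.ρ b ≤ l}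

/-- The objects of `R_{< l}`. -/
abbrev lt (l : Λ) : ObjectProperty R := serre S.L {b | S.ρ b < l}

/-- The category `R_{≤ l}`. -/
abbrev Le (l : Λ) : Type u := (S.le l).FullSubcategory

/-- `R_{< l}`, as a Serre subcategory of `R_{≤ l}`. -/
abbrev ltIn (l : Λ) : ObjectProperty (S.Le l) := (S.lt l).inverseImage (S.le l).ι

instance (l : Λ) : (S.ltIn l).IsSerreClass := inferInstance

/-- The stratum `R_l`, the Serre quotient of `R_{≤ l}` by `R_{< l}`. -/
abbrev Stratum (l : Λ) := (S.ltIn l).isoModSerre.Localization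

/-- The quotient functor `j^l : R_{≤ l} ⥤ R_l`. -/
abbrev j (l : Λ) : S.Le l ⥤ S.Stratum l := (S.ltIn l).isoModSerre.Q

/-- The irreducible object `L b` belongs to `R_{≤ ρ b}`. -/
lemma le_L (b : B) : S.le (S.ρ b) (S.L b) := by
  rintro c ⟨A, i, p, hi, hp⟩
  have hi0 : i ≠ 0 := by
    rintro rfl
    exact Simple.not_isZero (S.L c) ((IsZero.of_mono_zero A (S.L b)).of_epi p)
  have := isIso_of_mono_of_nonzero hi0
  have h0 : inv i ≫ p ≠ 0 := by
    intro h
    have hp0 : p = 0 := by rwa [IsIso.inv_comp_eq, comp_zero] at h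
    subst hp0
    exact Simple.not_isZero (S.L c) (IsZero.of_epi_zero A (S.L c))
  have := isIso_of_hom_simple h0
  exact (congrArg S.ρ (S.eq_of_iso b c ⟨asIso (inv i ≫ p)⟩)).ge

/-- `L b` as an object of `R_{≤ ρ b}`. -/
abbrev LLe (b : B) : S.Le (S.ρ b) := ⟨S.L b, S.le_L b⟩

/-- The irreducible object `L_l(b) = j^l L(b)` of the stratum `R_l`, where `l = ρ b`. -/
abbrev LStratum (b : B) : S.Stratum (S.ρ b) := (S.j (S.ρ b)).obj (S.LLe b)

/-- `X ≅ Δ(b) = j^l_! P_l(b)`, where `l = ρ b` and `P_l(b)` is a projective cover of `L_l(b)`. -/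
def IsStandard (b : B) (X : R) : Prop :=
  ∃ (hX : S.le (S.ρ b) X) (P : S.Stratum (S.ρ b)) (p : P ⟶ S.LStratum b),
    IsProjectiveCover p ∧ IsLeftAdjointValue (S.j (S.ρ b)) P ⟨X, hX⟩

/-- `X ≅ Δ̄(b) = j^l_! L_l(b)`, where `l = ρ b`. -/
def IsProperStandard (b : B) (X : R) : Prop :=
  ∃ hX : S.le (S.ρ b) X, IsLeftAdjointValue (S.j (S.ρ b)) (S.LStratum b) ⟨X, hX⟩

/-- `X ≅ ∇(b) = j^l_* I_l(b)`, where `l = ρ b` and `I_l(b)` is an injective hull of `L_l(b)`. -/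
def IsCostandard (b : B) (X : R) : Prop :=
  ∃ (hX : S.le (S.ρ b) X) (I : S.Stratum (S.ρ b)) (i : S.LStratum b ⟶ I),
    IsInjectiveHull i ∧ IsRightAdjointValue (S.j (S.ρ b)) I ⟨X, hX⟩

/-- `X ≅ ∇̄(b) = j^l_* L_l(b)`, where `l = ρ b`. -/
def IsProperCostandard (b : B) (X : R) : Prop :=
  ∃ hX : S.le (S.ρ b) X, IsRightAdjointValue (S.j (S.ρ b)) (S.LStratum b) ⟨X, hX⟩

end Stratification

/-- The set of signs `{+, -}`. -/
inductive Sign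
  | plus
  | minus

namespace Stratification

variable {B : Type x} {Λ : Type y} [PartialOrder Λ] (S : Stratification R B Λ) (ε : Λ → Sign)

/-- `X ≅ Δ_ε(b)`, which is `Δ(b)` if `ε (ρ b) = +` and `Δ̄(b)` if `ε (ρ b) = -`. -/
def IsEpsStandard (b : B) (X : R) : Prop :=
  match ε (S.ρ b) with
  | .plus => S.IsStandard b X
  | .minus => S.IsProperStandard b X

/-- `X ≅ ∇_ε(b)`, which is `∇̄(b)` if `ε (ρ b) = +` and `∇(b)` if `ε (ρ b) = -`. -/
def IsEpsCostandard (b : B) (X : R) : Prop :=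
  match ε (S.ρ b) with
  | .plus => S.IsProperCostandard b X
  | .minus => S.IsCostandard b X

end Stratification

end Stratification

/-! ### The ind-completion and lower finite stratified categories -/

section Lower

variable {R : Type u} [SmallCategory R] [Abelian R]

/-- The canonical embedding of `R` in its ind-completion. -/
noncomputable abbrev toInd (X : R) : Ind R := (Ind.yoneda (C := R)).obj X

instance : (Ind.yoneda (C := R)).Additive := Functor.additive_of_preserves_binary_products _

/-- The `k`-vector space structure on `Hom (X, V)`, for `X` in `R` and `V` in `Ind R`, induced by
the `k`-linear structure of `R`: the scalar `a` acts through the endomorphism `a • 𝟙` of `X`. -/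
@[reducible]
noncomputable def homModule (k : Type w) [Field k] [Linear k R] (X : R) (V : Ind R) :
    Module k (toInd X ⟶ V) where
  smul a f := (Ind.yoneda (C := R)).map (a • 𝟙 X) ≫ f
  one_smul f := by
    change (Ind.yoneda (C := R)).map ((1 : k) • 𝟙 X) ≫ f = f
    simp
  mul_smul a b f := by
    change (Ind.yoneda (C := R)).map ((a * b) • 𝟙 X) ≫ f =
      (Ind.yoneda (C := R)).map (a • 𝟙 X) ≫ (Ind.yoneda (C := R)).map (b • 𝟙 X) ≫ f
    rw [← Category.assoc, ← Functor.map_comp]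
    simp [mul_smul, smul_comm b a]
  smul_zero a := comp_zero
  smul_add a f g := Preadditive.comp_add _ _ _ _ f g
  add_smul a b f := by
    change (Ind.yoneda (C := R)).map ((a + b) • 𝟙 X) ≫ f =
      (Ind.yoneda (C := R)).map (a • 𝟙 X) ≫ f + (Ind.yoneda (C := R)).map (b • 𝟙 X) ≫ f
    rw [add_smul, Functor.map_add, Preadditive.add_comp]
  zero_smul f := by
    change (Ind.yoneda (C := R)).map ((0 : k) • 𝟙 X) ≫ f = 0
    rw [zero_smul, Functor.map_zero, zero_comp]

/-- `dim Hom (X, V) < ∞`. -/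
def HomFiniteDimensional (k : Type w) [Field k] [Linear k R] (X : R) (V : Ind R) : Prop :=
  @Module.Finite k (toInd X ⟶ V) _ _ (homModule k X V)

namespace Stratification

variable {B : Type x} {Λ : Type y} [PartialOrder Λ] (S : Stratification R B Λ) (ε : Λ → Sign)

/-- The object `V` of `Ind R` belongs to `R` and has a `∇_ε`-flag with sections
`∇_ε(b₁), …, ∇_ε(bₙ)` from bottom to top. -/
def HasCostandardFlag (V : Ind R) (bs : List B) : Prop :=
  ∃ X : R, Nonempty (toInd X ≅ V) ∧ HasFlag (S.IsEpsCostandard ε) X bs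

/-- The directed set `F` of subobjects of `V` is an ascending `∇_ε`-flag in `V`: its sum (the
supremum in the lattice of subobjects) is `V`, and each of its members has a `∇_ε`-flag. -/
structure IsAscendingFlag (V : Ind R) (F : Set (Subobject V)) : Prop where
  nonempty : F.Nonempty
  directed : DirectedOn (· ≤ ·) F
  sum_eq : IsLUB F ⊤
  flag : ∀ W ∈ F, ∃ bs : List B, S.HasCostandardFlag ε (W : Ind R) bs

/-- The stratified category is lower finite `ε`-stratified: the poset is lower finite, and for each
`b` there is a finitely cogenerated injective object `I_b` of `Ind R` with an ascending `∇_ε`-flag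
in which every member has a `∇_ε`-flag with `∇_ε(b)` at the bottom and other sections `∇_ε(c)` with
`ρ c ≥ ρ b`. -/
structure IsLowerFiniteEpsStratified : Prop where
  lower_finite : ∀ l : Λ, (Set.Iic l).Finite
  exists_injective : ∀ b : B, ∃ I : Ind R, Injective I ∧ IsFinitelyCogenerated I ∧
    ∃ F : Set (Subobject I), S.IsAscendingFlag ε I F ∧ ∀ W ∈ F, ∃ bs : List B,
      S.HasCostandardFlag ε (W : Ind R) (b :: bs) ∧ ∀ c ∈ bs, S.ρ b ≤ S.ρ c

end Stratification

open Classical in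
/-- The multiplicity `(V : ∇_ε(c))` computed from an ascending flag `F` and from a choice `sec W` of
the list of sections of a `∇_ε`-flag of each of its members `W`: the supremum of the multiplicities
of `c` in these lists. -/
noncomputable def flagMultiplicity {B : Type x} {V : Ind R} (F : Set (Subobject V))
    (sec : Subobject V → List B) (c : B) : ℕ∞ :=
  ⨆ W ∈ F, ((sec W).count c : ℕ∞)

end Lower

end Strat

/-! All that is needed about `Δ_ε(b)` and `∇_ε(b)` can be said inside `R`: the strata they meet,
their simple top or socle, and the extensions they split (`StandardLike`, `CostandardLike`).
Together with the injective objects `I_c` this gives Ext¹(Δ_ε(b), ∇_ε(c)) = 0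
(`ext_one_standard_costandard`). If ρ(c) ≤ ρ(b), the extension splits by these properties. Otherwise
it suffices to extend simple objects L(d) with ρ(c) ≰ ρ(d) by ∇_ε(c): a non-split extension would
embed in an object with a flag in strata ≥ ρ(c), which confines it to R_{≤ρ(c)}, where it splits
after all.

The crux is the next degree. Shifting along ∇_ε(c) ⊆ I_c reduces Ext²(Δ_ε(b), ∇_ε(c)) to
Ext¹(Δ_ε(b), W/∇_ε(c)), where W has a flag in strata ≥ ρ(c). That group vanishes
(`ext_one_quotient`): the sections in stratum ρ(c) can be moved to the bottom of W, and the copy of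
∇_ε(c) must lie among them.

Now let Ext¹(Δ_ε(b), V) = 0 for all b. If L(c) embeds in V with ρ(c) minimal, the embedding extends
to one of ∇_ε(c). By the vanishing of Ext² the quotient satisfies the same hypothesis, while the sum
of dim Hom(Δ_ε(b), V) over a finite lower set of labels drops. Hence for each such set V has a
subobject with a flag whose quotient has no simple subobject labelled by the set
(`exists_flag_subobject`), and these subobjects exhaust V. Applied to W/∇_ε(c), this yields a flag
there, so the dimension shift iterates and all Extⁿ(Δ_ε(b), ∇_ε(c)) with n ≥ 1 vanish. The vanishing
passes to ascending flags because Ext classes from objects of `R` into an ind-object come from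
objects of `R` (`exists_ext_factor`).

An injective hull of L(b) satisfies the Ext¹ condition trivially. Since dim Hom(Δ_ε(b), ∇_ε(c)) is 1
for b = c and 0 otherwise, flag multiplicities are the dimensions of Hom(Δ_ε(c), −). For I(b) this
dimension is exact in the first argument, and Schur's lemma identifies it with [Δ_ε(c) : L(b)]. -/

namespace Strat

/-! ### Uniqueness of covers and universal arrows, and duality. -/

section Covers

variable {C : Type u} [Category.{v} C]

/-- Projective covers are unique up to isomorphism. -/
lemma IsProjectiveCover.nonempty_iso {P P' X : C} {p : P ⟶ X} {p' : P' ⟶ X}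
    (hp : IsProjectiveCover p) (hp' : IsProjectiveCover p') :
    Nonempty (P ≅ P') := by
  obtain ⟨_, _, h⟩ := hp
  obtain ⟨_, _, h'⟩ := hp'
  let f := Projective.factorThru p p'
  have hf : f ≫ p' = p := Projective.factorThru_comp _ _
  have : Epi f := h' f (by rw [hf]; infer_instance)
  let s := Projective.factorThru (𝟙 P') f
  have hs : s ≫ f = 𝟙 _ := Projective.factorThru_comp _ _
  have : Epi s := h s (by rw [← hf, reassoc_of% hs]; infer_instance)
  have : IsSplitMono s := ⟨⟨f, hs⟩⟩
  have : IsIso s := isIso_of_epi_of_isSplitMono s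
  exact ⟨(asIso s).symm⟩

lemma IsLeftAdjointValue.nonempty_iso {D : Type u'} [Category.{v'} D] {j : C ⥤ D} {P P' : D}
    {X X' : C} (h : IsLeftAdjointValue j P X) (h' : IsLeftAdjointValue j P' X') (i : P ≅ P') :
    Nonempty (X ≅ X') := by
  obtain ⟨e, he⟩ := h
  obtain ⟨e', he'⟩ := h'
  obtain ⟨f, hf, -⟩ := he X' (i.hom ≫ e')
  obtain ⟨g, hg, -⟩ := he' X (i.inv ≫ e)
  refine ⟨⟨f, g, ?_, ?_⟩⟩
  · apply (he X e).unique _ (by simp)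
    rw [j.map_comp, reassoc_of% hf, hg, i.hom_inv_id_assoc]
  · apply (he' X' e').unique _ (by simp)
    rw [j.map_comp, reassoc_of% hg, hf, i.inv_hom_id_assoc]

/-- With its analogue for adjoint values, this lets every statement on the injective side be deduced
from the projective side. -/
lemma isInjectiveHull_iff_op {X I : C} (i : X ⟶ I) :
    IsInjectiveHull i ↔ IsProjectiveCover i.op := by
  constructor
  · rintro ⟨_, _, h⟩
    refine ⟨inferInstance, inferInstance, fun Z f hf => ?_⟩
    have : Mono (i ≫ f.unop) := by
      rw [show i ≫ f.unop = (f ≫ i.op).unop from rfl]; infer_instance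
    have := h f.unop this
    exact (inferInstance : Epi f.unop.op)
  · rintro ⟨h1, h2, h⟩
    refine ⟨Injective.injective_iff_projective_op.2 h1,
      (inferInstance : Mono i.op.unop), fun Z f hf => ?_⟩
    have := h f.op (by rw [← op_comp]; infer_instance)
    exact (inferInstance : Mono f.op.unop)

lemma isRightAdjointValue_iff_op {D : Type u'} [Category.{v'} D] (j : C ⥤ D) (I : D) (X : C) :
    IsRightAdjointValue j I X ↔
      IsLeftAdjointValue j.op (Opposite.op I) (Opposite.op X) := by
  constructor
  · rintro ⟨e, he⟩
    refine ⟨e.op, fun Y f => ?_⟩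
    obtain ⟨g, hg, hu⟩ := he Y.unop f.unop
    refine ⟨g.op, Quiver.Hom.unop_inj hg, fun g' hg' => Quiver.Hom.unop_inj ?_⟩
    exact hu g'.unop (Quiver.Hom.op_inj hg')
  · rintro ⟨e, he⟩
    refine ⟨e.unop, fun Y f => ?_⟩
    obtain ⟨g, hg, hu⟩ := he (Opposite.op Y) f.op
    refine ⟨g.unop, Quiver.Hom.op_inj hg, fun g' hg' => Quiver.Hom.op_inj ?_⟩
    exact hu g'.op (Quiver.Hom.unop_inj hg')

end Covers

/-! ### Projective covers and essential epimorphisms for objects of finite length. -/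

section Finite

variable {C : Type u} [Category.{v} C] [Abelian C]

lemma isArtinianObject_op {X : C} [IsNoetherianObject X] :
    IsArtinianObject (Opposite.op X) := by
  refine ⟨?_⟩
  exact ((Abelian.subobjectIsoSubobjectOp X).symm.dual.toOrderEmbedding.wellFoundedLT :)

lemma isNoetherianObject_op {X : C} [IsArtinianObject X] :
    IsNoetherianObject (Opposite.op X) := by
  refine ⟨?_⟩
  exact ((Abelian.subobjectIsoSubobjectOp X).symm.dual.toOrderEmbedding.wellFoundedGT :)

/-- Surjective endomorphisms of noetherian objects are isomorphisms. -/
lemma isIso_of_epi_endo {X : C} [IsNoetherianObject X] (f : X ⟶ X) [Epi f] : IsIso f := by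
  suffices Mono f from isIso_of_mono_of_epi f
  obtain ⟨F, hF0, hF⟩ : ∃ F : ℕ → (X ⟶ X), F 0 = 𝟙 X ∧ ∀ n, F (n + 1) = F n ≫ f :=
    ⟨fun n => Nat.rec (𝟙 X) (fun _ g => g ≫ f) n, rfl, fun _ => rfl⟩
  have hepi : ∀ n, Epi (F n) := by
    intro n
    induction n with
    | zero => rw [hF0]; infer_instance
    | succ n ih => rw [hF]; exact epi_comp (F n) f
  let K : ℕ →o Subobject X := ⟨fun n => kernelSubobject (F n), monotone_nat_of_le_succ
    fun n => by rw [hF]; exact kernelSubobject_comp_le _ _⟩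
  obtain ⟨n, hn⟩ := monotone_chain_condition_of_isNoetherianObject K
  have h1 : kernelSubobject (F n) = kernelSubobject (F (n + 1)) := hn (n + 1) (by omega)
  apply Preadditive.mono_of_cancel_zero
  intro Z g hg
  have := hepi n
  have hz : pullback.fst (F n) g ≫ F (n + 1) = 0 := by
    rw [hF, pullback.condition_assoc, hg, comp_zero]
  have hz2 : pullback.fst (F n) g ≫ F n = 0 := by
    have := (kernelSubobject_factors_iff (F (n + 1)) (pullback.fst (F n) g)).2 hz
    rw [← h1] at this
    exact (kernelSubobject_factors_iff _ _).1 this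
  rw [pullback.condition] at hz2
  exact (cancel_epi (pullback.snd (F n) g)).1 (by rw [hz2, comp_zero])

/-- Existence of projective covers of quotients of projective objects of finite length. -/
lemma exists_isProjectiveCover_of_epi {Q X : C} (q : Q ⟶ X) [Projective Q] [Epi q]
    [IsArtinianObject Q] [IsNoetherianObject Q] :
    ∃ (P : C) (p : P ⟶ X), IsProjectiveCover p := by
  obtain ⟨A, hA, hmin⟩ := (wellFounded_lt (α := Subobject Q)).has_min
    {A | Epi (A.arrow ≫ q)} ⟨⊤, by
      change Epi _
      infer_instance⟩
  change Epi (A.arrow ≫ q) at hA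
  have hess : ∀ ⦃Z : C⦄ (f : Z ⟶ (A : C)), Epi (f ≫ A.arrow ≫ q) → Epi f := by
    intro Z f hf
    have hle : Subobject.mk (image.ι f ≫ A.arrow) ≤ A :=
      Subobject.mk_le_of_comm (image.ι f) rfl
    have he : Epi ((Subobject.mk (image.ι f ≫ A.arrow)).arrow ≫ q) := by
      have h1 : f ≫ A.arrow ≫ q = (factorThruImage f ≫
          (Subobject.underlyingIso (image.ι f ≫ A.arrow)).inv) ≫
          ((Subobject.mk (image.ι f ≫ A.arrow)).arrow ≫ q) := by simp
      rw [h1] at hf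
      exact epi_of_epi (factorThruImage f ≫
        (Subobject.underlyingIso (image.ι f ≫ A.arrow)).inv)
        ((Subobject.mk (image.ι f ≫ A.arrow)).arrow ≫ q)
    have heq : Subobject.mk (image.ι f ≫ A.arrow) = A := by
      by_contra hne
      exact hmin _ he (lt_of_le_of_ne hle hne)
    have hg : (Subobject.isoOfEqMk A (image.ι f ≫ A.arrow) heq.symm).hom ≫ image.ι f = 𝟙 _ := by
      rw [← cancel_mono A.arrow]
      simp [Subobject.ofLEMk_comp]
    have : Epi (image.ι f) := by
      have : Epi ((Subobject.isoOfEqMk A (image.ι f ≫ A.arrow) heq.symm).hom ≫ image.ι f) := by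
        rw [hg]; infer_instance
      exact epi_of_epi (Subobject.isoOfEqMk A (image.ι f ≫ A.arrow) heq.symm).hom (image.ι f)
    rw [← image.fac f]
    exact epi_comp _ _
  refine ⟨(A : C), A.arrow ≫ q, ?_, hA, hess⟩
  let h := Projective.factorThru q (A.arrow ≫ q)
  have hh : h ≫ A.arrow ≫ q = q := Projective.factorThru_comp _ _
  have : Epi (A.arrow ≫ h) := hess _ (by
    rw [Category.assoc, hh]; exact hA)
  have : IsNoetherianObject (A : C) := isNoetherianObject_of_mono A.arrow
  have := isIso_of_epi_endo (A.arrow ≫ h)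
  exact Retract.projective ⟨A.arrow, h ≫ inv (A.arrow ≫ h), by
    rw [← Category.assoc, IsIso.hom_inv_id]⟩

/-- If `p : P ⟶ L` is an essential epimorphism onto a simple object and `f : P ⟶ Y` is nonzero,
then `L` is a quotient of the image of `f`. -/
lemma exists_epi_image_of_essential {P L Y : C} [Simple L] {p : P ⟶ L} [Epi p]
    (hp : ∀ ⦃Z : C⦄ (f : Z ⟶ P), Epi (f ≫ p) → Epi f) {f : P ⟶ Y} (hf : f ≠ 0) :
    ∃ q : Abelian.image f ⟶ L, Epi q ∧ Abelian.factorThruImage f ≫ q = p := by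
  have h0 : kernel.ι f ≫ p = 0 := by
    by_contra h
    have : Epi (kernel.ι f) := hp _ (epi_of_nonzero_to_simple h)
    exact hf ((cancel_epi (kernel.ι f)).1 (by rw [kernel.condition, comp_zero]))
  have h0' : kernel.ι (Abelian.factorThruImage f) ≫ p = 0 := by
    have : kernel.ι (Abelian.factorThruImage f) ≫ f = 0 := by
      calc _ = kernel.ι (Abelian.factorThruImage f) ≫ Abelian.factorThruImage f ≫
            Abelian.image.ι f := by rw [Abelian.image.fac]
        _ = 0 := by rw [kernel.condition_assoc, zero_comp]
    rw [← kernel.lift_ι f _ this, Category.assoc, h0, comp_zero]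
  refine ⟨Abelian.epiDesc (Abelian.factorThruImage f) p h0', ?_, Abelian.comp_epiDesc _ _ _⟩
  have : Epi (Abelian.factorThruImage f ≫ Abelian.epiDesc (Abelian.factorThruImage f) p h0') := by
    rw [Abelian.comp_epiDesc]; infer_instance
  exact epi_of_epi (Abelian.factorThruImage f) _

lemma isSubquotient_of_essential {P L Y : C} [Simple L] {p : P ⟶ L} [Epi p]
    (hp : ∀ ⦃Z : C⦄ (f : Z ⟶ P), Epi (f ≫ p) → Epi f) {f : P ⟶ Y} (hf : f ≠ 0) :
    IsSubquotient L Y := by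
  obtain ⟨q, hq, -⟩ := exists_epi_image_of_essential hp hf
  exact ⟨_, Abelian.image.ι f, q, inferInstance, hq⟩

end Finite

/-! ### Colocal objects and Serre quotients. -/

section Colocal

variable {C : Type u} [Category.{v} C] [Abelian C] (P : ObjectProperty C) [P.IsSerreClass]

/-- An object `X` is colocal with respect to a Serre class if `Hom (X, -)` inverts the
isomorphisms modulo this class. -/
def IsColocal (X : C) : Prop :=
  ∀ ⦃Y Y' : C⦄ (s : Y ⟶ Y'), P.isoModSerre s → ∀ g : X ⟶ Y', ∃! h : X ⟶ Y, h ≫ s = g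

variable {P}

/-- Morphisms in the quotient are right fractions, and colocality splits every denominator with
target `X`. -/
lemma IsColocal.map_bijective {X : C} (hX : IsColocal P X) {D : Type u'} [Category.{v'} D]
    (Q : C ⥤ D) [Q.IsLocalization P.isoModSerre] (Y : C) :
    Function.Bijective (fun g : X ⟶ Y => Q.map g) := by
  constructor
  · intro f g hfg
    obtain ⟨Z, s, hs, h⟩ := (MorphismProperty.map_eq_iff_precomp Q P.isoModSerre f g).1 hfg
    obtain ⟨t, ht, -⟩ := hX s hs (𝟙 X)
    rw [← Category.id_comp f, ← Category.id_comp g, ← ht, Category.assoc, Category.assoc, h]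
  · intro f
    obtain ⟨φ, rfl⟩ := Localization.exists_rightFraction Q P.isoModSerre f
    obtain ⟨t, ht, -⟩ := hX φ.s φ.hs (𝟙 X)
    refine ⟨t ≫ φ.f, ?_⟩
    dsimp only
    rw [Q.map_comp, ← φ.map_s_comp_map Q (Localization.inverts _ _), ← Q.map_comp_assoc, ht,
      Q.map_id, Category.id_comp]

lemma IsColocal.exists_section {X E : C} (hX : IsColocal P X) (q : E ⟶ X) [Epi q]
    (hq : P (kernel q)) : ∃ s : X ⟶ E, s ≫ q = 𝟙 X :=
  (hX q (P.isoModSerre_of_epi q hq) (𝟙 X)).exists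

/-- Bijectivity of `Q` on morphisms out of `X` makes the identity of `Q.obj X` a universal arrow. -/
lemma IsColocal.isLeftAdjointValue {X : C} (hX : IsColocal P X) {D : Type u'} [Category.{v'} D]
    (Q : C ⥤ D) [Q.IsLocalization P.isoModSerre] {Z : D} (e : Z ≅ Q.obj X) :
    IsLeftAdjointValue Q Z X := by
  refine ⟨e.hom, fun Y f => ?_⟩
  obtain ⟨g, hg⟩ := (hX.map_bijective Q Y).2 (e.inv ≫ f)
  dsimp only at hg
  refine ⟨g, by simp [hg], fun g' hg' => (hX.map_bijective Q Y).1 ?_⟩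
  dsimp only at hg' ⊢
  rw [hg, ← hg', e.inv_hom_id_assoc]

/-- A quotient of a projective object `P₀` by a subobject `K` is colocal if neither of `P₀`, `K`
has nonzero morphisms to objects of the Serre class. -/
lemma isColocal_of_presentation {P₀ X : C} [Projective P₀] (p : P₀ ⟶ X) [Epi p]
    (h₀ : ∀ (Y : C), P Y → ∀ f : P₀ ⟶ Y, f = 0)
    (h₁ : ∀ (Y : C), P Y → ∀ f : kernel p ⟶ Y, f = 0) : IsColocal P X := by
  intro Y Y' s hs g
  have h2 : ∀ {T : C}, (∀ (Y : C), P Y → ∀ f : T ⟶ Y, f = 0) → ∀ f : T ⟶ Y, f ≫ s = 0 → f = 0 := by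
    intro T hT f hf
    rw [← kernel.lift_ι s f hf, hT _ hs.1 (kernel.lift s f hf), zero_comp]
  have h3 : p ≫ g ≫ cokernel.π s = 0 := h₀ _ hs.2 _
  have h4 : (p ≫ g) ≫ cokernel.π s = 0 := by rwa [Category.assoc]
  let k : P₀ ⟶ Abelian.image s := kernel.lift _ (p ≫ g) h4
  have hk : k ≫ Abelian.image.ι s = p ≫ g := kernel.lift_ι _ _ _
  let l : P₀ ⟶ Y := Projective.factorThru k (Abelian.factorThruImage s)
  have hl : l ≫ s = p ≫ g := by
    rw [← hk, ← Projective.factorThru_comp k (Abelian.factorThruImage s), Category.assoc,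
      Abelian.image.fac]
  have hl' : kernel.ι p ≫ l = 0 := h2 h₁ _ (by
    rw [Category.assoc, hl, kernel.condition_assoc, zero_comp])
  refine ⟨Abelian.epiDesc p l hl', ?_, ?_⟩
  · dsimp only
    rw [← cancel_epi p, Abelian.comp_epiDesc_assoc, hl]
  · intro h' hh'
    rw [← cancel_epi p, Abelian.comp_epiDesc, ← sub_eq_zero]
    apply h2 h₀
    rw [Preadditive.sub_comp, hl, Category.assoc, hh', sub_self]

/-- The image of a nonzero `f` would lie in the class and have `L` as a quotient. -/
lemma IsProjectiveCover.eq_zero {P₀ L : C} [Simple L] {p : P₀ ⟶ L} (hp : IsProjectiveCover p)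
    (hL : ¬ P L) (Y : C) (hY : P Y) (f : P₀ ⟶ Y) : f = 0 := by
  by_contra hf
  obtain ⟨_, _, h⟩ := hp
  obtain ⟨q, hq, -⟩ := exists_epi_image_of_essential h hf
  exact hL (P.prop_of_epi q (P.prop_of_mono (Abelian.image.ι f) hY))

lemma IsProjectiveCover.isColocal {P₀ L : C} [Simple L] {p : P₀ ⟶ L} (hp : IsProjectiveCover p)
    (hL : ¬ P L) : IsColocal P P₀ := by
  have := hp.1
  refine isColocal_of_presentation (𝟙 P₀) (hp.eq_zero hL) fun Y _ f => ?_
  have : IsZero (kernel (𝟙 P₀)) := isZero_kernel_of_mono _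
  exact this.eq_of_src _ _

open ObjectProperty.SerreClassLocalization in
/-- The quotient functor by a Serre class maps a projective cover of a simple object which is not
in the class to a projective cover. -/
lemma IsProjectiveCover.map {P₀ L : C} [Simple L] {p : P₀ ⟶ L} (hp : IsProjectiveCover p)
    (hL : ¬ P L) {D : Type u'} [Category.{v'} D] [Preadditive D] (Q : C ⥤ D)
    [Q.IsLocalization P.isoModSerre] [Q.Additive] : IsProjectiveCover (Q.map p) := by
  have hcol := hp.isColocal hL
  have h0 := hp.eq_zero hL
  obtain ⟨_, _, hess⟩ := hp
  have := preservesEpimorphisms Q P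
  have := Localization.essSurj Q P.isoModSerre
  refine ⟨⟨fun {E F} f g hg => ?_⟩, inferInstance, fun Z f hf => ?_⟩
  -- Up to isomorphism an epimorphism of the quotient is the image of an epimorphism of `C`, so the
  -- lifting problem can be solved in `C`, where the colocal `P₀` is projective.
  · obtain ⟨X', Y', f', hf', ⟨e⟩⟩ := (epi_iff Q P g).1 hg
    obtain ⟨φ, hφ⟩ := (hcol.map_bijective Q Y').2 (f ≫ e.inv.right)
    dsimp only at hφ
    refine ⟨Q.map (Projective.factorThru φ f') ≫ e.hom.left, ?_⟩
    have hw : e.hom.left ≫ g = Q.map f' ≫ e.hom.right := e.hom.w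
    rw [Category.assoc, hw, ← Q.map_comp_assoc, Projective.factorThru_comp, hφ, Category.assoc,
      ← Arrow.comp_right, e.inv_hom_id, Arrow.id_right]
    exact Category.comp_id _
  · obtain ⟨φ, hφ⟩ := Localization.exists_rightFraction Q P.isoModSerre
      ((Q.objObjPreimageIso Z).hom ≫ f)
    have h1 : Q.map φ.s ≫ (Q.objObjPreimageIso Z).hom ≫ f = Q.map φ.f := by
      rw [hφ, φ.map_s_comp_map]
    have := Localization.inverts Q P.isoModSerre _ φ.hs
    have h2 : Epi (Q.map (φ.f ≫ p)) := by
      rw [Q.map_comp, ← h1, Category.assoc, Category.assoc]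
      infer_instance
    rw [epi_map_iff Q P] at h2
    -- If this composite vanished, the simple object `L` itself would be the cokernel that has to
    -- lie in the class.
    have h3 : φ.f ≫ p ≠ 0 := by
      intro h
      rw [h, ObjectProperty.epiModSerre_zero_iff] at h2
      exact hL h2
    have : Epi φ.f := hess _ (epi_of_nonzero_to_simple h3)
    have h4 : Epi (Q.map φ.f) := inferInstance
    rw [← h1] at h4
    have h5 : Epi (((Q.map φ.s) ≫ (Q.objObjPreimageIso Z).hom) ≫ f) := by
      rwa [Category.assoc]
    exact epi_of_epi (Q.map φ.s ≫ (Q.objObjPreimageIso Z).hom) f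

/-- An artinian object has a smallest subobject with quotient in a given Serre class, and this
subobject has no nonzero morphism to an object of the class. -/
lemma exists_smallest_cokernel (P : ObjectProperty C) [P.IsSerreClass] (A : C)
    [IsArtinianObject A] : ∃ (K : C) (i : K ⟶ A), Mono i ∧ P (cokernel i) ∧
      ∀ (Y : C), P Y → ∀ f : K ⟶ Y, f = 0 := by
  obtain ⟨K, hK, hmin⟩ := (wellFounded_lt (α := Subobject A)).has_min
    {K | P (cokernel K.arrow)} ⟨⊤, P.prop_of_isZero (isZero_cokernel_of_epi _)⟩
  change P (cokernel K.arrow) at hK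
  refine ⟨_, K.arrow, inferInstance, hK, fun Y hY f => ?_⟩
  -- The kernel of `f` competes with `K`: its cokernel in `A` is an extension of `A / K` by the
  -- image of `f`. Minimality forces the kernel to be all of `K`.
  let m : kernel f ⟶ A := kernel.ι f ≫ K.arrow
  have hm : P (cokernel m) := by
    refine (P.epiModSerre.comp_mem (kernel.ι f) K.arrow ?_ hK : P.epiModSerre m)
    exact P.prop_of_mono (Abelian.image.ι f) hY |> P.prop_of_iso
      (Abelian.coimageIsoImage f).symm
  have hle : Subobject.mk m ≤ K := Subobject.mk_le_of_comm (kernel.ι f) rfl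
  have heq : Subobject.mk m = K := by
    by_contra hne
    refine hmin (Subobject.mk m) ?_ (lt_of_le_of_ne hle hne)
    change P _
    have : P.epiModSerre ((Subobject.underlyingIso m).hom ≫ m) :=
      P.epiModSerre.comp_mem _ _ (P.epiModSerre_of_epi _) hm
    rwa [Subobject.underlyingIso_hom_comp_eq_mk] at this
  have hg : (Subobject.isoOfEqMk K m heq.symm).hom ≫ kernel.ι f = 𝟙 _ := by
    rw [← cancel_mono K.arrow]
    simp [m, Subobject.ofLEMk_comp]
  rw [← Category.id_comp f, ← hg, Category.assoc, kernel.condition, comp_zero]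

/-- The largest quotient of a projective cover of `L` which is isomorphic to `L` modulo the Serre
class. -/
lemma IsProjectiveCover.exists_proper {P₀ L : C} [Simple L] {p : P₀ ⟶ L}
    (hp : IsProjectiveCover p) (hL : ¬ P L) [IsArtinianObject P₀] :
    ∃ (X : C) (q : X ⟶ L), Epi q ∧ (∀ ⦃Z : C⦄ (f : Z ⟶ X), Epi (f ≫ q) → Epi f) ∧
      P (kernel q) ∧ IsColocal P X := by
  have h0 := hp.eq_zero hL
  obtain ⟨_, _, hess⟩ := hp
  have : IsArtinianObject (kernel p) := isArtinianObject_of_mono (kernel.ι p)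
  obtain ⟨K, i, hi, hK, hK0⟩ := exists_smallest_cokernel P (kernel p)
  -- The required object is `P₀ / K`. It agrees with `L` modulo the class because `ker p / K` is in
  -- the class, and it is colocal because `K` has no nonzero morphism to the class.
  let c : P₀ ⟶ cokernel (i ≫ kernel.ι p) := cokernel.π _
  let q : cokernel (i ≫ kernel.ι p) ⟶ L := cokernel.desc _ p (by simp)
  have hcq : c ≫ q = p := cokernel.π_desc _ _ _
  have hq : Epi q := by
    have : Epi (c ≫ q) := by rw [hcq]; infer_instance
    exact epi_of_epi c q
  refine ⟨_, q, hq, ?_, ?_, ?_⟩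
  · intro Z f hf
    have h1 : Epi (pullback.snd f c ≫ p) := by
      have : pullback.snd f c ≫ p = pullback.fst f c ≫ f ≫ q := by
        rw [pullback.condition_assoc]
        exact congrArg _ hcq.symm
      rw [this]
      exact epi_comp _ _
    have h2 := hess _ h1
    have h3 : Epi (pullback.fst f c ≫ f) := by
      rw [pullback.condition]; exact epi_comp _ _
    exact epi_of_epi (pullback.fst f c) f
  · have ex := (kernelCokernelCompSequence_exact c q)
    have h1 : (kernel.ι p ≫ c) ≫ q = 0 := by rw [Category.assoc, hcq, kernel.condition]
    have h2 : i ≫ kernel.ι p ≫ c = 0 := by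
      rw [← Category.assoc]; exact cokernel.condition _
    let t : cokernel i ⟶ kernel q := cokernel.desc i (kernel.lift q (kernel.ι p ≫ c) h1) (by
      rw [← cancel_mono (kernel.ι q), Category.assoc, kernel.lift_ι, h2, zero_comp])
    have ht : cokernel.π i ≫ t = kernel.lift q (kernel.ι p ≫ c) h1 := cokernel.π_desc _ _ _
    suffices Epi t from P.prop_of_epi t hK
    suffices Epi (kernel.lift q (kernel.ι p ≫ c) h1) by
      rw [← ht] at this
      exact epi_of_epi (cokernel.π i) t
    rw [epi_iff_surjective_up_to_refinements]
    intro A y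
    obtain ⟨A', π, hπ, z, hz⟩ := surjective_up_to_refinements_of_epi c (y ≫ kernel.ι q)
    refine ⟨A', π, hπ, kernel.lift p z ?_, ?_⟩
    · rw [← hcq, ← reassoc_of% hz, kernel.condition, comp_zero, comp_zero]
    · rw [← cancel_mono (kernel.ι q), Category.assoc, Category.assoc, kernel.lift_ι,
        kernel.lift_ι_assoc, hz]
  · refine isColocal_of_presentation c h0 fun Y hY f => ?_
    let e : K ⟶ kernel c := kernel.lift c (i ≫ kernel.ι p) (cokernel.condition _)
    have he : IsIso e := by
      have : Mono (e ≫ kernel.ι c) := by rw [kernel.lift_ι]; infer_instance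
      have : Mono e := mono_of_mono e (kernel.ι c)
      have : Epi e := by
        let w : kernel c ⟶ K := Abelian.monoLift (i ≫ kernel.ι p) (kernel.ι c)
          (kernel.condition c)
        have hw : w ≫ e = 𝟙 _ := by
          rw [← cancel_mono (kernel.ι c), Category.assoc, kernel.lift_ι, Category.id_comp]
          exact Abelian.monoLift_comp _ _ _
        have : Epi (w ≫ e) := by rw [hw]; infer_instance
        exact epi_of_epi w e
      exact isIso_of_mono_of_epi e
    rw [← cancel_epi e, comp_zero]
    exact hK0 Y hY _

open ObjectProperty in
instance isSerreClass_op (P : ObjectProperty C) [P.IsSerreClass] : P.op.IsSerreClass where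
  exists_zero := ⟨Opposite.op 0, (isZero_zero C).op, P.prop_zero⟩
  prop_of_mono f _ hY := P.prop_of_epi f.unop hY
  prop_of_epi f _ hX := P.prop_of_mono f.unop hX
  prop_X₂_of_shortExact hS h₁ h₃ := P.prop_X₂_of_shortExact hS.unop h₃ h₁

/-- Passing to the opposite category swaps kernel and cokernel, and the condition is symmetric in
the two. So `Q.op` is again a Serre quotient functor. -/
lemma isoModSerre_op (P : ObjectProperty C) [P.IsSerreClass] :
    P.op.isoModSerre = P.isoModSerre.op := by
  ext X Y f
  have h1 : P.op.monoModSerre f ↔ P.epiModSerre f.unop :=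
    (P.op.prop_iff_of_iso (cokernelUnopOp f).symm :)
  have h2 : P.op.epiModSerre f ↔ P.monoModSerre f.unop :=
    (P.op.prop_iff_of_iso (kernelUnopOp f).symm :)
  rw [ObjectProperty.isoModSerre_iff, h1, h2, and_comm]
  rfl

end Colocal

/-! ### Simple objects in the opposite category. -/

section Simple

variable {C : Type u} [Category.{v} C] [Abelian C]

instance simple_op (X : C) [Simple X] : Simple (Opposite.op X) where
  mono_isIso_iff_nonzero {Y} f _ := by
    constructor
    · rintro _ rfl
      exact Simple.not_isZero X (IsZero.of_mono_zero (C := Cᵒᵖ) Y (Opposite.op X) |> fun _ =>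
        (IsZero.of_epi_zero (C := Cᵒᵖ) Y (Opposite.op X)).unop)
    · intro h
      have : IsIso f.unop := isIso_of_epi_of_nonzero (f := f.unop) (by
        rintro h'
        exact h (Quiver.Hom.unop_inj h'))
      exact (isIso_unop_iff f).1 this

end Simple

/-! ### Adjoint values at simple objects of a Serre quotient and at their covers and hulls. -/

section Quotient

variable {C : Type u} [Category.{v} C] [Abelian C] {P : ObjectProperty C} [P.IsSerreClass]
  {D : Type u'} [Category.{v'} D] [Preadditive D] (Q : C ⥤ D) [Q.IsLocalization P.isoModSerre]
  [Q.Additive] (hA : ∀ X : C, IsArtinianObject X) (hN : ∀ X : C, IsNoetherianObject X)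
  (L : C) [Simple L] (hL : ¬ P L)

include hA hN hL

-- The projective cover of `L` in `C` itself serves: its top is outside the class, so it is colocal
-- and `Q` keeps it a projective cover.
omit [Q.Additive] [Preadditive D] [Q.IsLocalization P.isoModSerre] in
lemma exists_leftAdjointValue_projectiveCover [EnoughProjectives C] [Preadditive D]
    [Q.IsLocalization P.isoModSerre] [Q.Additive] :
    ∃ X : C, (∃ (P₀ : D) (p₀ : P₀ ⟶ Q.obj L), IsProjectiveCover p₀ ∧ IsLeftAdjointValue Q P₀ X) ∧
      Projective X ∧ IsColocal P X ∧
      ∃ p : X ⟶ L, Epi p ∧ ∀ ⦃Z : C⦄ (f : Z ⟶ X), Epi (f ≫ p) → Epi f := by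
  have := hA (Projective.over L)
  have := hN (Projective.over L)
  obtain ⟨X, p, hp⟩ := exists_isProjectiveCover_of_epi (Projective.π L)
  exact ⟨X, ⟨_, Q.map p, hp.map hL Q, (hp.isColocal hL).isLeftAdjointValue Q (Iso.refl _)⟩, hp.1,
    hp.isColocal hL, p, hp.2⟩

-- Here the projective cover is cut down to a colocal quotient which `Q` identifies with `L`.
omit [Preadditive D] [Q.Additive] in
lemma exists_leftAdjointValue_simple [EnoughProjectives C] :
    ∃ X : C, IsLeftAdjointValue Q (Q.obj L) X ∧ IsColocal P X ∧
      ∃ p : X ⟶ L, Epi p ∧ (∀ ⦃Z : C⦄ (f : Z ⟶ X), Epi (f ≫ p) → Epi f) ∧ P (kernel p) := by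
  have := hA (Projective.over L)
  have := hN (Projective.over L)
  obtain ⟨P₀, p, hp⟩ := exists_isProjectiveCover_of_epi (Projective.π L)
  have := hA P₀
  obtain ⟨X, q, hq, hess, hk, hX⟩ := hp.exists_proper hL
  have : IsIso (Q.map q) := Localization.inverts Q P.isoModSerre q (P.isoModSerre_of_epi q hk)
  exact ⟨X, hX.isLeftAdjointValue Q (asIso (Q.map q)).symm, hX, q, hq, hess, hk⟩

lemma exists_rightAdjointValue_injectiveHull [EnoughInjectives C] :
    ∃ X : C, (∃ (I : D) (i : Q.obj L ⟶ I), IsInjectiveHull i ∧ IsRightAdjointValue Q I X) ∧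
      Injective X ∧ IsColocal P.op (Opposite.op X) ∧
      ∃ i : L ⟶ X, Mono i ∧ ∀ ⦃Z : C⦄ (f : X ⟶ Z), Mono (i ≫ f) → Mono f := by
  have hA' : ∀ X : Cᵒᵖ, IsArtinianObject X := fun X =>
    have := hN X.unop
    isArtinianObject_op (X := X.unop)
  have hN' : ∀ X : Cᵒᵖ, IsNoetherianObject X := fun X =>
    have := hA X.unop
    isNoetherianObject_op (X := X.unop)
  have : Q.op.IsLocalization P.op.isoModSerre := by
    rw [isoModSerre_op]; infer_instance
  obtain ⟨X, ⟨I, i, hi, hI⟩, hX, hcol, p, hp, hess⟩ :=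
    exists_leftAdjointValue_projectiveCover Q.op hA' hN' (Opposite.op L) (P := P.op) hL
  refine ⟨X.unop, ⟨I.unop, i.unop, (isInjectiveHull_iff_op _).2 hi,
    (isRightAdjointValue_iff_op _ _ _).2 hI⟩, Injective.injective_iff_projective_op.2 hX, hcol,
    p.unop, inferInstance, fun Z f hf => ?_⟩
  have := hess f.op (by
    rw [← Quiver.Hom.op_unop p, ← op_comp]; infer_instance)
  exact (inferInstance : Mono f.op.unop)

omit [Preadditive D] [Q.Additive] in
lemma exists_rightAdjointValue_simple [EnoughInjectives C] :
    ∃ X : C, IsRightAdjointValue Q (Q.obj L) X ∧ IsColocal P.op (Opposite.op X) ∧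
      ∃ i : L ⟶ X, Mono i ∧ (∀ ⦃Z : C⦄ (f : X ⟶ Z), Mono (i ≫ f) → Mono f) ∧
        P (cokernel i) := by
  have hA' : ∀ X : Cᵒᵖ, IsArtinianObject X := fun X =>
    have := hN X.unop
    isArtinianObject_op (X := X.unop)
  have hN' : ∀ X : Cᵒᵖ, IsNoetherianObject X := fun X =>
    have := hA X.unop
    isNoetherianObject_op (X := X.unop)
  have : Q.op.IsLocalization P.op.isoModSerre := by
    rw [isoModSerre_op]; infer_instance
  obtain ⟨X, hI, hcol, p, hp, hess, hk⟩ :=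
    exists_leftAdjointValue_simple Q.op hA' hN' (Opposite.op L) (P := P.op) hL
  refine ⟨X.unop, (isRightAdjointValue_iff_op _ _ _).2 hI, hcol,
    p.unop, inferInstance, fun Z f hf => ?_, ?_⟩
  · have := hess f.op (by
      rw [← Quiver.Hom.op_unop p, ← op_comp]; infer_instance)
    exact (inferInstance : Mono f.op.unop)
  · exact (P.op.prop_iff_of_iso (cokernelUnopOp p)).2 hk

omit hA hN hL in
lemma IsColocal.exists_retraction {X E : C} (hX : IsColocal P.op (Opposite.op X)) (f : X ⟶ E)
    [Mono f] (hf : P (cokernel f)) : ∃ r : E ⟶ X, f ≫ r = 𝟙 X := by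
  obtain ⟨s, hs⟩ := hX.exists_section f.op
    ((P.op.prop_iff_of_iso (kernelOpOp f).symm).1 hf)
  exact ⟨s.unop, Quiver.Hom.op_inj hs⟩

end Quotient

/-! ### Standard and costandard objects described inside `R`. -/

namespace Stratification

variable {R : Type u} [Category.{v} R] [Abelian R]
  {B : Type x} {Λ : Type y} [PartialOrder Λ] (S : Stratification R B Λ) (ε : Λ → Sign)

/-- The properties of `Δ_ε(b)` in terms of the category `R` only. -/
structure StandardLike (b : B) (X : R) : Prop where
  le : S.le (S.ρ b) X
  exists_epi : ∃ p : X ⟶ S.L b, Epi p ∧ (∀ ⦃Z : R⦄ (f : Z ⟶ X), Epi (f ≫ p) → Epi f) ∧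
    (ε (S.ρ b) = .minus → S.lt (S.ρ b) (kernel p))
  split_lt : ∀ ⦃E : R⦄ (q : E ⟶ X) [Epi q], S.lt (S.ρ b) (kernel q) → ∃ s : X ⟶ E, s ≫ q = 𝟙 X
  split_le : ε (S.ρ b) = .plus → ∀ ⦃E : R⦄ (q : E ⟶ X) [Epi q], S.le (S.ρ b) (kernel q) →
    ∃ s : X ⟶ E, s ≫ q = 𝟙 X

/-- The properties of `∇_ε(b)` in terms of the category `R` only. -/
structure CostandardLike (b : B) (X : R) : Prop where
  le : S.le (S.ρ b) X
  exists_mono : ∃ i : S.L b ⟶ X, Mono i ∧ (∀ ⦃Z : R⦄ (f : X ⟶ Z), Mono (i ≫ f) → Mono f) ∧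
    (ε (S.ρ b) = .plus → S.lt (S.ρ b) (cokernel i))
  split_lt : ∀ ⦃E : R⦄ (f : X ⟶ E) [Mono f], S.lt (S.ρ b) (cokernel f) →
    ∃ r : E ⟶ X, f ≫ r = 𝟙 X
  split_le : ε (S.ρ b) = .minus → ∀ ⦃E : R⦄ (f : X ⟶ E) [Mono f], S.le (S.ρ b) (cokernel f) →
    ∃ r : E ⟶ X, f ≫ r = 𝟙 X

variable {S ε}

lemma StandardLike.of_iso {b : B} {X X' : R} (h : S.StandardLike ε b X) (e : X ≅ X') :
    S.StandardLike ε b X' where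
  le := (S.le _).prop_of_iso e h.le
  exists_epi := by
    obtain ⟨p, hp, hess, hk⟩ := h.exists_epi
    refine ⟨e.inv ≫ p, inferInstance, fun Z f hf => ?_, fun hm => ?_⟩
    · have : Epi (f ≫ e.inv) := hess _ (by rwa [Category.assoc])
      have : Epi ((f ≫ e.inv) ≫ e.hom) := epi_comp _ _
      simpa using this
    · exact (S.lt _).prop_of_iso (kernelIsIsoComp e.inv p).symm (hk hm)
  split_lt E q _ hq := by
    obtain ⟨s, hs⟩ := h.split_lt (q ≫ e.inv) ((S.lt _).prop_of_iso (kernelCompMono q e.inv).symm hq)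
    refine ⟨e.inv ≫ s, ?_⟩
    rw [← cancel_mono e.inv, Category.assoc, Category.assoc, hs, Category.comp_id,
      Category.id_comp]
  split_le hp E q _ hq := by
    obtain ⟨s, hs⟩ := h.split_le hp (q ≫ e.inv)
      ((S.le _).prop_of_iso (kernelCompMono q e.inv).symm hq)
    refine ⟨e.inv ≫ s, ?_⟩
    rw [← cancel_mono e.inv, Category.assoc, Category.assoc, hs, Category.comp_id,
      Category.id_comp]

lemma CostandardLike.of_iso {b : B} {X X' : R} (h : S.CostandardLike ε b X) (e : X ≅ X') :
    S.CostandardLike ε b X' where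
  le := (S.le _).prop_of_iso e h.le
  exists_mono := by
    obtain ⟨p, hp, hess, hk⟩ := h.exists_mono
    refine ⟨p ≫ e.hom, inferInstance, fun Z f hf => ?_, fun hm => ?_⟩
    · have : Mono (e.hom ≫ f) := hess _ (by rwa [← Category.assoc])
      have : Mono (e.inv ≫ e.hom ≫ f) := mono_comp _ _
      simpa using this
    · exact (S.lt _).prop_of_iso (cokernelCompIsIso p e.hom).symm (hk hm)
  split_lt E f _ hf := by
    obtain ⟨r, hr⟩ := h.split_lt (e.hom ≫ f)
      ((S.lt _).prop_of_iso (cokernelEpiComp e.hom f).symm hf)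
    refine ⟨r ≫ e.hom, ?_⟩
    rw [← cancel_epi e.hom, ← Category.assoc, ← Category.assoc, hr, Category.id_comp,
      Category.comp_id]
  split_le hp E f _ hf := by
    obtain ⟨r, hr⟩ := h.split_le hp (e.hom ≫ f)
      ((S.le _).prop_of_iso (cokernelEpiComp e.hom f).symm hf)
    refine ⟨r ≫ e.hom, ?_⟩
    rw [← cancel_epi e.hom, ← Category.assoc, ← Category.assoc, hr, Category.id_comp,
      Category.comp_id]

variable (S)

/-- Subobjects in `R_{≤ l}` embed in those in `R`. -/
noncomputable def subobjectEmbedding (l : Λ) (X : S.Le l) :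
    Subobject X ↪o Subobject X.obj :=
  OrderEmbedding.ofMapLEIff (fun A => Subobject.mk ((S.le l).ι.map A.arrow)) (by
    intro A A'
    constructor
    · intro h
      refine Subobject.le_of_comm (ObjectProperty.homMk (Subobject.ofMkLEMk _ _ h)) ?_
      ext
      exact Subobject.ofMkLEMk_comp h
    · intro h
      refine Subobject.mk_le_mk_of_comm ((S.le l).ι.map (Subobject.ofLE A A' h)) ?_
      rw [← Functor.map_comp, Subobject.ofLE_arrow])

instance simple_LLe (b : B) : Simple (S.LLe b) :=
  have : Simple ((S.le (S.ρ b)).ι.obj (S.LLe b)) := S.simple b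
  (S.le (S.ρ b)).ι.simple_of_simple_obj _

omit [Abelian R] in
lemma isSubquotient_self (X : R) : IsSubquotient X X := ⟨X, 𝟙 X, 𝟙 X, inferInstance, inferInstance⟩

lemma not_ltIn_LLe (b : B) : ¬ S.ltIn (S.ρ b) (S.LLe b) := fun h =>
  lt_irrefl _ (h b (isSubquotient_self _))

lemma lt_le {l : Λ} {X : R} (h : S.lt l X) : S.le l X := fun b hb => (h b hb).le

variable {S}

/-- Projective objects of `R_{≤ l}` split epimorphisms in `R` with kernel in `R_{≤ l}`. -/
lemma exists_section_of_projective {l : Λ} (X : S.Le l) [Projective X] {E : R} (q : E ⟶ X.obj)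
    [Epi q] (hq : S.le l (kernel q)) : ∃ s : X.obj ⟶ E, s ≫ q = 𝟙 _ := by
  have hE : S.le l E := (S.le l).prop_X₂_of_shortExact
    (S := ShortComplex.mk (kernel.ι q) q (kernel.condition q))
    ⟨ShortComplex.exact_of_f_is_kernel _ (kernelIsKernel q)⟩ hq X.property
  let q' : (⟨E, hE⟩ : S.Le l) ⟶ X := ObjectProperty.homMk q
  have : Epi q' := (S.le l).ι.epi_of_epi_map (inferInstanceAs (Epi q))
  exact ⟨(Projective.factorThru (𝟙 X) q').hom,
    congrArg (·.hom) (Projective.factorThru_comp (𝟙 X) q')⟩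

lemma exists_retraction_of_injective {l : Λ} (X : S.Le l) [Injective X] {E : R} (f : X.obj ⟶ E)
    [Mono f] (hf : S.le l (cokernel f)) : ∃ r : E ⟶ X.obj, f ≫ r = 𝟙 _ := by
  have hE : S.le l E := (S.le l).prop_X₂_of_shortExact
    (S := ShortComplex.mk f (cokernel.π f) (cokernel.condition f))
    ⟨ShortComplex.exact_of_g_is_cokernel _ (cokernelIsCokernel f)⟩ X.property hf
  let f' : X ⟶ (⟨E, hE⟩ : S.Le l) := ObjectProperty.homMk f
  have : Mono f' := (S.le l).ι.mono_of_mono_map (inferInstanceAs (Mono f))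
  exact ⟨(Injective.factorThru (𝟙 X) f').hom,
    congrArg (·.hom) (Injective.comp_factorThru (𝟙 X) f')⟩

lemma exists_section_of_isColocal {l : Λ} (X : S.Le l) (hX : IsColocal (S.ltIn l) X) {E : R}
    (q : E ⟶ X.obj) [Epi q] (hq : S.lt l (kernel q)) : ∃ s : X.obj ⟶ E, s ≫ q = 𝟙 _ := by
  have hE : S.le l E := (S.le l).prop_X₂_of_shortExact
    (S := ShortComplex.mk (kernel.ι q) q (kernel.condition q))
    ⟨ShortComplex.exact_of_f_is_kernel _ (kernelIsKernel q)⟩ (S.lt_le hq) X.property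
  let q' : (⟨E, hE⟩ : S.Le l) ⟶ X := ObjectProperty.homMk q
  have : Epi q' := (S.le l).ι.epi_of_epi_map (inferInstanceAs (Epi q))
  obtain ⟨s, hs⟩ := hX.exists_section q' ((S.lt l).prop_of_iso
    (PreservesKernel.iso (S.le l).ι q').symm hq)
  exact ⟨s.hom, congrArg (·.hom) hs⟩

lemma exists_retraction_of_isColocal {l : Λ} (X : S.Le l)
    (hX : IsColocal (S.ltIn l).op (Opposite.op X)) {E : R}
    (f : X.obj ⟶ E) [Mono f] (hf : S.lt l (cokernel f)) : ∃ r : E ⟶ X.obj, f ≫ r = 𝟙 _ := by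
  have hE : S.le l E := (S.le l).prop_X₂_of_shortExact
    (S := ShortComplex.mk f (cokernel.π f) (cokernel.condition f))
    ⟨ShortComplex.exact_of_g_is_cokernel _ (cokernelIsCokernel f)⟩ X.property (S.lt_le hf)
  let f' : X ⟶ (⟨E, hE⟩ : S.Le l) := ObjectProperty.homMk f
  have : Mono f' := (S.le l).ι.mono_of_mono_map (inferInstanceAs (Mono f))
  obtain ⟨r, hr⟩ := hX.exists_retraction f' ((S.lt l).prop_of_iso
    (PreservesCokernel.iso (S.le l).ι f').symm hf)
  exact ⟨r.hom, congrArg (·.hom) hr⟩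

/-- The test object `Z` need not lie in `R_{≤ l}`, but the image of `f` does, and it decides whether
`f` is epi. -/
lemma essential_epi_hom {l : Λ} {X L : S.Le l} {p : X ⟶ L}
    (h : ∀ ⦃Z : S.Le l⦄ (f : Z ⟶ X), Epi (f ≫ p) → Epi f) ⦃Z : R⦄ (f : Z ⟶ X.obj)
    (hf : Epi (f ≫ p.hom)) : Epi f := by
  let g : (⟨Abelian.image f, (S.le l).prop_of_mono (Abelian.image.ι f) X.property⟩ : S.Le l) ⟶ X :=
    ObjectProperty.homMk (Abelian.image.ι f)
  have : Epi g := h _ ((S.le l).ι.epi_of_epi_map (by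
    change Epi (Abelian.image.ι f ≫ p.hom)
    have : Epi (Abelian.factorThruImage f ≫ Abelian.image.ι f ≫ p.hom) := by
      rwa [← Category.assoc, Abelian.image.fac]
    exact epi_of_epi (Abelian.factorThruImage f) _))
  have : Epi (Abelian.image.ι f) := inferInstanceAs (Epi ((S.le l).ι.map g))
  rw [← Abelian.image.fac f]
  exact epi_comp _ _

lemma essential_mono_hom {l : Λ} {X L : S.Le l} {i : L ⟶ X}
    (h : ∀ ⦃Z : S.Le l⦄ (f : X ⟶ Z), Mono (i ≫ f) → Mono f) ⦃Z : R⦄ (f : X.obj ⟶ Z)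
    (hf : Mono (i.hom ≫ f)) : Mono f := by
  let g : X ⟶ (⟨Abelian.coimage f,
      (S.le l).prop_of_epi (Abelian.coimage.π f) X.property⟩ : S.Le l) :=
    ObjectProperty.homMk (Abelian.coimage.π f)
  have : Mono g := h _ ((S.le l).ι.mono_of_mono_map (by
    change Mono (i.hom ≫ Abelian.coimage.π f)
    have : Mono ((i.hom ≫ Abelian.coimage.π f) ≫ Abelian.factorThruCoimage f) := by
      rwa [Category.assoc, Abelian.coimage.fac]
    exact mono_of_mono _ (Abelian.factorThruCoimage f)))
  have : Mono (Abelian.coimage.π f) := inferInstanceAs (Mono ((S.le l).ι.map g))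
  rw [← Abelian.coimage.fac f]
  exact mono_comp _ _

variable (hA : ∀ X : R, IsArtinianObject X) (hN : ∀ X : R, IsNoetherianObject X)

include hA in
lemma isArtinianObject_Le (l : Λ) (X : S.Le l) : IsArtinianObject X :=
  have := hA X.obj
  ⟨((S.subobjectEmbedding l X).wellFoundedLT :)⟩

include hN in
lemma isNoetherianObject_Le (l : Λ) (X : S.Le l) : IsNoetherianObject X :=
  have := hN X.obj
  ⟨((S.subobjectEmbedding l X).wellFoundedGT :)⟩

include hA hN

variable (S ε)

/-- For sign `+` the object is a projective cover of `L b` in `R_{≤ ρ b}`; for sign `-` it is a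
colocal quotient of such a cover that agrees with `L b` modulo `R_{< ρ b}`. -/
lemma exists_isEpsStandard (b : B) : ∃ X : R, S.IsEpsStandard ε b X ∧ S.StandardLike ε b X := by
  have hA' := S.isArtinianObject_Le hA (S.ρ b)
  have hN' := S.isNoetherianObject_Le hN (S.ρ b)
  have := S.enoughProjectives (S.ρ b)
  cases h : ε (S.ρ b) with
  | plus =>
    obtain ⟨X, ⟨P₀, p₀, hp₀, hX⟩, _, hcol, p, hp, hess⟩ :=
      exists_leftAdjointValue_projectiveCover (S.j (S.ρ b)) hA' hN' (S.LLe b) (S.not_ltIn_LLe b)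
    refine ⟨X.obj, ?_, X.property, ⟨p.hom, inferInstanceAs (Epi ((S.le (S.ρ b)).ι.map p)),
      essential_epi_hom hess, by simp [h]⟩, fun E q _ hq => exists_section_of_isColocal X hcol q hq,
      fun _ E q _ hq => exists_section_of_projective X q hq⟩
    simp only [IsEpsStandard, h]
    exact ⟨X.property, P₀, p₀, hp₀, hX⟩
  | minus =>
    obtain ⟨X, hX, hcol, p, hp, hess, hk⟩ :=
      exists_leftAdjointValue_simple (S.j (S.ρ b)) hA' hN' (S.LLe b) (S.not_ltIn_LLe b)
    refine ⟨X.obj, ?_, X.property, ⟨p.hom, inferInstanceAs (Epi ((S.le (S.ρ b)).ι.map p)),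
      essential_epi_hom hess, fun _ => (S.lt _).prop_of_iso
        (PreservesKernel.iso (S.le (S.ρ b)).ι p) hk⟩,
      fun E q _ hq => exists_section_of_isColocal X hcol q hq, by simp [h]⟩
    simp only [IsEpsStandard, h]
    exact ⟨X.property, hX⟩

lemma exists_isEpsCostandard (b : B) :
    ∃ X : R, S.IsEpsCostandard ε b X ∧ S.CostandardLike ε b X := by
  have hA' := S.isArtinianObject_Le hA (S.ρ b)
  have hN' := S.isNoetherianObject_Le hN (S.ρ b)
  have := S.enoughInjectives (S.ρ b)
  cases h : ε (S.ρ b) with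
  | minus =>
    obtain ⟨X, ⟨P₀, p₀, hp₀, hX⟩, _, hcol, p, hp, hess⟩ :=
      exists_rightAdjointValue_injectiveHull (S.j (S.ρ b)) hA' hN' (S.LLe b) (S.not_ltIn_LLe b)
    refine ⟨X.obj, ?_, X.property, ⟨p.hom, inferInstanceAs (Mono ((S.le (S.ρ b)).ι.map p)),
      essential_mono_hom hess, by simp [h]⟩,
      fun E q _ hq => exists_retraction_of_isColocal X hcol q hq,
      fun _ E q _ hq => exists_retraction_of_injective X q hq⟩
    simp only [IsEpsCostandard, h]
    exact ⟨X.property, P₀, p₀, hp₀, hX⟩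
  | plus =>
    obtain ⟨X, hX, hcol, p, hp, hess, hk⟩ :=
      exists_rightAdjointValue_simple (S.j (S.ρ b)) hA' hN' (S.LLe b) (S.not_ltIn_LLe b)
    refine ⟨X.obj, ?_, X.property, ⟨p.hom, inferInstanceAs (Mono ((S.le (S.ρ b)).ι.map p)),
      essential_mono_hom hess, fun _ => (S.lt _).prop_of_iso
        (PreservesCokernel.iso (S.le (S.ρ b)).ι p) hk⟩,
      fun E q _ hq => exists_retraction_of_isColocal X hcol q hq, by simp [h]⟩
    simp only [IsEpsCostandard, h]
    exact ⟨X.property, hX⟩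

variable {S ε}

omit hA hN in
lemma IsEpsStandard.nonempty_iso {b : B} {X X' : R} (h : S.IsEpsStandard ε b X)
    (h' : S.IsEpsStandard ε b X') : Nonempty (X ≅ X') := by
  cases hs : ε (S.ρ b) with
  | plus =>
    simp only [IsEpsStandard, hs] at h h'
    obtain ⟨hX, P, p, hp, hv⟩ := h
    obtain ⟨hX', P', p', hp', hv'⟩ := h'
    obtain ⟨i⟩ := hp.nonempty_iso hp'
    obtain ⟨e⟩ := hv.nonempty_iso hv' i
    exact ⟨(S.le _).ι.mapIso e⟩
  | minus =>
    simp only [IsEpsStandard, hs] at h h'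
    obtain ⟨hX, hv⟩ := h
    obtain ⟨hX', hv'⟩ := h'
    obtain ⟨e⟩ := hv.nonempty_iso hv' (Iso.refl _)
    exact ⟨(S.le _).ι.mapIso e⟩

omit hA hN in
lemma IsEpsCostandard.nonempty_iso {b : B} {X X' : R} (h : S.IsEpsCostandard ε b X)
    (h' : S.IsEpsCostandard ε b X') : Nonempty (X ≅ X') := by
  cases hs : ε (S.ρ b) with
  | minus =>
    simp only [IsEpsCostandard, hs] at h h'
    obtain ⟨hX, P, p, hp, hv⟩ := h
    obtain ⟨hX', P', p', hp', hv'⟩ := h'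
    rw [isInjectiveHull_iff_op] at hp hp'
    rw [isRightAdjointValue_iff_op] at hv hv'
    obtain ⟨i⟩ := hp.nonempty_iso hp'
    obtain ⟨e⟩ := hv.nonempty_iso hv' i
    exact ⟨(S.le _).ι.mapIso e.unop.symm⟩
  | plus =>
    simp only [IsEpsCostandard, hs] at h h'
    obtain ⟨hX, hv⟩ := h
    obtain ⟨hX', hv'⟩ := h'
    rw [isRightAdjointValue_iff_op] at hv hv'
    obtain ⟨e⟩ := hv.nonempty_iso hv' (Iso.refl _)
    exact ⟨(S.le _).ι.mapIso e.unop.symm⟩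

/-- The universal property fixes the object up to isomorphism, so what holds for the constructed one
holds for all. -/
lemma IsEpsStandard.standardLike {b : B} {X : R} (h : S.IsEpsStandard ε b X) :
    S.StandardLike ε b X := by
  obtain ⟨X', h', hX'⟩ := exists_isEpsStandard S ε hA hN b
  obtain ⟨e⟩ := h'.nonempty_iso h
  exact hX'.of_iso e

lemma IsEpsCostandard.costandardLike {b : B} {X : R} (h : S.IsEpsCostandard ε b X) :
    S.CostandardLike ε b X := by
  obtain ⟨X', h', hX'⟩ := exists_isEpsCostandard S ε hA hN b
  obtain ⟨e⟩ := h'.nonempty_iso h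
  exact hX'.of_iso e

end Stratification

/-! ### Short exact sequences and the long exact sequences of Ext. -/

section Ext

open Abelian

variable {C : Type u} [Category.{v} C] [Abelian C]

lemma shortExact_of_mono {X Y : C} (f : X ⟶ Y) [Mono f] :
    (ShortComplex.mk f (cokernel.π f) (cokernel.condition f)).ShortExact :=
  ⟨ShortComplex.exact_of_g_is_cokernel _ (cokernelIsCokernel f)⟩

lemma shortExact_of_epi {X Y : C} (f : X ⟶ Y) [Epi f] :
    (ShortComplex.mk (kernel.ι f) f (kernel.condition f)).ShortExact :=
  ⟨ShortComplex.exact_of_f_is_kernel _ (kernelIsKernel f)⟩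

/-- If `S` is a short exact sequence and `S.X₁ ⟶ S.X₂` factors through a subobject `W` of `S.X₂`,
then the quotient of `W` by `S.X₁` is the image of `W` in `S.X₃`. -/
lemma shortExact_image {S : ShortComplex C} (hS : S.ShortExact) {W : C} (j : W ⟶ S.X₂) [Mono j]
    (n : S.X₁ ⟶ W) (hn : n ≫ j = S.f) :
    (ShortComplex.mk n (Abelian.factorThruImage (j ≫ S.g)) (by
      rw [← cancel_mono (Abelian.image.ι (j ≫ S.g)), Category.assoc, Abelian.image.fac,
        ← Category.assoc, hn, S.zero, zero_comp])).ShortExact := by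
  have := hS.mono_f
  have : Mono (n ≫ j) := by rw [hn]; infer_instance
  have : Mono n := mono_of_mono n j
  refine ⟨ShortComplex.exact_of_f_is_kernel _ ?_⟩
  refine KernelFork.IsLimit.ofι' n _ fun {A} k hk => ?_
  have hk' : (k ≫ j) ≫ S.g = 0 := by
    have := congrArg (· ≫ Abelian.image.ι (j ≫ S.g)) hk
    simpa using this
  refine ⟨hS.exact.lift _ hk', ?_⟩
  rw [← cancel_mono j, Category.assoc, hn, hS.exact.lift_f]

/-- The pullback of an extension. -/
lemma shortExact_pullback {T : ShortComplex C} (hT : T.ShortExact) {A : C} (a : A ⟶ T.X₃) :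
    (ShortComplex.mk (pullback.lift T.f 0 (by simp) : T.X₁ ⟶ pullback T.g a) (pullback.snd T.g a)
      (pullback.lift_snd _ _ _)).ShortExact := by
  have := hT.mono_f
  have := hT.epi_g
  have h0 : T.f ≫ T.g = 0 ≫ a := by rw [T.zero, zero_comp]
  have hi : pullback.lift T.f 0 h0 ≫ pullback.fst T.g a = T.f := pullback.lift_fst _ _ _
  have : Mono (pullback.lift T.f 0 h0 ≫ pullback.fst T.g a) := by rw [hi]; infer_instance
  have := mono_of_mono (pullback.lift T.f 0 h0) (pullback.fst T.g a)
  refine ⟨ShortComplex.exact_of_f_is_kernel _ (KernelFork.IsLimit.ofι' _ _ fun {A} k hk => ?_)⟩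
  have hk' : (k ≫ pullback.fst T.g a) ≫ T.g = 0 := by
    rw [Category.assoc, pullback.condition, ← Category.assoc, hk, zero_comp]
  refine ⟨hT.exact.lift _ hk', pullback.hom_ext ?_ ?_⟩
  · rw [Category.assoc, hi]
    exact hT.exact.lift_f _ hk'
  · rw [Category.assoc, pullback.lift_snd, comp_zero, hk]

variable [HasExt.{w} C]

lemma ext_X₂_of_covariant {X : C} {S : ShortComplex C} (hS : S.ShortExact) (n : ℕ)
    [Subsingleton (Ext X S.X₁ n)] [Subsingleton (Ext X S.X₃ n)] : Subsingleton (Ext X S.X₂ n) := by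
  refine subsingleton_of_forall_eq 0 fun x => ?_
  obtain ⟨x₁, rfl⟩ := Ext.covariant_sequence_exact₂ X hS x (Subsingleton.elim _ _)
  rw [Subsingleton.elim x₁ 0, Ext.zero_comp]

lemma ext_X₃_of_covariant {X : C} {S : ShortComplex C} (hS : S.ShortExact) (n : ℕ)
    [Subsingleton (Ext X S.X₂ n)] [Subsingleton (Ext X S.X₁ (n + 1))] :
    Subsingleton (Ext X S.X₃ n) := by
  refine subsingleton_of_forall_eq 0 fun x => ?_
  obtain ⟨x₁, rfl⟩ := Ext.covariant_sequence_exact₃ X hS x rfl (Subsingleton.elim _ _)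
  rw [Subsingleton.elim x₁ 0, Ext.zero_comp]

lemma ext_X₁_of_covariant {X : C} {S : ShortComplex C} (hS : S.ShortExact) (n : ℕ)
    [Subsingleton (Ext X S.X₃ n)] [Subsingleton (Ext X S.X₂ (n + 1))] :
    Subsingleton (Ext X S.X₁ (n + 1)) := by
  refine subsingleton_of_forall_eq 0 fun x => ?_
  obtain ⟨x₁, rfl⟩ := Ext.covariant_sequence_exact₁ X hS x (Subsingleton.elim _ _) rfl
  rw [Subsingleton.elim x₁ 0, Ext.zero_comp]

lemma ext_X₂_of_contravariant {Y : C} {S : ShortComplex C} (hS : S.ShortExact) (n : ℕ)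
    [Subsingleton (Ext S.X₁ Y n)] [Subsingleton (Ext S.X₃ Y n)] : Subsingleton (Ext S.X₂ Y n) := by
  refine subsingleton_of_forall_eq 0 fun x => ?_
  obtain ⟨x₁, rfl⟩ := Ext.contravariant_sequence_exact₂ hS Y x (Subsingleton.elim _ _)
  rw [Subsingleton.elim x₁ 0, Ext.comp_zero]

/-- If `S.X₁` has no nonzero morphism to `Y` and `Ext¹(S.X₂, Y) = 0`, then `Ext¹(S.X₃, Y) = 0`. -/
lemma ext_one_X₃_of_contravariant {Y : C} {S : ShortComplex C} (hS : S.ShortExact)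
    (h₁ : ∀ f : S.X₁ ⟶ Y, f = 0) [Subsingleton (Ext S.X₂ Y 1)] : Subsingleton (Ext S.X₃ Y 1) := by
  refine subsingleton_of_forall_eq 0 fun x => ?_
  obtain ⟨x₁, rfl⟩ := Ext.contravariant_sequence_exact₃ hS Y x (Subsingleton.elim _ _) (n₀ := 0) rfl
  obtain ⟨f, rfl⟩ := (Ext.mk₀_bijective _ _).2 x₁
  rw [h₁ f, Ext.mk₀_zero, Ext.comp_zero]

lemma ext_of_retract_right {X Y A : C} (i : Y ⟶ A) (r : A ⟶ Y) (h : i ≫ r = 𝟙 Y) (n : ℕ)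
    [Subsingleton (Ext X A n)] : Subsingleton (Ext X Y n) := by
  refine subsingleton_of_forall_eq 0 fun x => ?_
  have h1 : x.comp (Ext.mk₀ (i ≫ r)) (add_zero n) = x := by rw [h, Ext.comp_mk₀_id]
  rw [← h1, ← Ext.mk₀_comp_mk₀, ← Ext.comp_assoc_of_second_deg_zero,
    Subsingleton.elim (x.comp (Ext.mk₀ i) (add_zero n)) 0, Ext.zero_comp]

lemma ext_of_iso_right {X Y A : C} (e : A ≅ Y) (n : ℕ) [Subsingleton (Ext X A n)] :
    Subsingleton (Ext X Y n) :=
  ext_of_retract_right e.inv e.hom e.inv_hom_id n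

lemma ext_of_iso_left {X Y A : C} (e : X ≅ Y) (n : ℕ) [Subsingleton (Ext X A n)] :
    Subsingleton (Ext Y A n) := by
  refine subsingleton_of_forall_eq 0 fun x => ?_
  have h1 : (Ext.mk₀ (e.inv ≫ e.hom)).comp x (zero_add n) = x := by
    rw [e.inv_hom_id, Ext.mk₀_id_comp]
  rw [← h1, ← Ext.mk₀_comp_mk₀, Ext.comp_assoc_of_second_deg_zero,
    Subsingleton.elim ((Ext.mk₀ e.hom).comp x (zero_add n)) 0, Ext.comp_zero]

lemma ext_of_isZero_right {X Y : C} (h : IsZero Y) (n : ℕ) : Subsingleton (Ext X Y n) := by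
  refine subsingleton_of_forall_eq 0 fun x => ?_
  have h1 : x.comp (Ext.mk₀ (𝟙 Y)) (add_zero n) = x := Ext.comp_mk₀_id x
  rw [← h1, h.eq_of_src (𝟙 Y) 0, Ext.mk₀_zero, Ext.comp_zero]

lemma ext_of_isZero_left {X Y : C} (h : IsZero X) (n : ℕ) : Subsingleton (Ext X Y n) := by
  refine subsingleton_of_forall_eq 0 fun x => ?_
  have h1 : (Ext.mk₀ (𝟙 X)).comp x (zero_add n) = x := Ext.mk₀_id_comp x
  rw [← h1, h.eq_of_src (𝟙 X) 0, Ext.mk₀_zero, Ext.zero_comp]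

lemma exists_lift_of_ext_one {X : C} {S : ShortComplex C} (hS : S.ShortExact)
    [Subsingleton (Ext X S.X₁ 1)] (f : X ⟶ S.X₃) : ∃ g : X ⟶ S.X₂, g ≫ S.g = f := by
  obtain ⟨x, hx⟩ := Ext.covariant_sequence_exact₃ X hS (Ext.mk₀ f) rfl (Subsingleton.elim _ _)
  obtain ⟨g, rfl⟩ := (Ext.mk₀_bijective _ _).2 x
  exact ⟨g, (Ext.mk₀_bijective _ _).1 (by rwa [Ext.mk₀_comp_mk₀] at hx)⟩

lemma exists_extension_of_ext_one {Y : C} {S : ShortComplex C} (hS : S.ShortExact)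
    [Subsingleton (Ext S.X₃ Y 1)] (f : S.X₁ ⟶ Y) : ∃ g : S.X₂ ⟶ Y, S.f ≫ g = f := by
  obtain ⟨x, hx⟩ := Ext.contravariant_sequence_exact₁ hS Y (Ext.mk₀ f) rfl (Subsingleton.elim _ _)
  obtain ⟨g, rfl⟩ := (Ext.mk₀_bijective _ _).2 x
  exact ⟨g, (Ext.mk₀_bijective _ _).1 (by rwa [Ext.mk₀_comp_mk₀] at hx)⟩

end Ext

/-! ### Objects of `R` inside the ind-completion. -/

section Ind

variable {R : Type u} [SmallCategory R] [Abelian R]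

omit [Abelian R] in
lemma ind_hom_ext {V W : Ind R} {f g : V ⟶ W}
    (h : ∀ (X : R) (a : toInd X ⟶ V), a ≫ f = a ≫ g) : f = g := by
  refine Ind.isSeparating_range_yoneda f g fun G hG a => ?_
  obtain ⟨X, rfl⟩ := (ObjectProperty.ofObj_iff _ _).1 hG
  exact h X a

/-- Objects of `R` separate morphisms, so the cokernel projection of `m` vanishes. -/
lemma ind_isIso_of_mono {V W : Ind R} (m : W ⟶ V) [Mono m]
    (h : ∀ (X : R) (a : toInd X ⟶ V), ∃ b, b ≫ m = a) : IsIso m := by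
  have : Epi m := Preadditive.epi_of_cokernel_zero (ind_hom_ext fun X a => by
    obtain ⟨b, rfl⟩ := h X a
    simp)
  exact isIso_of_mono_of_epi m

/-- A morphism from an ind-object to a noetherian object of `R` has an image which is the image
of an object of `R`. -/
lemma exists_image_of_noetherian {V : Ind R} {X : R} [IsNoetherianObject X] (p : V ⟶ toInd X) :
    ∃ (Y : R) (a : toInd Y ⟶ V) (g : Y ⟶ X), Ind.yoneda.map g = a ≫ p ∧
      p ≫ Ind.yoneda.map (cokernel.π g) = 0 := by
  let s : Set (Subobject X) := {A | ∃ (Y : R) (a : toInd Y ⟶ V) (g : Y ⟶ X),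
    Ind.yoneda.map g = a ≫ p ∧ A = imageSubobject g}
  have hs : s.Nonempty := ⟨_, 0, 0, 0, by simp, rfl⟩
  -- Among the images of objects of `R` mapping to `V`, take a maximal one. Another `Z` over `V` is
  -- absorbed, since `Y ⊞ Z` would otherwise give a larger image.
  obtain ⟨_, ⟨Y, a, g, hg, rfl⟩, hmax⟩ := (wellFounded_gt (α := Subobject X)).has_min s hs
  refine ⟨Y, a, g, hg, ind_hom_ext fun Z f => ?_⟩
  obtain ⟨g', hg'⟩ := Ind.yoneda.map_surjective (f ≫ p)
  let t : Y ⊞ Z ⟶ X := biprod.desc g g'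
  have h1 : imageSubobject g ≤ imageSubobject t := by
    have : biprod.inl ≫ t = g := biprod.inl_desc _ _
    simpa only [this] using imageSubobject_comp_le biprod.inl t
  have h2 : imageSubobject g' ≤ imageSubobject t := by
    have : biprod.inr ≫ t = g' := biprod.inr_desc _ _
    simpa only [this] using imageSubobject_comp_le biprod.inr t
  have h3 : imageSubobject t ∈ s := by
    refine ⟨Y ⊞ Z, Ind.yoneda.map biprod.fst ≫ a + Ind.yoneda.map biprod.snd ≫ f, t, ?_, rfl⟩
    rw [Preadditive.add_comp, Category.assoc, Category.assoc, ← hg, ← hg', ← Functor.map_comp,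
      ← Functor.map_comp, ← Functor.map_add, ← biprod.desc_eq]
  have h4 : imageSubobject g' ≤ imageSubobject g := by
    rcases h1.lt_or_eq with h | h
    · exact absurd h (hmax _ h3)
    · rwa [h]
  have h5 : (imageSubobject g).arrow ≫ cokernel.π g = 0 := by
    rw [← cancel_epi (factorThruImageSubobject g), imageSubobject_arrow_comp_assoc,
      cokernel.condition, comp_zero]
  have h6 : g' ≫ cokernel.π g = 0 := by
    rw [← imageSubobject_arrow_comp g', ← Subobject.ofLE_arrow h4, Category.assoc, Category.assoc,
      h5, comp_zero, comp_zero]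
  rw [← Category.assoc, ← hg', ← Functor.map_comp, h6, Functor.map_zero, comp_zero]

lemma exists_cover_of_epi {V : Ind R} {X : R} [IsNoetherianObject X] (p : V ⟶ toInd X) [Epi p] :
    ∃ (Y : R) (a : toInd Y ⟶ V) (g : Y ⟶ X), Ind.yoneda.map g = a ≫ p ∧ Epi g := by
  obtain ⟨Y, a, g, hg, h⟩ := exists_image_of_noetherian p
  refine ⟨Y, a, g, hg, Preadditive.epi_of_cokernel_zero (Ind.yoneda.map_injective ?_)⟩
  rw [← cancel_epi p, h, Functor.map_zero, comp_zero]

/-- Since `X` is noetherian, a single object of `R` over `V` has the same image in `X` as `V`, so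
`V` is the image of a morphism of `R`. -/
lemma essImage_of_mono {V : Ind R} {X : R} [IsNoetherianObject X] (m : V ⟶ toInd X) [Mono m] :
    ∃ A : R, Nonempty (toInd A ≅ V) := by
  obtain ⟨Y, a, g, hg, h⟩ := exists_image_of_noetherian m
  have hS := (shortExact_of_epi (cokernel.π g)).map_of_exact (Ind.yoneda (C := R))
  have := hS.mono_f
  let n : V ⟶ toInd (kernel (cokernel.π g)) := hS.exact.lift m h
  have hn : n ≫ Ind.yoneda.map (kernel.ι (cokernel.π g)) = m := hS.exact.lift_f m h
  have : Mono (n ≫ Ind.yoneda.map (kernel.ι (cokernel.π g))) := by rw [hn]; infer_instance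
  have : Mono n := mono_of_mono n (Ind.yoneda.map (kernel.ι (cokernel.π g)))
  have h1 : a ≫ n = Ind.yoneda.map (Abelian.factorThruImage g) := by
    rw [← cancel_mono (Ind.yoneda.map (kernel.ι (cokernel.π g))), Category.assoc, hn, ← hg,
      ← Functor.map_comp]
    exact congrArg _ (Abelian.image.fac g).symm
  have : Epi (a ≫ n) := by
    rw [h1]
    infer_instance
  have : Epi n := epi_of_epi a n
  have := isIso_of_mono_of_epi n
  exact ⟨_, ⟨(asIso n).symm⟩⟩

lemma essImage_of_epi {W : Ind R} {X : R} [IsNoetherianObject X] (p : toInd X ⟶ W) [Epi p] :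
    ∃ A : R, Nonempty (toInd A ≅ W) := by
  obtain ⟨A, ⟨e⟩⟩ := essImage_of_mono (kernel.ι p)
  obtain ⟨g, hg⟩ := Ind.yoneda.map_surjective (e.hom ≫ kernel.ι p)
  refine ⟨cokernel g, ⟨PreservesCokernel.iso Ind.yoneda g ≪≫ cokernelIsoOfEq hg ≪≫
    cokernelEpiComp e.hom (kernel.ι p) ≪≫ ?_⟩⟩
  exact (cokernelIsCokernel (kernel.ι p)).coconePointUniqueUpToIso
    (shortExact_of_epi p).gIsCokernel

/-- Some `Y` in `R` maps to `S.X₂` and covers `S.X₃`. Together with `S.X₁` it covers `S.X₂`, which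
is thus a quotient of an object of `R`. -/
lemma essImage_of_shortExact [∀ X : R, IsNoetherianObject X] {S : ShortComplex (Ind R)}
    (hS : S.ShortExact) (h₁ : ∃ A : R, Nonempty (toInd A ≅ S.X₁))
    (h₃ : ∃ A : R, Nonempty (toInd A ≅ S.X₃)) : ∃ A : R, Nonempty (toInd A ≅ S.X₂) := by
  obtain ⟨A, ⟨e⟩⟩ := h₁
  obtain ⟨D, ⟨e'⟩⟩ := h₃
  have := hS.epi_g
  obtain ⟨Y, a, g, hg, hepi⟩ := exists_cover_of_epi (S.g ≫ e'.inv)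
  let t : toInd (A ⊞ Y) ⟶ S.X₂ :=
    Ind.yoneda.map biprod.fst ≫ e.hom ≫ S.f + Ind.yoneda.map biprod.snd ≫ a
  have hl : Ind.yoneda.map biprod.inl ≫ t = e.hom ≫ S.f := by
    simp [t, ← Functor.map_comp_assoc]
  have hr : Ind.yoneda.map biprod.inr ≫ t = a := by
    simp [t, ← Functor.map_comp_assoc]
  have : Epi t := by
    refine Preadditive.epi_of_cancel_zero _ fun {P} q hq => ?_
    have h1 : S.f ≫ q = 0 := by
      rw [← cancel_epi e.hom, ← Category.assoc, ← hl, Category.assoc, hq, comp_zero, comp_zero]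
    have h2 : a ≫ q = 0 := by rw [← hr, Category.assoc, hq, comp_zero]
    obtain ⟨q', rfl⟩ : ∃ q', S.g ≫ q' = q := ⟨hS.exact.desc q h1, hS.exact.g_desc q h1⟩
    have : Epi (a ≫ S.g) := by
      have : Epi (a ≫ S.g ≫ e'.inv) := by rw [← hg]; infer_instance
      have : Epi ((a ≫ S.g ≫ e'.inv) ≫ e'.hom) := epi_comp _ _
      simpa using this
    rw [← Category.assoc] at h2
    rw [zero_of_epi_comp (a ≫ S.g) h2, comp_zero]
  exact essImage_of_epi t

/-- Morphisms from an object of `R` to an ind-object are the elements of the presheaf. -/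
noncomputable def coyonedaToIndIso (X : R) : coyoneda.obj (Opposite.op (toInd X)) ≅
    Ind.inclusion R ⋙ (evaluation _ _).obj (Opposite.op X) :=
  NatIso.ofComponents (fun V => (((Ind.inclusion.fullyFaithful (C := R)).homEquiv.trans
    ((Ind.yonedaCompInclusion.app X).homCongr (Iso.refl _))).trans yonedaEquiv).toIso) (by
      intro V W f
      ext g
      simp [yonedaEquiv, Functor.FullyFaithful.homEquiv]
      trace_state)

/-- Hom from `toInd X` is evaluation at `X`, and filtered colimits of ind-objects are computed as
presheaves. -/
instance isFinitelyPresentable_toInd (X : R) : IsFinitelyPresentable.{u} (toInd X) := by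
  rw [isFinitelyPresentable_iff_preservesFilteredColimitsOfSize]
  refine ⟨fun J _ _ => preservesColimitsOfShape_of_natIso (coyonedaToIndIso X).symm⟩

/-- In a Grothendieck category a directed sum of subobjects is their filtered colimit, and `toInd X`
is finitely presentable. This is the compactness used whenever an ascending flag is reduced to one
of its members. -/
lemma exists_factors {V : Ind R} {F : Set (Subobject V)} (hne : F.Nonempty)
    (hdir : DirectedOn (· ≤ ·) F) (hsup : IsLUB F ⊤) {X : R} (f : toInd X ⟶ V) :
    ∃ W ∈ F, ∃ g : toInd X ⟶ (W : Ind R), g ≫ W.arrow = f := by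
  -- The colimit has to be indexed in the universe of `R`, so `F` is replaced by a small copy with
  -- the transported order.
  obtain ⟨J, ⟨e⟩⟩ := (inferInstance : Small.{u} F).equiv_small
  let : Preorder J := Preorder.lift e.symm
  have : Nonempty J := ⟨e ⟨_, hne.some_mem⟩⟩
  have : IsDirectedOrder J := ⟨fun a b => by
    obtain ⟨c, hc, hac, hbc⟩ := hdir _ (e.symm a).2 _ (e.symm b).2
    refine ⟨e ⟨c, hc⟩, ?_, ?_⟩
    · change (e.symm a).1 ≤ (e.symm (e ⟨c, hc⟩)).1
      simpa using hac
    · change (e.symm b).1 ≤ (e.symm (e ⟨c, hc⟩)).1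
      simpa using hbc⟩
  have hle : ∀ {a b : J}, (a ⟶ b) → (e.symm a).1 ≤ (e.symm b).1 := fun {a b} h =>
    (show a ≤ b from leOfHom h)
  let G : J ⥤ MonoOver V :=
    { obj a := MonoOver.mk (e.symm a).1.arrow
      map h := MonoOver.homMk (Subobject.ofLE _ _ (hle h)) (Subobject.ofLE_arrow _) }
  let c : Cocone (G ⋙ MonoOver.forget _) :=
    { pt := Over.mk (𝟙 V)
      ι := { app a := Over.homMk (e.symm a).1.arrow
             naturality a b h := by
               ext
               change Subobject.ofLE _ _ (hle h) ≫ (e.symm b).1.arrow = (e.symm a).1.arrow ≫ 𝟙 _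
               rw [Subobject.ofLE_arrow, Category.comp_id] } }
  have : Mono c.pt.hom := inferInstanceAs (Mono (𝟙 V))
  have hc := IsGrothendieckAbelian.isColimitMapCoconeOfSubobjectMkEqISup G c (by
    change Subobject.mk (𝟙 V) = ⨆ a, Subobject.mk (e.symm a).1.arrow
    rw [← Subobject.top_eq_id, eq_comm, eq_top_iff]
    refine hsup.2 fun W hW => ?_
    have := le_iSup (fun a => Subobject.mk (e.symm a).1.arrow) (e ⟨W, hW⟩)
    simpa using this)
  obtain ⟨a, g, hg⟩ := IsFinitelyPresentable.exists_hom_of_isColimit hc f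
  exact ⟨_, (e.symm a).2, g, hg⟩

end Ind

/-! ### Splittings and naturality of extension classes. -/

section ShortExact

open Abelian

variable {C : Type u} [Category.{v} C] [Abelian C]

lemma shortExact_of_map {D : Type u'} [Category.{v'} D] [Abelian D] (F : C ⥤ D) [F.Additive]
    [F.Faithful] [PreservesFiniteLimits F] [PreservesFiniteColimits F] {S : ShortComplex C}
    (h : (S.map F).ShortExact) : S.ShortExact := by
  have : Mono (F.map S.f) := h.mono_f
  have : Epi (F.map S.g) := h.epi_g
  have := F.mono_of_mono_map (f := S.f) inferInstance
  have := F.epi_of_epi_map (f := S.g) inferInstance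
  exact ⟨(S.exact_map_iff_of_faithful F).1 h.exact⟩

lemma exists_section_of_retraction {S : ShortComplex C} (hS : S.ShortExact) (r : S.X₂ ⟶ S.X₁)
    (h : S.f ≫ r = 𝟙 _) : ∃ s : S.X₃ ⟶ S.X₂, s ≫ S.g = 𝟙 _ := by
  have := hS.epi_g
  let σ := ShortComplex.Splitting.ofExactOfRetraction S hS.exact r h inferInstance
  exact ⟨σ.s, σ.s_g⟩

variable [HasExt.{w} C]

lemma comp_extClass_naturality {X : C} {n : ℕ} {S₁ S₂ : ShortComplex C} (h₁ : S₁.ShortExact)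
    (h₂ : S₂.ShortExact) (φ : S₁ ⟶ S₂) (η : Ext X S₁.X₃ n) :
    (η.comp (Ext.mk₀ φ.τ₃) (add_zero n)).comp h₂.extClass rfl =
      (η.comp h₁.extClass rfl).comp (Ext.mk₀ φ.τ₁) (add_zero (n + 1)) := by
  rw [Ext.comp_assoc_of_second_deg_zero, Ext.comp_assoc_of_third_deg_zero,
    ShortComplex.ShortExact.extClass_naturality]

lemma mk₀_comp_extClass_eq_zero {X : C} {S : ShortComplex C} (hS : S.ShortExact)
    (f : X ⟶ S.X₂) : (Ext.mk₀ (f ≫ S.g)).comp hS.extClass (zero_add 1) = 0 := by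
  rw [← Ext.mk₀_comp_mk₀, Ext.comp_assoc_of_second_deg_zero, hS.comp_extClass, Ext.comp_zero]

end ShortExact

/-! ### Ext from objects of `R` to ind-objects. -/

section IndExt

open Abelian

variable {R : Type u} [SmallCategory R] [Abelian R] [∀ X : R, IsNoetherianObject X]

/-- A morphism from an object of `R` to a quotient of an ind-object lifts after passing to a cover
in `R`. -/
lemma exists_cover_lift {V W : Ind R} (p : V ⟶ W) [Epi p] {K : R} (g : toInd K ⟶ W) :
    ∃ (K' : R) (e : K' ⟶ K) (h : toInd K' ⟶ V), Epi e ∧ h ≫ p = Ind.yoneda.map e ≫ g := by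
  obtain ⟨K', a, e, he, hepi⟩ := exists_cover_of_epi (pullback.snd p g)
  refine ⟨K', e, a ≫ pullback.fst p g, hepi, ?_⟩
  rw [Category.assoc, pullback.condition, he, Category.assoc]

/-- Induction by dimension shifting: a class of degree `n + 1` is a class with values in the
quotient of an injective by `V`, followed by the connecting class, and the former comes from an
object of `R`. -/
lemma exists_ext_factor {X : R} (n : ℕ) : ∀ {V : Ind R} (ξ : Ext (toInd X) V n),
    ∃ (K : R) (f : toInd K ⟶ V) (ξ' : Ext (toInd X) (toInd K) n),
      ξ = ξ'.comp (Ext.mk₀ f) (add_zero n) := by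
  induction n with
  | zero =>
    intro V ξ
    obtain ⟨f, rfl⟩ := (Ext.mk₀_bijective _ _).2 ξ
    exact ⟨X, f, Ext.mk₀ (𝟙 _), by rw [Ext.mk₀_id_comp]⟩
  | succ n ih =>
    intro V ξ
    have hS := shortExact_of_mono (Injective.ι V)
    obtain ⟨η, rfl⟩ := Ext.covariant_sequence_exact₁ _ hS ξ (Ext.eq_zero_of_injective _) rfl
    obtain ⟨K, g, η', rfl⟩ := ih η
    -- `K` need not lift to the injective, but a cover `K'` does. The extension of `K` by the kernel
    -- of the cover then maps to the injective resolution step, and naturality of the connecting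
    -- class finishes.
    obtain ⟨K', e, h, he, hh⟩ := exists_cover_lift (cokernel.π (Injective.ι V)) g
    have hS' := (shortExact_of_epi e).map_of_exact (Ind.yoneda (C := R))
    have := hS.mono_f
    have hm0 : (Ind.yoneda.map (kernel.ι e) ≫ h) ≫ cokernel.π (Injective.ι V) = 0 := by
      rw [Category.assoc, hh, ← Category.assoc, ← Functor.map_comp, kernel.condition,
        Functor.map_zero, zero_comp]
    let φ : (ShortComplex.mk (kernel.ι e) e (kernel.condition e)).map Ind.yoneda ⟶
        ShortComplex.mk (Injective.ι V) (cokernel.π (Injective.ι V)) (cokernel.condition _) :=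
      { τ₁ := hS.exact.lift _ hm0
        τ₂ := h
        τ₃ := g
        comm₁₂ := hS.exact.lift_f _ hm0
        comm₂₃ := hh }
    refine ⟨kernel e, φ.τ₁, η'.comp hS'.extClass rfl, ?_⟩
    exact comp_extClass_naturality hS' hS φ η'

/-- This takes the place of commuting Ext with filtered colimits: each class already comes from some
`K` in `R`, and it dies in the intermediate object. -/
lemma ext_of_factors {X : R} {V : Ind R} {n : ℕ}
    (h : ∀ (K : R) (f : toInd K ⟶ V), ∃ (V' : Ind R) (g : toInd K ⟶ V') (i : V' ⟶ V), g ≫ i = f ∧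
      Subsingleton (Ext (toInd X) V' n)) : Subsingleton (Ext (toInd X) V n) := by
  refine subsingleton_of_forall_eq 0 fun ξ => ?_
  obtain ⟨K, f, ξ', rfl⟩ := exists_ext_factor n ξ
  obtain ⟨V', g, i, rfl, hV'⟩ := h K f
  rw [← Ext.mk₀_comp_mk₀, ← Ext.comp_assoc_of_second_deg_zero,
    Subsingleton.elim (ξ'.comp (Ext.mk₀ g) (add_zero n)) 0, Ext.zero_comp]

/-- An extension in the ind-completion of objects of `R` is the image of an extension in `R`. -/
lemma exists_shortExact_of_ind {Y X : R} {P : Ind R} {i : toInd Y ⟶ P} {p : P ⟶ toInd X}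
    {w : i ≫ p = 0} (h : (ShortComplex.mk i p w).ShortExact) :
    ∃ (E : R) (e : toInd E ≅ P) (i' : Y ⟶ E) (q' : E ⟶ X) (w' : i' ≫ q' = 0),
      Ind.yoneda.map i' = i ≫ e.inv ∧ Ind.yoneda.map q' = e.hom ≫ p ∧
      (ShortComplex.mk i' q' w').ShortExact := by
  obtain ⟨E, ⟨e⟩⟩ := essImage_of_shortExact h ⟨Y, ⟨Iso.refl _⟩⟩ ⟨X, ⟨Iso.refl _⟩⟩
  change toInd E ≅ P at e
  obtain ⟨i', hi'⟩ := Ind.yoneda.map_surjective (i ≫ e.inv)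
  obtain ⟨q', hq'⟩ := Ind.yoneda.map_surjective (e.hom ≫ p)
  have hz : i' ≫ q' = 0 := Ind.yoneda.map_injective (by
    rw [Functor.map_comp, hi', hq', Functor.map_zero]; simpa using w)
  refine ⟨E, e, i', q', hz, hi', hq', shortExact_of_map Ind.yoneda
    (ShortComplex.shortExact_of_iso (S₁ := .mk _ _ w)
      (ShortComplex.isoMk (Iso.refl _) e.symm (Iso.refl _) ?_ ?_) h)⟩
  · exact (Category.id_comp _).trans hi'
  · change e.inv ≫ Ind.yoneda.map q' = p ≫ 𝟙 _
    rw [hq', e.inv_hom_id_assoc, Category.comp_id]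

/-- Extensions of objects of `R` may be computed in `R`. -/
lemma ext_one_of_split {X Y : R} (h : ∀ (E : R) (i : Y ⟶ E) (q : E ⟶ X) (w : i ≫ q = 0),
    (ShortComplex.mk i q w).ShortExact → ∃ s : X ⟶ E, s ≫ q = 𝟙 X) :
    Subsingleton (Ext (toInd X) (toInd Y) 1) := by
  have hS := shortExact_of_mono (Injective.ι (toInd Y))
  refine subsingleton_of_forall_eq 0 fun ξ => ?_
  obtain ⟨η, rfl⟩ := Ext.covariant_sequence_exact₁ _ hS ξ (Ext.eq_zero_of_injective _) rfl
  obtain ⟨g, rfl⟩ := (Ext.mk₀_bijective _ _).2 η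
  let p := cokernel.π (Injective.ι (toInd Y))
  change toInd X ⟶ cokernel (Injective.ι (toInd Y)) at g
  obtain ⟨E, e, i, q, w, -, hq, hE⟩ := exists_shortExact_of_ind (shortExact_pullback hS g)
  obtain ⟨s, hs⟩ := h E i q w hE
  have hl : (Ind.yoneda.map s ≫ e.hom ≫ pullback.fst p g) ≫ p = g := by
    rw [Category.assoc, Category.assoc, pullback.condition, ← Category.assoc e.hom, ← hq,
      ← Category.assoc, ← Functor.map_comp, hs, CategoryTheory.Functor.map_id,
      Category.id_comp]
  rw [← hl]
  exact mk₀_comp_extClass_eq_zero hS _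

/-- Dimension shifting for `Ext` into a subobject of an injective ind-object which is a directed sum
of subobjects. -/
lemma ext_succ_of_directed {X : R} {n : ℕ} {S : ShortComplex (Ind R)} (hS : S.ShortExact)
    [Injective S.X₂] {F : Set (Subobject S.X₂)} (hdir : DirectedOn (· ≤ ·) F) (hsup : IsLUB F ⊤)
    {W₀ : Subobject S.X₂} (hW₀ : W₀ ∈ F)
    (h : ∀ W ∈ F, W₀ ≤ W → Subsingleton (Ext (toInd X) (Abelian.image (W.arrow ≫ S.g)) n)) :
    Subsingleton (Ext (toInd X) S.X₁ (n + 1)) := by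
  have := hS.epi_g
  have : Subsingleton (Ext (toInd X) S.X₂ (n + 1)) := Ext.subsingleton_of_injective _ _ _
  have : Subsingleton (Ext (toInd X) S.X₃ n) := by
    refine ext_of_factors fun K f => ?_
    -- Only a cover of `K` lifts to `S.X₂`, and there it lands in one member. The map to that
    -- member's image in `S.X₃` kills the kernel of the cover, so it descends to `K`.
    obtain ⟨K', e, a, he, ha⟩ := exists_cover_lift S.g f
    obtain ⟨W, hW, b, rfl⟩ := exists_factors ⟨_, hW₀⟩ hdir hsup a
    obtain ⟨W', hW', h1, h2⟩ := hdir _ hW _ hW₀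
    let c : toInd K' ⟶ Abelian.image (W'.arrow ≫ S.g) :=
      b ≫ Subobject.ofLE _ _ h1 ≫ Abelian.factorThruImage (W'.arrow ≫ S.g)
    have hc : c ≫ Abelian.image.ι (W'.arrow ≫ S.g) = Ind.yoneda.map e ≫ f := by
      rw [← ha]
      simp only [c, Category.assoc, Abelian.image.fac, Subobject.ofLE_arrow_assoc]
    have hk : kernel.ι (Ind.yoneda.map e) ≫ c = 0 := by
      rw [← cancel_mono (Abelian.image.ι (W'.arrow ≫ S.g)), Category.assoc, hc, ← Category.assoc,
        kernel.condition, zero_comp, zero_comp]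
    refine ⟨_, Abelian.epiDesc (Ind.yoneda.map e) c hk, Abelian.image.ι (W'.arrow ≫ S.g), ?_,
      h W' hW' h2⟩
    rw [← cancel_epi (Ind.yoneda.map e), ← Category.assoc, Abelian.comp_epiDesc, hc]
  exact ext_X₁_of_covariant hS n

end IndExt

/-! ### Finite length induction and essential socles. -/

section FiniteLength

variable {C : Type u} [Category.{v} C] [Abelian C]

/-- Induction over objects of finite length, splitting off simple subobjects. -/
lemma finite_length_induction [∀ X : C, IsArtinianObject X] [∀ X : C, IsNoetherianObject X]
    {P : C → Prop} (zero : ∀ X, IsZero X → P X)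
    (ext : ∀ T : ShortComplex C, T.ShortExact → Simple T.X₁ → P T.X₃ → P T.X₂) (X : C) : P X := by
  -- All quotients of `X` are treated at once, by noetherian induction on the kernel, which grows
  -- strictly when a simple subobject of the quotient is divided out.
  suffices ∀ (A : Subobject X) (Y : C) (q : X ⟶ Y) [Epi q], kernelSubobject q = A → P Y from
    this _ X (𝟙 X) rfl
  intro A
  induction A using (wellFounded_gt (α := Subobject X)).induction with
  | _ A ih =>
  intro Y q _ hA
  by_cases hY : IsZero Y
  · exact zero Y hY
  obtain ⟨T, hT⟩ := exists_simple_subobject hY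
  refine ext _ (shortExact_of_mono T.arrow) hT ?_
  refine ih (kernelSubobject (q ≫ cokernel.π T.arrow)) ?_ _ (q ≫ cokernel.π T.arrow) rfl
  refine lt_of_le_of_ne (hA ▸ kernelSubobject_comp_le _ _) fun h => ?_
  have h1 : kernel.ι (q ≫ cokernel.π T.arrow) ≫ q = 0 := by
    have h2 : (kernelSubobject (q ≫ cokernel.π T.arrow)).arrow ≫ q = 0 := by
      rw [← Subobject.ofLE_arrow (show kernelSubobject (q ≫ cokernel.π T.arrow) ≤
        kernelSubobject q by rw [← h, hA]), Category.assoc, kernelSubobject_arrow_comp, comp_zero]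
    rw [← kernelSubobject_arrow', Category.assoc, h2, comp_zero]
  let σ := Abelian.epiDesc (q ≫ cokernel.π T.arrow) q h1
  have h3 : cokernel.π T.arrow ≫ σ = 𝟙 Y := by
    rw [← cancel_epi q, ← Category.assoc, Abelian.comp_epiDesc, Category.comp_id]
  have h4 : T.arrow = 0 := by
    rw [← Category.comp_id T.arrow, ← h3, cokernel.condition_assoc, zero_comp]
  exact Simple.not_isZero (T : C) (IsZero.of_mono_eq_zero T.arrow h4)

lemma exists_mono_image_of_essential {L X Y : C} [Simple L] {i : L ⟶ X} [Mono i]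
    (hi : ∀ ⦃Z : C⦄ (f : X ⟶ Z), Mono (i ≫ f) → Mono f) {f : Y ⟶ X} (hf : f ≠ 0) :
    ∃ j : L ⟶ Abelian.image f, j ≫ Abelian.image.ι f = i := by
  have h0 : i ≫ cokernel.π f = 0 := by
    by_contra h
    have : Mono (cokernel.π f) := hi _ (mono_of_nonzero_from_simple h)
    exact hf ((cancel_mono (cokernel.π f)).1 (by rw [cokernel.condition, zero_comp]))
  exact ⟨kernel.lift _ i h0, kernel.lift_ι _ _ _⟩

lemma isSubquotient_of_essential_mono {L X Y : C} [Simple L] {i : L ⟶ X} [Mono i]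
    (hi : ∀ ⦃Z : C⦄ (f : X ⟶ Z), Mono (i ≫ f) → Mono f) {f : Y ⟶ X} (hf : f ≠ 0) :
    IsSubquotient L Y := by
  obtain ⟨j, hj⟩ := exists_mono_image_of_essential hi hf
  have : Mono (j ≫ Abelian.image.ι f) := by rw [hj]; infer_instance
  have : Mono j := mono_of_mono j (Abelian.image.ι f)
  exact IsSubquotient.of_epi (Abelian.factorThruImage f)
    ⟨L, j, 𝟙 L, inferInstance, inferInstance⟩

lemma exists_endo_of_essential_mono {L X : C} [Simple L] {i : L ⟶ X} [Mono i]
    (hi : ∀ ⦃Z : C⦄ (f : X ⟶ Z), Mono (i ≫ f) → Mono f) {f : L ⟶ X} (hf : f ≠ 0) :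
    ∃ j : L ⟶ L, i = j ≫ f := by
  have := mono_of_nonzero_from_simple hf
  obtain ⟨j, hj⟩ := exists_mono_image_of_essential hi hf
  have : IsIso (Abelian.factorThruImage f) := isIso_of_mono_of_epi _
  refine ⟨j ≫ inv (Abelian.factorThruImage f), ?_⟩
  have h3 : inv (Abelian.factorThruImage f) ≫ f = Abelian.image.ι f := by
    rw [IsIso.inv_comp_eq, Abelian.image.fac]
  rw [Category.assoc, h3, hj]

/-- The kernel of `φ` meets `T.X₁` trivially, so it embeds in the simple object `T.X₃`: either it is
zero or it is a complement of `T.X₁`. -/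
lemma exists_section_or_mono {T : ShortComplex C} (hT : T.ShortExact) [Simple T.X₃] {Z : C}
    (φ : T.X₂ ⟶ Z) [Mono (T.f ≫ φ)] : (∃ s : T.X₃ ⟶ T.X₂, s ≫ T.g = 𝟙 _) ∨ Mono φ := by
  have : Mono (kernel.ι φ ≫ T.g) := Preadditive.mono_of_cancel_zero _ fun {A} a ha => by
    have := hT.mono_f
    rw [← Category.assoc] at ha
    have h1 := hT.exact.lift_f _ ha
    have h2 : hT.exact.lift _ ha = 0 := by
      rw [← cancel_mono (T.f ≫ φ), ← Category.assoc, h1, Category.assoc, kernel.condition,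
        comp_zero, zero_comp]
    rw [h2, zero_comp] at h1
    rw [← cancel_mono (kernel.ι φ), ← h1, zero_comp]
  by_cases h : kernel.ι φ ≫ T.g = 0
  · right
    have h1 : IsZero (kernel φ) := IsZero.of_mono_eq_zero _ h
    exact Preadditive.mono_of_kernel_zero (h1.eq_of_src _ _)
  · left
    have := isIso_of_mono_of_nonzero h
    exact ⟨inv (kernel.ι φ ≫ T.g) ≫ kernel.ι φ, by rw [Category.assoc, IsIso.inv_hom_id]⟩

end FiniteLength

/-! ### Morphisms and first extensions between standard and costandard objects. -/

namespace Stratification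

section Basic

variable {R : Type u} [Category.{v} R] [Abelian R]
  {B : Type x} {Λ : Type y} [PartialOrder Λ] {S : Stratification R B Λ} {ε : Λ → Sign}

lemma eq_of_isSubquotient_L {b c : B} (h : IsSubquotient (S.L c) (S.L b)) : c = b := by
  obtain ⟨A, i, p, hi, hp⟩ := h
  have hi0 : i ≠ 0 := by
    rintro rfl
    exact Simple.not_isZero (S.L c) ((IsZero.of_mono_zero A (S.L b)).of_epi p)
  have := isIso_of_mono_of_nonzero hi0
  have h0 : inv i ≫ p ≠ 0 := by
    intro h
    have hp0 : p = 0 := by rwa [IsIso.inv_comp_eq, comp_zero] at h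
    subst hp0
    exact Simple.not_isZero (S.L c) (IsZero.of_epi_zero A (S.L c))
  have := isIso_of_hom_simple h0
  exact (S.eq_of_iso b c ⟨asIso (inv i ≫ p)⟩).symm

lemma serre_L {T : Set B} {b : B} (hb : b ∈ T) : serre S.L T (S.L b) :=
  fun _ h => eq_of_isSubquotient_L h ▸ hb

omit [Abelian R] in
lemma serre_mono {L : B → R} {T T' : Set B} (h : T ⊆ T') {X : R} (hX : serre L T X) :
    serre L T' X :=
  fun b hb => h (hX b hb)

lemma serre_induction [∀ X : R, IsArtinianObject X] [∀ X : R, IsNoetherianObject X] {T : Set B}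
    {P : R → Prop} (zero : ∀ X, IsZero X → P X) (simple : ∀ X, ∀ b ∈ T, Nonempty (X ≅ S.L b) → P X)
    (ext : ∀ U : ShortComplex R, U.ShortExact → P U.X₁ → P U.X₃ → P U.X₂) {X : R}
    (hX : serre S.L T X) : P X := by
  induction X using finite_length_induction with
  | zero X h => exact zero X h
  | ext U hU h ih =>
    have := hU.mono_f
    have := hU.epi_g
    obtain ⟨b, ⟨e⟩⟩ := S.exists_iso _ h
    refine ext U hU (simple _ b (hX b ?_) ⟨e⟩) (ih ((serre S.L T).prop_of_epi U.g hX))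
    exact ⟨U.X₁, U.f, e.hom, inferInstance, inferInstance⟩

/-- A nonzero morphism makes `L b` a factor of `Y` and `L c` a factor of `X`, so the strata agree.
In a common stratum one of the two objects is proper, and its only factor in that stratum is its own
label. -/
lemma hom_eq_zero {b c : B} {X Y : R} (hX : S.StandardLike ε b X) (hY : S.CostandardLike ε c Y)
    (h : b ≠ c) (f : X ⟶ Y) : f = 0 := by
  by_contra hf
  obtain ⟨p, _, hp, hk⟩ := hX.exists_epi
  obtain ⟨i, _, hi, hc⟩ := hY.exists_mono
  have h1 : IsSubquotient (S.L b) Y := isSubquotient_of_essential hp hf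
  have h2 : IsSubquotient (S.L c) X := isSubquotient_of_essential_mono hi hf
  have heq : S.ρ b = S.ρ c := le_antisymm (hY.le b h1) (hX.le c h2)
  cases hs : ε (S.ρ b) with
  | minus =>
    rcases h2.of_shortExact (shortExact_of_epi p) with h3 | h3
    · exact (hk hs c h3).ne heq.symm
    · exact h (eq_of_isSubquotient_L h3).symm
  | plus =>
    rcases h1.of_shortExact (shortExact_of_mono i) with h3 | h3
    · exact h (eq_of_isSubquotient_L h3)
    · exact (hc (heq ▸ hs) b h3).ne heq

/-- Every morphism factors through `L b`. For sign `-` the kernel of `X ⟶ L b` lies in lower strata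
and cannot hit the socle of `Y`; sign `+` is dual. Schur's lemma then leaves one scalar. -/
lemma exists_hom_basis {k : Type w} [Field k] [IsAlgClosed k] [Linear k R]
    [∀ b, Module.Finite k (S.L b ⟶ S.L b)] {b : B} {X Y : R} (hX : S.StandardLike ε b X)
    (hY : S.CostandardLike ε b Y) : ∃ f₀ : X ⟶ Y, f₀ ≠ 0 ∧ ∀ f : X ⟶ Y, ∃ a : k, f = a • f₀ := by
  obtain ⟨p, _, hp, hk⟩ := hX.exists_epi
  obtain ⟨i, _, hi, hc⟩ := hY.exists_mono
  have hi0 : i ≠ 0 := fun h => Simple.not_isZero (S.L b) (IsZero.of_mono_eq_zero i h)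
  have hp0 : p ≠ 0 := fun h => Simple.not_isZero (S.L b) (IsZero.of_epi_eq_zero p h)
  refine ⟨p ≫ i, fun h => hi0 (zero_of_epi_comp p h), fun f => ?_⟩
  cases hs : ε (S.ρ b) with
  | minus =>
    have h0 : kernel.ι p ≫ f = 0 := by
      by_contra h
      exact lt_irrefl _ (hk hs b (isSubquotient_of_essential_mono hi h))
    obtain ⟨h, rfl⟩ : ∃ h, p ≫ h = f := ⟨Abelian.epiDesc p f h0, Abelian.comp_epiDesc _ _ _⟩
    by_cases h1 : h = 0
    · exact ⟨0, by simp [h1]⟩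
    · obtain ⟨j, hj⟩ := exists_endo_of_essential_mono hi h1
      obtain ⟨a, ha⟩ := endomorphism_simple_eq_smul_id k j
      have h2 : a • h = i := by rw [hj, ← ha, Linear.smul_comp, Category.id_comp]
      have ha0 : a ≠ 0 := by
        rintro rfl
        rw [zero_smul] at h2
        exact hi0 h2.symm
      exact ⟨a⁻¹, by rw [← h2, Linear.comp_smul, smul_smul, inv_mul_cancel₀ ha0, one_smul]⟩
  | plus =>
    have h0 : f ≫ cokernel.π i = 0 := by
      by_contra h
      exact lt_irrefl _ (hc hs b (isSubquotient_of_essential hp h))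
    obtain ⟨g, rfl⟩ : ∃ g, g ≫ i = f := ⟨Abelian.monoLift i f h0, Abelian.monoLift_comp _ _ _⟩
    by_cases h1 : g = 0
    · exact ⟨0, by simp [h1]⟩
    · have := epi_of_nonzero_to_simple h1
      obtain ⟨q, -, hq⟩ := exists_epi_image_of_essential hp h1
      have : Epi (Abelian.image.ι g) := by
        have : Epi (Abelian.factorThruImage g ≫ Abelian.image.ι g) := by
          rw [Abelian.image.fac]; infer_instance
        exact epi_of_epi (Abelian.factorThruImage g) _
      have : IsIso (Abelian.image.ι g) := isIso_of_mono_of_epi _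
      obtain ⟨a, ha⟩ := endomorphism_simple_eq_smul_id k (inv (Abelian.image.ι g) ≫ q)
      have h2 : a • g = p := by
        have h3 : g ≫ inv (Abelian.image.ι g) = Abelian.factorThruImage g := by
          rw [IsIso.comp_inv_eq, Abelian.image.fac]
        rw [← hq, ← h3, Category.assoc, ← ha, Linear.comp_smul, Category.comp_id]
      have ha0 : a ≠ 0 := by
        rintro rfl
        rw [zero_smul] at h2
        exact hp0 h2.symm
      exact ⟨a⁻¹, by rw [← h2, Linear.smul_comp, smul_smul, inv_mul_cancel₀ ha0, one_smul]⟩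

end Basic

section Ext

open Abelian

variable {R : Type u} [SmallCategory R] [Abelian R]
  [∀ X : R, IsArtinianObject X] [∀ X : R, IsNoetherianObject X]
  {B : Type x} {Λ : Type y} [PartialOrder Λ] {S : Stratification R B Λ} {ε : Λ → Sign}

lemma IsEpsStandard.like {b : B} {X : R} (h : S.IsEpsStandard ε b X) : S.StandardLike ε b X :=
  h.standardLike inferInstance inferInstance

lemma IsEpsCostandard.like {b : B} {X : R} (h : S.IsEpsCostandard ε b X) :
    S.CostandardLike ε b X :=
  h.costandardLike inferInstance inferInstance

/-- If `W` has a flag with sections in strata `≥ l`, a subobject of `W` without composition factors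
in strata `> l` belongs to `R_{≤ l}`. -/
lemma le_of_mono_flag {l : Λ} {W : R} {bs : List B} (hW : HasFlag (S.IsEpsCostandard ε) W bs)
    (hbs : ∀ b ∈ bs, l ≤ S.ρ b) {E : R} (m : E ⟶ W) [Mono m]
    (hE : ∀ e, IsSubquotient (S.L e) E → l ≤ S.ρ e → S.ρ e ≤ l) : S.le l E := by
  induction hW generalizing E with
  | nil X hX => exact (S.le l).prop_of_isZero (hX.of_mono m)
  | cons T hT b bs hb _ ih =>
    have := hT.mono_f
    let q := Abelian.factorThruImage (m ≫ T.g)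
    refine (S.le l).prop_X₂_of_shortExact (shortExact_of_epi q) ?_ ?_
    · have h0 : (kernel.ι q ≫ m) ≫ T.g = 0 := by
        have h1 : q ≫ Abelian.image.ι (m ≫ T.g) = m ≫ T.g := Abelian.image.fac _
        have h2 : kernel.ι q ≫ q ≫ Abelian.image.ι (m ≫ T.g) = 0 := by
          rw [kernel.condition_assoc, zero_comp]
        rwa [h1, ← Category.assoc] at h2
      have hn := hT.exact.lift_f _ h0
      set n := hT.exact.lift _ h0
      have : Mono (n ≫ T.f) := by rw [hn]; infer_instance
      have : Mono n := mono_of_mono n T.f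
      by_cases hn0 : n = 0
      · exact (S.le l).prop_of_isZero (IsZero.of_mono_eq_zero n hn0)
      · obtain ⟨i, _, hi, -⟩ := hb.like.exists_mono
        have h1 : S.ρ b ≤ l := hE b ((isSubquotient_of_essential_mono hi hn0).of_mono (kernel.ι q))
          (hbs b (by simp))
        exact serre_mono (fun e (he : S.ρ e ≤ _) => he.trans h1)
          ((S.le _).prop_of_mono n hb.like.le)
    · exact ih (fun b hb => hbs b (by simp [hb])) (Abelian.image.ι (m ≫ T.g))
        fun e he => hE e (he.of_epi q)

-- The copy of `Y` is the bottom section of one chosen member `W₀`. Its position in the flags of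
-- other members is not controlled, which is why later arguments allow arbitrary monomorphisms into
-- flagged objects.
omit [∀ X : R, IsArtinianObject X] [∀ X : R, IsNoetherianObject X] in
lemma IsLowerFiniteEpsStratified.exists_mono_injective (hS : S.IsLowerFiniteEpsStratified ε)
    {b : B} {Y : R} (hY : S.IsEpsCostandard ε b Y) : ∃ (I : Ind R) (j : toInd Y ⟶ I)
      (F : Set (Subobject I)) (W₀ : Subobject I) (n : toInd Y ⟶ (W₀ : Ind R)), Injective I ∧
      Mono j ∧ DirectedOn (· ≤ ·) F ∧ IsLUB F ⊤ ∧ W₀ ∈ F ∧ n ≫ W₀.arrow = j ∧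
      ∀ W ∈ F, ∃ bs : List B, S.HasCostandardFlag ε (W : Ind R) bs ∧
        ∀ c ∈ bs, S.ρ b ≤ S.ρ c := by
  obtain ⟨I, hI, -, F, hF, hF'⟩ := hS.exists_injective b
  obtain ⟨W₀, hW₀⟩ := hF.nonempty
  obtain ⟨bs, ⟨X, ⟨e⟩, hX⟩, -⟩ := hF' W₀ hW₀
  obtain ⟨Y', ⟨e'⟩, i, hi⟩ : ∃ Y', Nonempty (Y ≅ Y') ∧ ∃ i : Y' ⟶ X, Mono i := by
    cases hX with
    | cons T hT _ _ hb _ => exact ⟨T.X₁, hY.nonempty_iso hb, T.f, hT.mono_f⟩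
  refine ⟨I, (Ind.yoneda.map (e'.hom ≫ i) ≫ e.hom) ≫ W₀.arrow, F, W₀, _, hI, inferInstance,
    hF.directed, hF.sum_eq, hW₀, rfl, fun W hW => ?_⟩
  obtain ⟨cs, hcs, hle⟩ := hF' W hW
  refine ⟨b :: cs, hcs, fun c hc => ?_⟩
  rcases List.mem_cons.1 hc with rfl | hc
  · exact le_rfl
  · exact hle c hc

/-- Within `R_{≤ ρ c}` the splitting properties of `Y` suffice. The injective object serves to show
that a non-split extension would lie in `R_{≤ ρ c}`. -/
lemma ext_one_L_costandard (hS : S.IsLowerFiniteEpsStratified ε) {c d : B} {Y : R}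
    (hY : S.IsEpsCostandard ε c Y)
    (h : ¬ S.ρ c ≤ S.ρ d ∨ (ε (S.ρ c) = .minus ∧ S.ρ d ≤ S.ρ c)) :
    Subsingleton (Ext (toInd (S.L d)) (toInd Y) 1) := by
  refine ext_one_of_split fun E i q w hE => ?_
  have : Mono i := hE.mono_f
  have hco : cokernel i ≅ S.L d := (cokernelIsCokernel i).coconePointUniqueUpToIso hE.gIsCokernel
  have hle : S.ρ d ≤ S.ρ c → ∃ s : S.L d ⟶ E, s ≫ q = 𝟙 _ := fun hdc => by
    obtain ⟨r, hr⟩ : ∃ r : E ⟶ Y, i ≫ r = 𝟙 Y := by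
      rcases h with h | ⟨h, -⟩
      · exact hY.like.split_lt i ((S.lt _).prop_of_iso hco.symm
          (serre_L (lt_of_le_not_ge hdc h)))
      · exact hY.like.split_le h i ((S.le _).prop_of_iso hco.symm (serre_L hdc))
    exact exists_section_of_retraction hE r hr
  rcases h with h | ⟨-, h⟩
  swap
  · exact hle h
  obtain ⟨I, j, F, W₀, n, _, _, hdir, hsup, hW₀, -, hflag⟩ := hS.exists_mono_injective hY
  let φ : toInd E ⟶ I := Injective.factorThru j (Ind.yoneda.map i)
  have hφ : Ind.yoneda.map i ≫ φ = j := Injective.comp_factorThru _ _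
  obtain ⟨W, hW, g, hg⟩ := exists_factors ⟨_, hW₀⟩ hdir hsup φ
  obtain ⟨bs, ⟨X, ⟨e⟩, hX⟩, hbs⟩ := hflag W hW
  obtain ⟨ψ, hψ⟩ := Ind.yoneda.map_surjective (g ≫ e.inv)
  have : Mono (Ind.yoneda.map (i ≫ ψ)) := by
    have : Mono (Ind.yoneda.map (i ≫ ψ) ≫ e.hom ≫ W.arrow) := by
      have h1 : Ind.yoneda.map (i ≫ ψ) ≫ e.hom ≫ W.arrow = j := by
        rw [Functor.map_comp, hψ, ← hφ, ← hg]
        simp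
      rw [h1]
      infer_instance
    exact mono_of_mono _ (e.hom ≫ W.arrow)
  have : Mono (i ≫ ψ) := Ind.yoneda.mono_of_mono_map this
  have hsimple : Simple (ShortComplex.mk i q w).X₃ := inferInstanceAs (Simple (S.L d))
  rcases exists_section_or_mono hE ψ with h1 | h1
  · exact h1
  -- The factors of `E` are those of `Y`, in strata `≤ ρ c`, and `L d`, whose stratum is not `≥ ρ
  -- c`; this is the input for confining subobjects of a flagged object.
  have hE' : S.le (S.ρ c) E := le_of_mono_flag hX hbs ψ fun e he hce => by
    rcases he.of_shortExact hE with h2 | h2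
    · exact hY.like.le e h2
    · obtain rfl := eq_of_isSubquotient_L h2
      exact absurd hce h
  have : Epi q := hE.epi_g
  exact hle ((S.le _).prop_of_epi q hE' d (isSubquotient_self _))

lemma ext_one_serre_costandard (hS : S.IsLowerFiniteEpsStratified ε) {c : B} {X Y : R}
    (hY : S.IsEpsCostandard ε c Y) {T : Set B} (hX : serre S.L T X)
    (h : ∀ d ∈ T, ¬ S.ρ c ≤ S.ρ d ∨ (ε (S.ρ c) = .minus ∧ S.ρ d ≤ S.ρ c)) :
    Subsingleton (Ext (toInd X) (toInd Y) 1) := by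
  refine serre_induction (P := fun X => Subsingleton (Ext (toInd X) (toInd Y) 1))
    (fun X hX => ext_of_isZero_left (Ind.yoneda.map_isZero hX) 1) ?_ ?_ hX
  · rintro X b hb ⟨e⟩
    have := ext_one_L_costandard hS hY (h b hb)
    exact ext_of_iso_left (Ind.yoneda.mapIso e).symm 1
  · intro U hU h₁ h₃
    have hU' := hU.map_of_exact (Ind.yoneda (C := R))
    have : Subsingleton (Ext (U.map Ind.yoneda).X₁ (toInd Y) 1) := h₁
    have : Subsingleton (Ext (U.map Ind.yoneda).X₃ (toInd Y) 1) := h₃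
    exact ext_X₂_of_contravariant hU' 1

/-- Three cases. If `ρ c ≰ ρ b`, the injective object for `c` decides. If `ρ c < ρ b`, colocality of
`X` splits the extension. In a common stratum `X` is relatively projective for sign `+`, and `Y`
relatively injective for sign `-`. -/
lemma ext_one_standard_costandard (hS : S.IsLowerFiniteEpsStratified ε) {b c : B} {X Y : R}
    (hX : S.IsEpsStandard ε b X) (hY : S.IsEpsCostandard ε c Y) :
    Subsingleton (Ext (toInd X) (toInd Y) 1) := by
  by_cases hcb : S.ρ c ≤ S.ρ b
  swap
  · exact ext_one_serre_costandard hS hY hX.like.le fun d (hd : S.ρ d ≤ S.ρ b) =>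
      Or.inl fun h => hcb (h.trans hd)
  refine ext_one_of_split fun E i q w hE => ?_
  have : Mono i := hE.mono_f
  have : Epi q := hE.epi_g
  have hco : cokernel i ≅ X := (cokernelIsCokernel i).coconePointUniqueUpToIso hE.gIsCokernel
  have hke : kernel q ≅ Y := (kernelIsKernel q).conePointUniqueUpToIso hE.fIsKernel
  rcases hcb.lt_or_eq with h | h
  · exact hX.like.split_lt q ((S.lt _).prop_of_iso hke.symm
      (serre_mono (fun e (he : S.ρ e ≤ _) => he.trans_lt h) hY.like.le))
  · cases hs : ε (S.ρ b) with
    | plus => exact hX.like.split_le hs q ((S.le _).prop_of_iso hke.symm (h ▸ hY.like.le))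
    | minus =>
      obtain ⟨r, hr⟩ := hY.like.split_le (h ▸ hs) i
        ((S.le _).prop_of_iso hco.symm (h ▸ hX.like.le))
      exact exists_section_of_retraction hE r hr

end Ext

end Stratification

/-! ### Preimages and iterated quotients of short exact sequences. -/

section ShortExactConstructions

variable {C : Type u} [Category.{v} C] [Abelian C]

/-- The preimage of a subobject of the quotient, and the resulting quotient. -/
lemma shortExact_preimage {T : ShortComplex C} (hT : T.ShortExact) {A D : C} (i : A ⟶ T.X₃)
    (q : T.X₃ ⟶ D) (w : i ≫ q = 0) (h : (ShortComplex.mk i q w).ShortExact) :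
    (ShortComplex.mk (pullback.fst T.g i) (T.g ≫ q) (by
      rw [← Category.assoc, pullback.condition, Category.assoc, w, comp_zero])).ShortExact := by
  have : Mono i := h.mono_f
  have : Epi q := h.epi_g
  have := hT.epi_g
  refine ⟨ShortComplex.exact_of_f_is_kernel _ (KernelFork.IsLimit.ofι' _ _ fun {A} k hk => ?_)⟩
  have hk' : (k ≫ T.g) ≫ q = 0 := by rwa [Category.assoc]
  exact ⟨pullback.lift k (h.exact.lift _ hk') (h.exact.lift_f _ hk').symm, pullback.lift_fst _ _ _⟩

/-- The quotient by a subobject meeting the first term of a short exact sequence trivially. -/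
lemma shortExact_cokernel_of_mono {T : ShortComplex C} (hT : T.ShortExact) {A D : C} (s : A ⟶ T.X₂)
    (q : T.X₃ ⟶ D) (w : (s ≫ T.g) ≫ q = 0) (h : (ShortComplex.mk (s ≫ T.g) q w).ShortExact) :
    ∃ (b : cokernel s ⟶ D) (w' : (T.f ≫ cokernel.π s) ≫ b = 0),
      (ShortComplex.mk (T.f ≫ cokernel.π s) b w').ShortExact := by
  have := hT.mono_f
  have := hT.epi_g
  have : Mono (s ≫ T.g) := h.mono_f
  have : Epi q := h.epi_g
  have : Mono s := mono_of_mono s T.g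
  let b : cokernel s ⟶ D := cokernel.desc s (T.g ≫ q) (by rwa [← Category.assoc])
  have hb : cokernel.π s ≫ b = T.g ≫ q := cokernel.π_desc _ _ _
  have hw : (T.f ≫ cokernel.π s) ≫ b = 0 := by
    rw [Category.assoc, hb, ← Category.assoc, T.zero, zero_comp]
  refine ⟨b, hw, ?_⟩
  have : Mono (T.f ≫ cokernel.π s) := Preadditive.mono_of_cancel_zero _ fun {Z} z hz => by
    have hs := (shortExact_of_mono s).exact
    rw [← Category.assoc] at hz
    have h1 : hs.lift _ hz ≫ s = z ≫ T.f := hs.lift_f _ hz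
    have h2 : hs.lift _ hz = 0 := by
      rw [← cancel_mono (s ≫ T.g), ← Category.assoc, h1, Category.assoc, T.zero, comp_zero,
        zero_comp]
    rw [h2, zero_comp] at h1
    exact zero_of_comp_mono T.f h1.symm
  have : Epi b := by
    have : Epi (cokernel.π s ≫ b) := by rw [hb]; exact epi_comp _ _
    exact epi_of_epi (cokernel.π s) _
  refine ⟨ShortComplex.exact_of_g_is_cokernel _
    (CokernelCofork.IsColimit.ofπ' _ _ fun {Z} k hk => ?_)⟩
  have hk' : T.f ≫ cokernel.π s ≫ k = 0 := by rwa [← Category.assoc]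
  have h1 : T.g ≫ hT.exact.desc _ hk' = cokernel.π s ≫ k := hT.exact.g_desc _ hk'
  have h2 : (s ≫ T.g) ≫ hT.exact.desc _ hk' = 0 := by
    rw [Category.assoc, h1, cokernel.condition_assoc, zero_comp]
  refine ⟨h.exact.desc _ h2, ?_⟩
  have h3 : q ≫ h.exact.desc _ h2 = hT.exact.desc _ hk' := h.exact.g_desc _ h2
  dsimp only
  rw [← cancel_epi (cokernel.π s), ← Category.assoc, hb, Category.assoc, h3, h1]

/-- The third isomorphism theorem: if `N ⊆ A ⊆ W`, then `W / A` is the quotient of `W / N` by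
`A / N`. -/
lemma shortExact_third_iso {N A W D Q : C} {f : A ⟶ W} {g : W ⟶ D} {w : f ≫ g = 0}
    (hT : (ShortComplex.mk f g w).ShortExact) {f' : N ⟶ W} {g' : W ⟶ Q} {w' : f' ≫ g' = 0}
    (hT' : (ShortComplex.mk f' g' w').ShortExact) (n : N ⟶ A) (hn : n ≫ f = f') :
    ∃ (a : cokernel n ⟶ Q) (b : Q ⟶ D) (w : a ≫ b = 0), (ShortComplex.mk a b w).ShortExact := by
  have : Mono f' := hT'.mono_f
  have : Epi g' := hT'.epi_g
  have : Mono f := hT.mono_f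
  have : Epi g := hT.epi_g
  let a : cokernel n ⟶ Q := cokernel.desc n (f ≫ g') (by rw [← Category.assoc, hn, w'])
  have ha : cokernel.π n ≫ a = f ≫ g' := cokernel.π_desc _ _ _
  have hf' : f' ≫ g = 0 := by
    rw [show f' ≫ g = n ≫ f ≫ g by rw [← Category.assoc, hn], w, comp_zero]
  let b : Q ⟶ D := hT'.exact.desc g hf'
  have hb : g' ≫ b = g := hT'.exact.g_desc _ _
  have : Epi (g' ≫ b) := by rw [hb]; infer_instance
  have : Epi b := epi_of_epi g' b
  have hab : a ≫ b = 0 := by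
    rw [← cancel_epi (cokernel.π n), ← Category.assoc, ha, Category.assoc, hb, w, comp_zero]
  refine ⟨a, b, hab, ?_⟩
  have : Mono a := Preadditive.mono_of_cancel_zero _ fun {Z} z hz => by
    obtain ⟨Z', p, hp, z', hz'⟩ := surjective_up_to_refinements_of_epi (cokernel.π n) z
    have h1 : (z' ≫ f) ≫ g' = 0 := by
      rw [Category.assoc, ← ha, ← Category.assoc, ← hz', Category.assoc, hz, comp_zero]
    have h2 : hT'.exact.lift _ h1 ≫ f' = z' ≫ f := hT'.exact.lift_f _ h1
    have h3 : z' = hT'.exact.lift _ h1 ≫ n := by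
      rw [← cancel_mono f, Category.assoc, hn]
      exact h2.symm
    rw [← cancel_epi p, hz', h3, Category.assoc, cokernel.condition, comp_zero, comp_zero]
  refine ⟨ShortComplex.exact_of_g_is_cokernel _
    (CokernelCofork.IsColimit.ofπ' _ _ fun {Z} k hk => ?_)⟩
  have hk' : f ≫ g' ≫ k = 0 := by
    rw [← Category.assoc, ← ha, Category.assoc]
    exact hk ▸ comp_zero
  refine ⟨hT.exact.desc (g' ≫ k) hk', ?_⟩
  dsimp only
  rw [← cancel_epi g', ← Category.assoc, hb]
  exact hT.exact.g_desc _ hk'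

end ShortExactConstructions

/-! ### Rearranging flags, and quotients by a costandard subobject. -/

namespace Stratification

open Abelian

variable {R : Type u} [SmallCategory R] [Abelian R]
  [∀ X : R, IsArtinianObject X] [∀ X : R, IsNoetherianObject X]
  {B : Type x} {Λ : Type y} [PartialOrder Λ] {S : Stratification R B Λ} {ε : Λ → Sign}

omit [∀ X : R, IsArtinianObject X] [∀ X : R, IsNoetherianObject X] in
lemma ext_of_hasFlag {V : Ind R} {n : ℕ} (h : ∀ (c : B) (Y : R), S.IsEpsCostandard ε c Y →
    Subsingleton (Ext V (toInd Y) n)) {W : R} {bs : List B}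
    (hW : HasFlag (S.IsEpsCostandard ε) W bs) : Subsingleton (Ext V (toInd W) n) := by
  induction hW with
  | nil X hX => exact ext_of_isZero_right (Ind.yoneda.map_isZero hX) n
  | cons T hT b bs hb _ ih =>
    have hT' := hT.map_of_exact (Ind.yoneda (C := R))
    have : Subsingleton (Ext V (T.map Ind.yoneda).X₁ n) := h b _ hb
    have : Subsingleton (Ext V (T.map Ind.yoneda).X₃ n) := ih
    exact ext_X₂_of_covariant hT' n

lemma serre_of_hasFlag {T : Set B} {W : R} {bs : List B} (hW : HasFlag (S.IsEpsCostandard ε) W bs)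
    (hbs : ∀ b ∈ bs, ∀ d, S.ρ d ≤ S.ρ b → d ∈ T) : serre S.L T W := by
  induction hW with
  | nil X hX => exact (serre S.L T).prop_of_isZero hX
  | cons U hU b bs hb _ ih =>
    exact (serre S.L T).prop_X₂_of_shortExact hU
      (serre_mono (hbs b (by simp)) hb.like.le) (ih fun b hb => hbs b (by simp [hb]))

lemma le_of_hasFlag {l : Λ} {W : R} {bs : List B} (hW : HasFlag (S.IsEpsCostandard ε) W bs)
    (hbs : ∀ b ∈ bs, S.ρ b ≤ l) : S.le l W :=
  serre_of_hasFlag hW fun b hb _ hd => hd.trans (hbs b hb)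

/-- A nonzero morphism into a section would have the simple socle of that section in its image. -/
lemma hom_flag_eq_zero {W : R} {bs : List B} (hW : HasFlag (S.IsEpsCostandard ε) W bs) {E : R}
    (hE : ∀ b ∈ bs, ¬ IsSubquotient (S.L b) E) (h : E ⟶ W) : h = 0 := by
  induction hW with
  | nil X hX => exact hX.eq_of_tgt _ _
  | cons T hT b bs hb _ ih =>
    have := hT.mono_f
    have h0 : h ≫ T.g = 0 := ih (fun b hb => hE b (by simp [hb])) _
    have h1 := hT.exact.lift_f _ h0
    obtain ⟨i, _, hi, -⟩ := hb.like.exists_mono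
    by_contra hne
    have h2 : hT.exact.lift _ h0 ≠ 0 := by
      intro h3
      rw [h3, zero_comp] at h1
      exact hne h1.symm
    exact hE b (by simp) (isSubquotient_of_essential_mono hi h2)

/-- A flag with sections in strata `≥ l` can be rearranged with the sections in stratum `l` at the
bottom. -/
lemma exists_flag_bottom_stratum (hS : S.IsLowerFiniteEpsStratified ε) {l : Λ} {W : R}
    {bs : List B} (hW : HasFlag (S.IsEpsCostandard ε) W bs) (hbs : ∀ b ∈ bs, l ≤ S.ρ b) :
    ∃ (A D : R) (i : A ⟶ W) (q : W ⟶ D) (w : i ≫ q = 0) (as ds : List B),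
      (ShortComplex.mk i q w).ShortExact ∧ HasFlag (S.IsEpsCostandard ε) A as ∧
      HasFlag (S.IsEpsCostandard ε) D ds ∧ (∀ a ∈ as, S.ρ a = l) ∧ ∀ d ∈ ds, l < S.ρ d := by
  induction hW with
  | nil X hX =>
    refine ⟨X, X, 0, 0, comp_zero, [], [], ?_, .nil X hX, .nil X hX, by simp, by simp⟩
    have : Mono (0 : X ⟶ X) := ⟨fun _ _ _ => hX.eq_of_tgt _ _⟩
    have : Epi (0 : X ⟶ X) := ⟨fun _ _ _ => hX.eq_of_src _ _⟩
    exact ⟨ShortComplex.exact_of_isZero_X₂ _ hX⟩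
  | cons T hT b bs hb _ ih =>
    obtain ⟨A, D, i, q, w, as, ds, hAD, hA, hD, has, hds⟩ := ih fun b hb => hbs b (by simp [hb])
    have : Mono i := hAD.mono_f
    rcases (hbs b (by simp)).lt_or_eq with hlt | heq
    -- When the bottom section lies in a higher stratum, there are no extensions of `A` by it, so
    -- `A` lifts to the whole object and slips underneath.
    · have : Subsingleton (Ext (toInd A) (T.map Ind.yoneda).X₁ 1) :=
        ext_one_serre_costandard hS hb (le_of_hasFlag hA fun a ha => (has a ha).le)
          fun d hd => Or.inl fun h => (hlt.trans_le (h.trans hd)).false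
      obtain ⟨s, hs⟩ := exists_lift_of_ext_one (hT.map_of_exact (Ind.yoneda (C := R)))
        (Ind.yoneda.map i)
      obtain ⟨s, rfl⟩ := Ind.yoneda.map_surjective s
      have hs' : s ≫ T.g = i := Ind.yoneda.map_injective (by rw [Functor.map_comp]; exact hs)
      subst hs'
      have : Mono s := mono_of_mono s T.g
      have hD' : HasFlag (S.IsEpsCostandard ε) (cokernel s) (b :: ds) := by
        obtain ⟨_, _, h⟩ := shortExact_cokernel_of_mono hT s q w hAD
        exact .cons _ h b ds hb hD
      exact ⟨A, cokernel s, s, cokernel.π s, cokernel.condition s, as, b :: ds,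
        shortExact_of_mono s, hA, hD', has, by simpa using ⟨hlt, hds⟩⟩
    · exact ⟨_, D, _, _, _, b :: as, ds, shortExact_preimage hT i q w hAD,
        .cons _ (shortExact_pullback hT i) b as hb hA, hD, by simpa using ⟨heq.symm, has⟩, hds⟩

/-- A monomorphism between costandard objects of positive sign with the same label is an
isomorphism. -/
lemma isIso_of_mono_costandard {c : B} (hc : ε (S.ρ c) = .plus) {N M : R}
    (hN : S.IsEpsCostandard ε c N) (hM : S.IsEpsCostandard ε c M) (m : N ⟶ M) [Mono m] :
    IsIso m := by
  obtain ⟨i, _, -, -⟩ := hN.like.exists_mono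
  obtain ⟨i', _, hi', hlt⟩ := hM.like.exists_mono
  have him : i ≫ m ≠ 0 := fun h =>
    Simple.not_isZero (S.L c) (IsZero.of_mono_eq_zero i (zero_of_comp_mono m h))
  obtain ⟨j, hj⟩ := exists_endo_of_essential_mono hi' him
  have : Mono (j ≫ i ≫ m) := by rw [← hj]; infer_instance
  have : Mono j := mono_of_mono j (i ≫ m)
  have h0 : i' ≫ cokernel.π m = 0 := by
    rw [hj, Category.assoc, Category.assoc, cokernel.condition, comp_zero, comp_zero]
  -- The socle of `M` lies in `N`, so the cokernel of `m` is a quotient of `M` modulo its socle and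
  -- lies in lower strata. Hence `m` splits, and the retraction is injective because it is so on the
  -- essential socle.
  have : Epi (cokernel.desc i' (cokernel.π m) h0) := by
    have : Epi (cokernel.π i' ≫ cokernel.desc i' (cokernel.π m) h0) := by
      rw [cokernel.π_desc]; infer_instance
    exact epi_of_epi (cokernel.π i') _
  obtain ⟨r, hr⟩ := hN.like.split_lt m
    ((S.lt _).prop_of_epi (cokernel.desc i' (cokernel.π m) h0) (hlt hc))
  have : Mono r := hi' r (by
    have : i' ≫ r = j ≫ i := by rw [hj, Category.assoc, Category.assoc, hr, Category.comp_id]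
    rw [this]
    exact mono_comp _ _)
  refine ⟨r, hr, ?_⟩
  rw [← cancel_mono r, Category.assoc, hr, Category.comp_id, Category.id_comp]

/-- Induction on the flag of `A`. If `N` still embeds modulo the bottom section, the cokernel of `n`
is an extension of a smaller case by that section. Otherwise `N` is the bottom section, and the rest
of the flag is a flag of the cokernel. -/
lemma ext_one_cokernel_of_stratum_plus {V : Ind R} {l : Λ} (hl : ε l = .plus)
    (hV : ∀ (c : B) (Y : R), S.IsEpsCostandard ε c Y → Subsingleton (Ext V (toInd Y) 1))
    {c : B} (hc : S.ρ c = l) {N : R} (hN : S.IsEpsCostandard ε c N) {A : R} {as : List B}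
    (hA : HasFlag (S.IsEpsCostandard ε) A as) (has : ∀ a ∈ as, S.ρ a = l) (n : N ⟶ A) [Mono n] :
    Subsingleton (Ext V (toInd (cokernel n)) 1) := by
  obtain ⟨i, _, hi, hlt⟩ := hN.like.exists_mono
  have hi0 : i ≠ 0 := fun h => Simple.not_isZero (S.L c) (IsZero.of_mono_eq_zero i h)
  induction hA with
  | nil X hX =>
    exact ext_of_isZero_right (Ind.yoneda.map_isZero (hX.of_epi (cokernel.π n))) 1
  | cons T hT b bs hb hbs ih =>
    have := hT.mono_f
    have := hT.epi_g
    by_cases hmono : Mono (n ≫ T.g)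
    · have : Subsingleton (Ext V (toInd (cokernel (n ≫ T.g))) 1) :=
        ih (fun a ha => has a (by simp [ha])) (n ≫ T.g)
      obtain ⟨_, _, h⟩ := shortExact_cokernel_of_mono hT n (cokernel.π (n ≫ T.g))
        (cokernel.condition _) (shortExact_of_mono _)
      have h' := h.map_of_exact (Ind.yoneda (C := R))
      have h1 := hV b _ hb
      exact @ext_X₂_of_covariant _ _ _ _ V _ h' 1 h1 this
    · -- the socle of `N` is killed by `T.g`
      have h0 : i ≫ n ≫ T.g = 0 := by
        by_contra h
        exact hmono (hi _ (mono_of_nonzero_from_simple h))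
      have hng : n ≫ T.g = 0 := by
        -- For sign `+`, `N` modulo its socle has only factors below stratum `l`, whereas the
        -- remaining sections have their socles in stratum `l`.
        have h1 : cokernel.desc i (n ≫ T.g) h0 = 0 := hom_flag_eq_zero hbs (fun e he h => by
          have := hlt (hc ▸ hl) e h
          rw [Set.mem_ofPred_eq, hc, has e (by simp [he])] at this
          exact this.false) _
        rw [← cokernel.π_desc i (n ≫ T.g) h0, h1, comp_zero]
      have hm : hT.exact.lift n hng ≫ T.f = n := hT.exact.lift_f _ _
      set m := hT.exact.lift n hng
      have : Mono (m ≫ T.f) := by rw [hm]; infer_instance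
      have : Mono m := mono_of_mono m T.f
      obtain ⟨i', _, hi', hlt'⟩ := hb.like.exists_mono
      have hbl : S.ρ b = l := has b (by simp)
      have hcb : c = b := by
        have h1 : IsSubquotient (S.L c) T.X₁ :=
          ⟨S.L c, i ≫ m, 𝟙 _, inferInstance, inferInstance⟩
        rcases h1.of_shortExact (shortExact_of_mono i') with h2 | h2
        · exact eq_of_isSubquotient_L h2
        · have h3 := hlt' (hbl ▸ hl) c h2
          rw [Set.mem_ofPred_eq, hc, hbl] at h3
          exact absurd h3 (lt_irrefl _)
      subst hcb
      have := isIso_of_mono_costandard (hc ▸ hl) hN hb m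
      have e : T.X₃ ≅ cokernel n := hT.gIsCokernel.coconePointUniqueUpToIso
        (cokernelIsCokernel T.f) ≪≫ (cokernelEpiComp m T.f).symm ≪≫ cokernelIsoOfEq hm
      have := ext_of_hasFlag hV hbs
      exact ext_of_iso_right (Ind.yoneda.mapIso e) 1

/-- If `W` has a flag with sections in strata `≥ ρ c`, then `Ext¹` from standard objects to the
quotient of `W` by a copy of `∇_ε(c)` vanishes. -/
lemma ext_one_quotient (hS : S.IsLowerFiniteEpsStratified ε) {V : Ind R}
    (hV : ∀ (c : B) (Y : R), S.IsEpsCostandard ε c Y → Subsingleton (Ext V (toInd Y) 1))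
    {c : B} {N : R} (hN : S.IsEpsCostandard ε c N) {W : R} {bs : List B}
    (hW : HasFlag (S.IsEpsCostandard ε) W bs) (hbs : ∀ b ∈ bs, S.ρ c ≤ S.ρ b) (m : N ⟶ W) [Mono m] :
    Subsingleton (Ext V (toInd (cokernel m)) 1) := by
  obtain ⟨A, D, i, q, w, as, ds, hAD, hA, hD, has, hds⟩ := exists_flag_bottom_stratum hS hW hbs
  have : Mono i := hAD.mono_f
  have h0 : m ≫ q = 0 := hom_flag_eq_zero hD (fun b hb h =>
    ((hds b hb).trans_le (hN.like.le b h)).false) _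
  have hn : hAD.exact.lift m h0 ≫ i = m := hAD.exact.lift_f _ _
  set n : N ⟶ A := hAD.exact.lift m h0
  have : Mono (n ≫ i) := by rw [hn]; infer_instance
  have : Mono n := mono_of_mono n i
  obtain ⟨a, b, w', h⟩ := shortExact_third_iso hAD (shortExact_of_mono m) n hn
  have h' := h.map_of_exact (Ind.yoneda (C := R))
  have h3 := ext_of_hasFlag hV hD
  have h1 : Subsingleton (Ext V (toInd (cokernel n)) 1) := by
    -- For sign `-`, `N` is relatively injective in `R_{≤ ρ c}`, which contains `A`, so `A / N` is a
    -- direct summand of `A`.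
    cases hs : ε (S.ρ c) with
    | plus => exact ext_one_cokernel_of_stratum_plus hs hV rfl hN hA has n
    | minus =>
      obtain ⟨r, hr⟩ := hN.like.split_le hs n ((S.le _).prop_of_epi (cokernel.π n)
        (le_of_hasFlag hA fun a ha => (has a ha).le))
      obtain ⟨s, hs⟩ := exists_section_of_retraction (shortExact_of_mono n) r hr
      have := ext_of_hasFlag hV hA
      exact ext_of_retract_right (Ind.yoneda.map s) (Ind.yoneda.map (cokernel.π n))
        (by rw [← Functor.map_comp]; exact (congrArg _ hs).trans
              (CategoryTheory.Functor.map_id _ _)) 1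
  exact @ext_X₂_of_covariant _ _ _ _ V _ h' 1 h1 h3

end Stratification

/-! ### Simple objects and essential socles in the ind-completion. -/

section Simple

variable {R : Type u} [SmallCategory R] [Abelian R]

instance simple_toInd (X : R) [Simple X] [IsNoetherianObject X] : Simple (toInd X) where
  mono_isIso_iff_nonzero {Y} f _ := by
    obtain ⟨A, ⟨e⟩⟩ := essImage_of_mono f
    obtain ⟨g, hg⟩ := Ind.yoneda.map_surjective (e.hom ≫ f)
    have hf : f = e.inv ≫ Ind.yoneda.map g := by rw [hg, e.inv_hom_id_assoc]
    have : Mono (Ind.yoneda.map g) := by rw [hg]; infer_instance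
    have : Mono g := Ind.yoneda.mono_of_mono_map this
    constructor
    · rintro h rfl
      have : Mono (0 : Y ⟶ toInd X) := inferInstance
      have h0 : IsZero (toInd X) := IsZero.of_epi_zero Y (toInd X)
      refine Simple.not_isZero X ((IsZero.iff_id_eq_zero _).2 (Ind.yoneda.map_injective ?_))
      exact h0.eq_of_src _ _
    · intro h
      have hg0 : g ≠ 0 := by
        rintro rfl
        exact h (by rw [hf, Functor.map_zero, comp_zero])
      have := isIso_of_mono_of_nonzero hg0
      rw [hf]
      infer_instance

/-- A morphism from `toInd X` is mono if its composition with an essential mono `L ⟶ X` is. -/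
lemma mono_of_essential_mono {L X : R} [∀ X : R, IsNoetherianObject X] [Simple L] {i : L ⟶ X}
    [Mono i] (hi : ∀ ⦃Z : R⦄ (f : X ⟶ Z), Mono (i ≫ f) → Mono f) {V : Ind R} (g : toInd X ⟶ V)
    (hg : Ind.yoneda.map i ≫ g ≠ 0) : Mono g := by
  refine Preadditive.mono_of_kernel_zero ?_
  obtain ⟨A, ⟨e⟩⟩ := essImage_of_mono (kernel.ι g)
  obtain ⟨a, ha⟩ := Ind.yoneda.map_surjective (e.hom ≫ kernel.ι g)
  have hag : Ind.yoneda.map a ≫ g = 0 := by rw [ha, Category.assoc, kernel.condition, comp_zero]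
  have ha0 : a = 0 := by
    by_contra h
    obtain ⟨j, hj⟩ := exists_mono_image_of_essential hi h
    have h1 : Ind.yoneda.map (Abelian.image.ι a) ≫ g = 0 := by
      rw [← cancel_epi (Ind.yoneda.map (Abelian.factorThruImage a)), ← Category.assoc,
        ← Functor.map_comp, Abelian.image.fac, hag, comp_zero]
    exact hg (by rw [← hj, Functor.map_comp, Category.assoc, h1, comp_zero])
  rw [← cancel_epi e.hom, ← ha, ha0, Functor.map_zero, comp_zero]

end Simple

lemma HasFlag.of_iso {C : Type u} [Category.{v} C] [Abelian C] {B : Type x} {N : B → C → Prop}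
    {X Y : C} {bs : List B} (h : HasFlag N X bs) (e : X ≅ Y) : HasFlag N Y bs := by
  cases h with
  | nil _ hX => exact .nil Y (hX.of_iso e.symm)
  | cons T hT b bs hb hbs =>
    have hw : (T.f ≫ e.hom) ≫ e.inv ≫ T.g = 0 := by simp
    exact .cons (ShortComplex.mk (T.f ≫ e.hom) (e.inv ≫ T.g) hw)
      (ShortComplex.shortExact_of_iso (S₁ := T)
      (ShortComplex.isoMk (Iso.refl _) e (Iso.refl _) (by simp) (by simp)) hT) b bs hb hbs

/-! ### Second extensions, and embedding costandard objects. -/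

namespace Stratification

open Abelian

variable {R : Type u} [SmallCategory R] [Abelian R]
  [∀ X : R, IsArtinianObject X] [∀ X : R, IsNoetherianObject X]
  {B : Type x} {Λ : Type y} [PartialOrder Λ] {S : Stratification R B Λ} {ε : Λ → Sign}

omit [∀ X : R, IsArtinianObject X] in
/-- Dimension shifting along the injective object provided for `∇_ε(c)`. -/
lemma ext_succ_costandard (hS : S.IsLowerFiniteEpsStratified ε) {c : B} {N : R}
    (hN : S.IsEpsCostandard ε c N) {X : R} {n : ℕ}
    (h : ∀ (W : R) (bs : List B), HasFlag (S.IsEpsCostandard ε) W bs → (∀ b ∈ bs, S.ρ c ≤ S.ρ b) →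
      ∀ (m : N ⟶ W) [Mono m], Subsingleton (Ext (toInd X) (toInd (cokernel m)) n)) :
    Subsingleton (Ext (toInd X) (toInd N) (n + 1)) := by
  obtain ⟨I, j, F, W₀, n₀, _, _, hdir, hsup, hW₀, hj, hflag⟩ := hS.exists_mono_injective hN
  have hT := shortExact_of_mono j
  refine @ext_succ_of_directed _ _ _ _ X n _ hT ‹_› F hdir hsup W₀ hW₀ fun W hW hle => ?_
  dsimp only
  obtain ⟨bs, ⟨Y, ⟨e⟩, hY⟩, hbs⟩ := hflag W hW
  have hn : (n₀ ≫ Subobject.ofLE _ _ hle) ≫ W.arrow = j := by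
    rw [Category.assoc, Subobject.ofLE_arrow, hj]
  have himg := shortExact_image hT W.arrow (n₀ ≫ Subobject.ofLE _ _ hle) hn
  set n₁ : toInd N ⟶ (W : Ind R) := n₀ ≫ Subobject.ofLE _ _ hle
  have : Mono n₁ := himg.mono_f
  obtain ⟨m, hm⟩ := Ind.yoneda.map_surjective (n₁ ≫ e.inv)
  have : Mono (Ind.yoneda.map m) := by rw [hm]; infer_instance
  have : Mono m := Ind.yoneda.mono_of_mono_map this
  have := h Y bs hY hbs m
  have i : toInd (cokernel m) ≅ Abelian.image (W.arrow ≫ cokernel.π j) :=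
    PreservesCokernel.iso Ind.yoneda m ≪≫ cokernelIsoOfEq hm ≪≫ cokernelCompIsIso n₁ e.inv ≪≫
      (cokernelIsCokernel n₁).coconePointUniqueUpToIso himg.gIsCokernel
  exact ext_of_iso_right i n

lemma ext_two_standard_costandard (hS : S.IsLowerFiniteEpsStratified ε) {b c : B} {X N : R}
    (hX : S.IsEpsStandard ε b X) (hN : S.IsEpsCostandard ε c N) :
    Subsingleton (Ext (toInd X) (toInd N) 2) :=
  ext_succ_costandard hS hN fun _ _ hW hbs m _ =>
    ext_one_quotient hS (fun _ _ hY => ext_one_standard_costandard hS hX hY) hN hW hbs m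

lemma hom_serre_eq_zero {T : Set B} {V : Ind R} (hV : ∀ d ∈ T, ∀ f : toInd (S.L d) ⟶ V, f = 0)
    {X : R} (hX : serre S.L T X) (f : toInd X ⟶ V) : f = 0 := by
  refine serre_induction (P := fun X => ∀ f : toInd X ⟶ V, f = 0)
    (fun X hX f => (Ind.yoneda.map_isZero hX).eq_of_src _ _) ?_ ?_ hX f
  · rintro X b hb ⟨e⟩ f
    have := hV b hb (Ind.yoneda.map e.inv ≫ f)
    exact zero_of_epi_comp _ this
  · intro U hU h₁ h₃ f
    have hU' := hU.map_of_exact (Ind.yoneda (C := R))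
    have := hU'.epi_g
    have h1 : (U.map Ind.yoneda).f ≫ f = 0 := h₁ _
    rw [← hU'.exact.g_desc f h1]
    exact (congrArg _ (h₃ (hU'.exact.desc f h1))).trans comp_zero

/-- From 0 → K → Δ_ε(c) → L(c) → 0, vanishing of Hom(K, V) and of Ext¹(Δ_ε(c), V) suffices. The sign
governs whether `K` may have factors in the stratum of `c` itself. -/
lemma ext_one_L_eq_zero {V : Ind R}
    (hV : ∀ (b : B) (X : R), S.IsEpsStandard ε b X → Subsingleton (Ext (toInd X) V 1)) {c : B}
    (h : ∀ d, (S.ρ d < S.ρ c ∨ (ε (S.ρ c) = .plus ∧ S.ρ d ≤ S.ρ c)) →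
      ∀ f : toInd (S.L d) ⟶ V, f = 0) : Subsingleton (Ext (toInd (S.L c)) V 1) := by
  obtain ⟨X, hX, hX'⟩ := exists_isEpsStandard S ε inferInstance inferInstance c
  obtain ⟨p, _, hp, hk⟩ := hX'.exists_epi
  have := hV c X hX
  refine @ext_one_X₃_of_contravariant _ _ _ _ V _
    ((shortExact_of_epi p).map_of_exact (Ind.yoneda (C := R))) ?_ this
  cases hs : ε (S.ρ c) with
  | minus => exact hom_serre_eq_zero (fun d hd => h d (Or.inl hd)) (hk hs)
  | plus =>
    exact hom_serre_eq_zero (fun d hd => h d (Or.inr ⟨hs, hd⟩))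
      ((S.le _).prop_of_mono (kernel.ι p) hX'.le)

/-- If `L b` embeds in `V`, no `L d` in a lower stratum does, and `Ext¹` from standard objects to
`V` vanishes, then `∇_ε(b)` embeds in `V`. -/
lemma exists_mono_costandard {V : Ind R}
    (hV : ∀ (b : B) (X : R), S.IsEpsStandard ε b X → Subsingleton (Ext (toInd X) V 1)) {b : B}
    (h : ∀ d, S.ρ d < S.ρ b → ∀ f : toInd (S.L d) ⟶ V, f = 0) {f : toInd (S.L b) ⟶ V} (hf : f ≠ 0)
    {N : R} (hN : S.IsEpsCostandard ε b N) : ∃ g : toInd N ⟶ V, Mono g := by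
  obtain ⟨i, _, hi, hc⟩ := hN.like.exists_mono
  -- `T` bounds the labels in ∇_ε(b)/L(b): strata below `ρ b` for sign `+`, and also `ρ b` itself
  -- for sign `-`. In that extra case the kernel of Δ_ε(c) → L(c) is again in strictly lower strata,
  -- so morphisms from strata below `ρ b` are all that is tested.
  have hT : ∃ T : Set B, serre S.L T (cokernel i) ∧
      ∀ c ∈ T, Subsingleton (Ext (toInd (S.L c)) V 1) := by
    cases hs : ε (S.ρ b) with
    | plus =>
      refine ⟨_, hc hs, fun c hcb => ext_one_L_eq_zero hV fun d hd => h d ?_⟩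
      exact hd.elim (fun h => h.trans hcb) fun h => h.2.trans_lt hcb
    | minus =>
      refine ⟨_, (S.le _).prop_of_epi (cokernel.π i) hN.like.le, fun c (hcb : S.ρ c ≤ S.ρ b) =>
        ext_one_L_eq_zero hV fun d hd => h d ?_⟩
      rcases hd with hd | ⟨h1, h2⟩
      · exact hd.trans_le hcb
      · refine h2.trans_lt (lt_of_le_of_ne hcb fun heq => ?_)
        rw [heq, hs] at h1
        cases h1
  obtain ⟨T, hT, hext⟩ := hT
  have : Subsingleton (Ext (toInd (cokernel i)) V 1) := by
    refine serre_induction (P := fun X => Subsingleton (Ext (toInd X) V 1))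
      (fun X hX => ext_of_isZero_left (Ind.yoneda.map_isZero hX) 1) ?_ ?_ hT
    · rintro X c hc ⟨e⟩
      have := hext c hc
      exact ext_of_iso_left (Ind.yoneda.mapIso e).symm 1
    · intro U hU h₁ h₃
      exact @ext_X₂_of_contravariant _ _ _ _ V _ (hU.map_of_exact (Ind.yoneda (C := R))) 1 h₁ h₃
  obtain ⟨g, hg⟩ := @exists_extension_of_ext_one _ _ _ _ V _
    ((shortExact_of_mono i).map_of_exact (Ind.yoneda (C := R))) this f
  exact ⟨g, mono_of_essential_mono hi g (by rw [show Ind.yoneda.map i ≫ g = f from hg]; exact hf)⟩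

end Stratification

/-! ### Dimensions of morphism spaces into ind-objects. -/

section HomDimension

open Abelian Module

variable (k : Type w) [Field k] {R : Type u} [SmallCategory R] [Abelian R] [Linear k R]

attribute [local instance] homModule

/-- The dimension of the space of morphisms from an object of `R` to an ind-object. -/
noncomputable def homDim (X : R) (V : Ind R) : ℕ := finrank k (toInd X ⟶ V)

/-- Postcomposition as a linear map. -/
noncomputable def homPost (X : R) {V W : Ind R} (f : V ⟶ W) :
    (toInd X ⟶ V) →ₗ[k] (toInd X ⟶ W) where
  toFun g := g ≫ f
  map_add' _ _ := Preadditive.add_comp _ _ _ _ _ _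
  map_smul' _ _ := Category.assoc _ _ _

/-- Precomposition as a linear map. -/
noncomputable def homPre {X Y : R} (f : X ⟶ Y) (V : Ind R) :
    (toInd Y ⟶ V) →ₗ[k] (toInd X ⟶ V) where
  toFun g := Ind.yoneda.map f ≫ g
  map_add' g h := Preadditive.comp_add _ _ _ _ _ _
  map_smul' a g := by
    change Ind.yoneda.map f ≫ Ind.yoneda.map (a • 𝟙 Y) ≫ g =
      Ind.yoneda.map (a • 𝟙 X) ≫ Ind.yoneda.map f ≫ g
    rw [← Category.assoc, ← Category.assoc, ← Functor.map_comp, ← Functor.map_comp]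
    simp

/-- Morphisms in `R` and between the associated ind-objects agree. -/
noncomputable def homToIndEquiv (X Y : R) : (X ⟶ Y) ≃ₗ[k] (toInd X ⟶ toInd Y) where
  toFun f := Ind.yoneda.map f
  map_add' f g := Functor.map_add _
  map_smul' a f := by
    change Ind.yoneda.map (a • f) = Ind.yoneda.map (a • 𝟙 X) ≫ Ind.yoneda.map f
    rw [← Functor.map_comp]
    simp
  invFun f := Ind.yoneda.preimage f
  left_inv f := Ind.yoneda.preimage_map f
  right_inv f := Ind.yoneda.map_preimage f

lemma homFiniteDimensional_toInd (X Y : R) [Module.Finite k (X ⟶ Y)] :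
    HomFiniteDimensional k X (toInd Y) :=
  Module.Finite.equiv (homToIndEquiv k X Y)

variable {k} in
lemma HomFiniteDimensional.of_mono {X : R} {V W : Ind R} (i : V ⟶ W) [Mono i]
    (h : HomFiniteDimensional k X W) : HomFiniteDimensional k X V :=
  have : Module.Finite k (toInd X ⟶ W) := h
  Module.Finite.of_injective (homPost k X i) fun _ _ h => (cancel_mono i).1 h

variable {k} in
lemma HomFiniteDimensional.of_lift {X : R} {V W : Ind R} (p : V ⟶ W)
    (hp : ∀ f : toInd X ⟶ W, ∃ g, g ≫ p = f)
    (h : HomFiniteDimensional k X V) : HomFiniteDimensional k X W :=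
  have : Module.Finite k (toInd X ⟶ V) := h
  Module.Finite.of_surjective (homPost k X p) hp

lemma homDim_of_iso_right (X : R) {V W : Ind R} (e : V ≅ W) : homDim k X V = homDim k X W :=
  LinearEquiv.finrank_eq (LinearEquiv.ofBijective (homPost k X e.hom)
    ⟨fun _ _ h => (cancel_mono e.hom).1 h, fun f => ⟨f ≫ e.inv, by
      change (f ≫ e.inv) ≫ e.hom = f
      simp⟩⟩)

lemma homDim_of_iso_left {X Y : R} (e : X ≅ Y) (V : Ind R) : homDim k X V = homDim k Y V :=
  LinearEquiv.finrank_eq (LinearEquiv.ofBijective (homPre k e.inv V)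
    ⟨fun _ _ h => (cancel_epi (Ind.yoneda.map e.inv)).1 h, fun f => ⟨Ind.yoneda.map e.hom ≫ f, by
      change Ind.yoneda.map e.inv ≫ Ind.yoneda.map e.hom ≫ f = f
      rw [← Category.assoc, ← Functor.map_comp]
      simp⟩⟩)

lemma homDim_le_of_mono {X : R} {V W : Ind R} (i : V ⟶ W) [Mono i]
    (h : HomFiniteDimensional k X W) : homDim k X V ≤ homDim k X W :=
  have : Module.Finite k (toInd X ⟶ W) := h
  LinearMap.finrank_le_finrank_of_injective (f := homPost k X i) fun _ _ h => (cancel_mono i).1 h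

lemma finrank_add_of_exact {M₁ M₂ M₃ : Type*} [AddCommGroup M₁] [AddCommGroup M₂] [AddCommGroup M₃]
    [Module k M₁] [Module k M₂] [Module k M₃] (f : M₁ →ₗ[k] M₂) (g : M₂ →ₗ[k] M₃)
    (hf : Function.Injective f) (hg : Function.Surjective g) (h : Function.Exact f g)
    [Module.Finite k M₂] : finrank k M₂ = finrank k M₁ + finrank k M₃ := by
  rw [← LinearMap.finrank_range_add_finrank_ker g, LinearMap.range_eq_top.2 hg, finrank_top,
    h.linearMap_ker_eq, LinearMap.finrank_range_of_inj hf, add_comm]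

/-- Additivity of the dimension in the second argument. -/
lemma homDim_X₂_right {X : R} {T : ShortComplex (Ind R)} (hT : T.ShortExact)
    [Subsingleton (Ext (toInd X) T.X₁ 1)] (h : HomFiniteDimensional k X T.X₂) :
    homDim k X T.X₂ = homDim k X T.X₁ + homDim k X T.X₃ := by
  have : Module.Finite k (toInd X ⟶ T.X₂) := h
  have := hT.mono_f
  refine finrank_add_of_exact k (homPost k X T.f) (homPost k X T.g)
    (fun _ _ h => (cancel_mono T.f).1 h) (exists_lift_of_ext_one hT) fun f => ⟨fun hf => ?_, ?_⟩
  · exact ⟨hT.exact.lift f hf, hT.exact.lift_f f hf⟩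
  · rintro ⟨g, rfl⟩
    change (g ≫ T.f) ≫ T.g = 0
    rw [Category.assoc, T.zero, comp_zero]

/-- Additivity of the dimension in the first argument. -/
lemma homDim_X₂_left {V : Ind R} {T : ShortComplex R} (hT : T.ShortExact) [Injective V]
    (h : HomFiniteDimensional k T.X₂ V) : homDim k T.X₂ V = homDim k T.X₁ V + homDim k T.X₃ V := by
  have : Module.Finite k (toInd T.X₂ ⟶ V) := h
  have hT' := hT.map_of_exact (Ind.yoneda (C := R))
  have := hT.mono_f
  have := hT'.epi_g
  rw [add_comm]
  refine finrank_add_of_exact k (homPre k T.g V) (homPre k T.f V)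
    (fun _ _ h => (cancel_epi (T.map Ind.yoneda).g).1 h)
    (fun f => ⟨Injective.factorThru f (Ind.yoneda.map T.f),
      Injective.comp_factorThru f (Ind.yoneda.map T.f)⟩)
    fun f => ⟨fun hf => ?_, ?_⟩
  · exact ⟨hT'.exact.desc f hf, hT'.exact.g_desc f hf⟩
  · rintro ⟨g, rfl⟩
    change Ind.yoneda.map T.f ≫ Ind.yoneda.map T.g ≫ g = 0
    rw [← Category.assoc, ← Functor.map_comp, T.zero, Functor.map_zero, zero_comp]

/-- Finiteness of the dimension is closed under extensions in the first argument. -/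
lemma homFiniteDimensional_X₂_left {V : Ind R} {T : ShortComplex R} (hT : T.ShortExact)
    (h₁ : HomFiniteDimensional k T.X₁ V) (h₃ : HomFiniteDimensional k T.X₃ V) :
    HomFiniteDimensional k T.X₂ V := by
  have : Module.Finite k (toInd T.X₁ ⟶ V) := h₁
  have : Module.Finite k (toInd T.X₃ ⟶ V) := h₃
  have hT' := hT.map_of_exact (Ind.yoneda (C := R))
  have := hT'.epi_g
  have hex : LinearMap.ker (homPre k T.f V) ≤ LinearMap.range (homPre k T.g V) := fun f hf =>
    ⟨hT'.exact.desc f hf, hT'.exact.g_desc f hf⟩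
  have : Module.Finite k (LinearMap.ker (homPre k T.f V)) :=
    Submodule.finiteDimensional_of_le hex
  have : Module.Finite k ((toInd T.X₂ ⟶ V) ⧸ LinearMap.ker (homPre k T.f V)) :=
    Module.Finite.equiv (homPre k T.f V).quotKerEquivRange.symm
  exact Module.Finite.of_submodule_quotient (LinearMap.ker (homPre k T.f V))

lemma homDim_eq_zero {X : R} {V : Ind R} (h : ∀ f : toInd X ⟶ V, f = 0) : homDim k X V = 0 := by
  have : Subsingleton (toInd X ⟶ V) := subsingleton_of_forall_eq 0 h
  exact finrank_zero_of_subsingleton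

lemma homDim_pos {X : R} {V : Ind R} (h : HomFiniteDimensional k X V) {f : toInd X ⟶ V}
    (hf : f ≠ 0) : 0 < homDim k X V := by
  have : Module.Finite k (toInd X ⟶ V) := h
  have : Nontrivial (toInd X ⟶ V) := ⟨f, 0, hf⟩
  exact finrank_pos

lemma homDim_eq_one {X : R} {V : Ind R} {f₀ : toInd X ⟶ V} (h₀ : f₀ ≠ 0)
    (h : ∀ f : toInd X ⟶ V, ∃ a : k, f = Ind.yoneda.map (a • 𝟙 X) ≫ f₀) : homDim k X V = 1 :=
  finrank_eq_one f₀ h₀ fun f => (h f).imp fun _ h => h.symm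

/-- The morphisms from `X` to a directed sum of subobjects are those to one of the subobjects. -/
lemma exists_homDim_le {X : R} {V : Ind R} (hV : HomFiniteDimensional k X V)
    {F : Set (Subobject V)} (hne : F.Nonempty) (hdir : DirectedOn (· ≤ ·) F) (hsup : IsLUB F ⊤) :
    ∃ W ∈ F, homDim k X V ≤ homDim k X (W : Ind R) := by
  have : Module.Finite k (toInd X ⟶ V) := hV
  obtain ⟨s, hs⟩ := (Module.Finite.fg_top : (⊤ : Submodule k (toInd X ⟶ V)).FG)
  have : ∀ t : Finset (toInd X ⟶ V), ∃ W ∈ F, ∀ f ∈ t, ∃ g : toInd X ⟶ (W : Ind R),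
      g ≫ W.arrow = f := by
    classical
    intro t
    induction t using Finset.induction_on with
    | empty => exact ⟨_, hne.some_mem, by simp⟩
    | insert f t _ ih =>
      obtain ⟨W, hW, h⟩ := ih
      obtain ⟨W', hW', g, hg⟩ := exists_factors hne hdir hsup f
      obtain ⟨W'', hW'', h1, h2⟩ := hdir _ hW _ hW'
      refine ⟨W'', hW'', fun f' hf' => ?_⟩
      rcases Finset.mem_insert.1 hf' with rfl | hf'
      · exact ⟨g ≫ Subobject.ofLE _ _ h2, by rw [Category.assoc, Subobject.ofLE_arrow, hg]⟩
      · obtain ⟨g', hg'⟩ := h f' hf'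
        exact ⟨g' ≫ Subobject.ofLE _ _ h1, by rw [Category.assoc, Subobject.ofLE_arrow, hg']⟩
  obtain ⟨W, hW, h⟩ := this s
  have hfin : Module.Finite k (toInd X ⟶ (W : Ind R)) := hV.of_mono W.arrow
  refine ⟨W, hW, LinearMap.finrank_le_finrank_of_surjective (f := homPost k X W.arrow) ?_⟩
  rw [← LinearMap.range_eq_top, ← top_le_iff, ← hs, Submodule.span_le]
  exact fun f hf => h f hf

end HomDimension

lemma shortExact_iso_comp {C : Type u} [Category.{v} C] [Abelian C] {T : ShortComplex C}
    (hT : T.ShortExact) {A : C} (e : A ≅ T.X₁) :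
    ∃ w : (e.hom ≫ T.f) ≫ T.g = 0, (ShortComplex.mk (e.hom ≫ T.f) T.g w).ShortExact := by
  have w : (e.hom ≫ T.f) ≫ T.g = 0 := by rw [Category.assoc, T.zero, comp_zero]
  exact ⟨w, ShortComplex.shortExact_of_iso (S₁ := T)
    (ShortComplex.isoMk e.symm (Iso.refl _) (Iso.refl _) (by simp) (by simp)) hT⟩

/-! ### The Ext criterion for ascending flags, and higher vanishing. -/

namespace Stratification

open Abelian

variable {k : Type w} [Field k] {R : Type u} [SmallCategory R] [Abelian R] [Linear k R]
  [∀ X : R, IsArtinianObject X] [∀ X : R, IsNoetherianObject X]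
  {B : Type x} {Λ : Type y} [PartialOrder Λ] {S : Stratification R B Λ} {ε : Λ → Sign}

/-- If `Ext¹` from standard objects to `V` vanishes, then `V` has a largest subobject with a flag
with sections in a given finite lower set of strata. -/
lemma exists_flag_subobject (hS : S.IsLowerFiniteEpsStratified ε) {T : Finset B}
    (hT : ∀ c ∈ T, ∀ d, S.ρ d ≤ S.ρ c → d ∈ T) {D : B → R} (hD : ∀ b, S.IsEpsStandard ε b (D b))
    (n : ℕ) : ∀ {V : Ind R} (_ : ∀ (b : B) (X : R), S.IsEpsStandard ε b X →
        Subsingleton (Ext (toInd X) V 1)) (_ : ∀ b, HomFiniteDimensional k (D b) V)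
      (_ : ∑ c ∈ T, homDim k (D c) V < n),
    ∃ (W : R) (bs : List B) (Q : Ind R) (i : toInd W ⟶ V) (p : V ⟶ Q) (w : i ≫ p = 0),
      (ShortComplex.mk i p w).ShortExact ∧ HasFlag (S.IsEpsCostandard ε) W bs ∧
      (∀ b ∈ bs, b ∈ T) ∧ ∀ c ∈ T, ∀ f : toInd (S.L c) ⟶ Q, f = 0 := by
  induction n with
  | zero => exact fun _ _ h => absurd h (Nat.not_lt_zero _)
  | succ n ih =>
  intro V hV hfin hn
  by_cases h0 : ∀ c ∈ T, ∀ f : toInd (S.L c) ⟶ V, f = 0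
  · refine ⟨0, [], V, 0, 𝟙 V, zero_comp, ?_, .nil _ (isZero_zero R), by simp, h0⟩
    have hz : IsZero (toInd (0 : R)) := Ind.yoneda.map_isZero (isZero_zero R)
    have : Mono (0 : toInd (0 : R) ⟶ V) := ⟨fun _ _ _ => hz.eq_of_tgt _ _⟩
    exact ⟨(ShortComplex.exact_iff_mono _ rfl).2 inferInstance⟩
  · push Not at h0
    -- As `T` is a lower set, minimality in `T` means that no simple object from any stratum below
    -- `ρ c` embeds in `V`.
    obtain ⟨c, ⟨hcT, f, hf⟩, hmin⟩ := Set.Finite.exists_minimalFor S.ρ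
      {c | c ∈ T ∧ ∃ f : toInd (S.L c) ⟶ V, f ≠ 0} (T.finite_toSet.subset fun c h => h.1) h0
    obtain ⟨N, hN, -⟩ := exists_isEpsCostandard S ε inferInstance inferInstance c
    obtain ⟨g, hg⟩ := exists_mono_costandard hV (fun d hd f => by
      by_contra hf
      exact (hmin ⟨hT c hcT d hd.le, f, hf⟩ hd.le).not_gt hd) hf hN
    have hU := shortExact_of_mono g
    have hext1 : ∀ b X, S.IsEpsStandard ε b X → Subsingleton (Ext (toInd X) (toInd N) 1) :=
      fun b X hX => ext_one_standard_costandard hS hX hN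
    -- The vanishing of Ext² lets the hypothesis on `V` descend to the quotient, so the construction
    -- can be repeated.
    have hV' : ∀ b X, S.IsEpsStandard ε b X → Subsingleton (Ext (toInd X) (cokernel g) 1) :=
      fun b X hX => @ext_X₃_of_covariant _ _ _ _ (toInd X) _ hU 1 (hV b X hX)
        (ext_two_standard_costandard hS hX hN)
    have hadd : ∀ b, homDim k (D b) V = homDim k (D b) (toInd N) + homDim k (D b) (cokernel g) :=
      fun b => @homDim_X₂_right _ _ _ _ _ _ _ _ hU (hext1 b _ (hD b)) (hfin b)
    have hfin' : ∀ b, HomFiniteDimensional k (D b) (cokernel g) := fun b =>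
      (hfin b).of_lift (cokernel.π g) (@exists_lift_of_ext_one _ _ _ _ _ _ hU (hext1 b _ (hD b)))
    have hlt : ∑ b ∈ T, homDim k (D b) (cokernel g) < ∑ b ∈ T, homDim k (D b) V := by
      refine Finset.sum_lt_sum (fun b _ => by rw [hadd b]; exact Nat.le_add_left _ _)
        ⟨c, hcT, ?_⟩
      have : 0 < homDim k (D c) (toInd N) := by
        obtain ⟨p, _, -, -⟩ := (hD c).like.exists_epi
        obtain ⟨i, _, -, -⟩ := hN.like.exists_mono
        refine homDim_pos k ((hfin c).of_mono g) (f := Ind.yoneda.map (p ≫ i)) fun h => ?_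
        have h1 : p ≫ i = 0 := Ind.yoneda.map_injective (by rw [h, Functor.map_zero])
        exact Simple.not_isZero (S.L c) (IsZero.of_mono_eq_zero i (zero_of_epi_comp p h1))
      rw [hadd c]
      omega
    obtain ⟨W₁, bs, Q, i, q, w, hWQ, hW₁, hbs, hQ⟩ := ih hV' hfin'
      (hlt.trans_le (Nat.lt_succ_iff.1 hn))
    obtain ⟨W, e, i', q', w', -, -, hW⟩ := exists_shortExact_of_ind (shortExact_pullback hU i)
    have hpre := shortExact_preimage hU i q w hWQ
    obtain ⟨w, hWQ'⟩ := shortExact_iso_comp hpre e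
    exact ⟨W, c :: bs, Q, _, _, w, hWQ', .cons _ hW c bs hN hW₁, by simpa using ⟨hcT, hbs⟩, hQ⟩

omit [∀ X : R, IsArtinianObject X] [∀ X : R, IsNoetherianObject X] in
/-- In a lower finite stratification, a finite set of labels generates a finite lower set. -/
lemma exists_finite_lower_set (hΛ : ∀ l : Λ, (Set.Iic l).Finite) (T₀ : Finset B) :
    ∃ T : Finset B, T₀ ⊆ T ∧ ∀ c ∈ T, ∀ d, S.ρ d ≤ S.ρ c → d ∈ T := by
  have hfin : (⋃ c ∈ T₀, ⋃ l ∈ Set.Iic (S.ρ c), {d | S.ρ d = l}).Finite :=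
    T₀.finite_toSet.biUnion fun c _ => (hΛ (S.ρ c)).biUnion fun l _ => S.fibre_finite l
  refine ⟨hfin.toFinset, fun c hc => ?_, fun c hc d hd => ?_⟩
  · simp only [Set.Finite.mem_toFinset, Set.mem_iUnion]
    exact ⟨c, hc, _, le_rfl, rfl⟩
  · simp only [Set.Finite.mem_toFinset, Set.mem_iUnion] at hc ⊢
    obtain ⟨e, he, l, hl, rfl⟩ := hc
    exact ⟨e, he, _, hd.trans hl, rfl⟩

/-- Objects of finite length have finitely many composition factors. -/
lemma exists_finset_serre (X : R) : ∃ T : Finset B, serre S.L T X := by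
  classical
  refine serre_induction (S := S) (T := Set.univ) (P := fun X => ∃ T : Finset B, serre S.L T X)
    (fun X hX => ⟨∅, (serre S.L _).prop_of_isZero hX⟩) ?_ ?_ (fun _ _ => Set.mem_univ _)
  · rintro X b - ⟨e⟩
    exact ⟨{b}, (serre S.L _).prop_of_iso e.symm (serre_L (by simp))⟩
  · rintro U hU ⟨T₁, h₁⟩ ⟨T₃, h₃⟩
    exact ⟨T₁ ∪ T₃, (serre S.L _).prop_X₂_of_shortExact hU (serre_mono (by simp) h₁)
      (serre_mono (by simp) h₃)⟩

/-- Vanishing of `Ext¹` from standard objects implies the existence of an ascending flag. -/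
lemma exists_ascendingFlag (hS : S.IsLowerFiniteEpsStratified ε) {V : Ind R}
    (hV : ∀ (b : B) (X : R), S.IsEpsStandard ε b X → Subsingleton (Ext (toInd X) V 1))
    (hfin : ∀ (b : B) (X : R), S.IsEpsStandard ε b X → HomFiniteDimensional k X V) :
    ∃ F : Set (Subobject V), S.IsAscendingFlag ε V F := by
  classical
  choose D hD _ using exists_isEpsStandard S ε inferInstance inferInstance
  -- the largest subobject with sections labelled by `T`
  let P (T : Finset B) (W : Subobject V) : Prop :=
    ∃ (X : R) (bs : List B) (_ : toInd X ≅ (W : Ind R)),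
    HasFlag (S.IsEpsCostandard ε) X bs ∧ serre S.L T X ∧
      ∀ (Y : R) (f : toInd Y ⟶ V), serre S.L T Y → ∃ g, g ≫ W.arrow = f
  have hP : ∀ T₀ : Finset B, ∃ T, T₀ ⊆ T ∧ ∃ W, P T W := by
    intro T₀
    obtain ⟨T, hT₀, hT⟩ := exists_finite_lower_set (S := S) hS.lower_finite T₀
    obtain ⟨X, bs, Q, i, p, w, hQ, hX, hbs, h⟩ := exists_flag_subobject hS hT hD _ hV
      (fun b => hfin b _ (hD b)) (Nat.lt_succ_self _)
    have : Mono i := hQ.mono_f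
    refine ⟨T, hT₀, Subobject.mk i, X, bs, (Subobject.underlyingIso i).symm, hX,
      serre_of_hasFlag hX fun b hb d hd => hT b (hbs b hb) d hd, fun Y f hY => ?_⟩
    have h0 : f ≫ p = 0 := hom_serre_eq_zero h hY _
    exact ⟨hQ.exact.lift f h0 ≫ (Subobject.underlyingIso i).inv, by
      rw [Category.assoc, Subobject.underlyingIso_arrow]
      exact hQ.exact.lift_f f h0⟩
  -- Maximality makes these subobjects monotone in the label set, hence the family directed.
  have hle : ∀ {T T' : Finset B} {W W' : Subobject V}, T ⊆ T' → P T W → P T' W' → W ≤ W' := by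
    rintro T T' W W' hT ⟨X, bs, e, -, hX, -⟩ ⟨_, _, _, -, -, h⟩
    obtain ⟨g, hg⟩ := h X (e.hom ≫ W.arrow) (serre_mono (by simpa using hT) hX)
    exact Subobject.le_of_comm (e.inv ≫ g) (by rw [Category.assoc, hg, e.inv_hom_id_assoc])
  refine ⟨{W | ∃ T, P T W}, ?_, ?_, ⟨fun _ _ => le_top, fun U hU => ?_⟩, ?_⟩
  · obtain ⟨T, -, W, h⟩ := hP ∅
    exact ⟨W, T, h⟩
  · rintro W ⟨T, h⟩ W' ⟨T', h'⟩
    obtain ⟨T'', hT, W'', h''⟩ := hP (T ∪ T')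
    exact ⟨W'', ⟨T'', h''⟩, hle (Finset.union_subset_left hT) h h'',
      hle (Finset.union_subset_right hT) h' h''⟩
  · have : IsIso U.arrow := ind_isIso_of_mono U.arrow fun X a => by
      obtain ⟨T₀, hT₀⟩ := exists_finset_serre (S := S) X
      obtain ⟨T, hT, W, h⟩ := hP T₀
      have hWU := hU ⟨T, h⟩
      obtain ⟨_, _, _, -, -, h⟩ := h
      obtain ⟨g, rfl⟩ := h X a (serre_mono (by simpa using hT) hT₀)
      exact ⟨g ≫ Subobject.ofLE _ _ hWU, by rw [Category.assoc, Subobject.ofLE_arrow]⟩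
    rw [Subobject.eq_top_of_isIso_arrow U]
  · rintro W ⟨T, X, bs, e, hX, -⟩
    exact ⟨bs, X, ⟨e⟩, hX⟩

/-- An object of `R` with vanishing `Ext¹` from standard objects has a flag. -/
lemma exists_flag_of_ext_one (hS : S.IsLowerFiniteEpsStratified ε) {X : R}
    (hX : ∀ (b : B) (Y : R), S.IsEpsStandard ε b Y → Subsingleton (Ext (toInd Y) (toInd X) 1))
    (hfin : ∀ Y : R, Module.Finite k (Y ⟶ X)) :
    ∃ bs, HasFlag (S.IsEpsCostandard ε) X bs := by
  obtain ⟨F, hF⟩ := exists_ascendingFlag (k := k) hS hX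
    fun _ Y _ => homFiniteDimensional_toInd k Y X
  -- By compactness the identity of an object of `R` factors through one member, which is therefore
  -- everything.
  obtain ⟨W, hW, g, hg⟩ := exists_factors hF.nonempty hF.directed hF.sum_eq (𝟙 (toInd X))
  have : Epi (g ≫ W.arrow) := by rw [hg]; infer_instance
  have : Epi W.arrow := epi_of_epi g W.arrow
  have : IsIso W.arrow := isIso_of_mono_of_epi _
  obtain ⟨bs, Y, ⟨e⟩, hY⟩ := hF.flag W hW
  exact ⟨bs, hY.of_iso (Ind.yoneda.preimageIso (e ≪≫ asIso W.arrow))⟩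

/-- Higher extensions from standard to costandard objects vanish. -/
lemma ext_standard_costandard (hS : S.IsLowerFiniteEpsStratified ε)
    (hfin : ∀ X Y : R, Module.Finite k (X ⟶ Y)) (n : ℕ) :
    ∀ {b c : B} {X N : R}, S.IsEpsStandard ε b X → S.IsEpsCostandard ε c N →
      Subsingleton (Ext (toInd X) (toInd N) (n + 1)) := by
  induction n with
  | zero => exact fun hX hN => ext_one_standard_costandard hS hX hN
  | succ n ih =>
    intro b c X N hX hN
    refine ext_succ_costandard hS hN fun W bs hW hbs m _ => ?_
    -- The quotient produced by the dimension shift has a flag itself, by the Ext¹ criterion, so the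
    -- inductive hypothesis applies to its sections.
    obtain ⟨cs, hcs⟩ := exists_flag_of_ext_one (k := k) hS (X := cokernel m)
      (fun b Y hY => ext_one_quotient hS (fun _ _ h => ext_one_standard_costandard hS hY h) hN hW
        hbs m) fun Y => hfin _ _
    exact ext_of_hasFlag (fun _ _ h => ih hX h) hcs

/-- Higher extensions from standard objects to ind-objects with an ascending flag vanish. -/
lemma ext_of_ascendingFlag (hS : S.IsLowerFiniteEpsStratified ε)
    (hfin : ∀ X Y : R, Module.Finite k (X ⟶ Y)) {V : Ind R} {F : Set (Subobject V)}
    (hF : S.IsAscendingFlag ε V F) {b : B} {X : R} (hX : S.IsEpsStandard ε b X) (n : ℕ) :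
    Subsingleton (Ext (toInd X) V (n + 1)) := by
  refine ext_of_factors fun K f => ?_
  obtain ⟨W, hW, g, rfl⟩ := exists_factors hF.nonempty hF.directed hF.sum_eq f
  obtain ⟨bs, Y, ⟨e⟩, hY⟩ := hF.flag W hW
  have := ext_of_hasFlag (fun _ _ h => ext_standard_costandard hS hfin n hX h) hY
  exact ⟨W, g, W.arrow, rfl, ext_of_iso_right e _⟩

end Stratification

/-! ### Composition multiplicities through additive functions. -/

section CompositionSeries

variable {C : Type u} [Category.{v} C] [Abelian C]

/-- The preimage in `A'` of a subobject of the quotient lies between `A` and `A'`, so it is one of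
the two. -/
lemma simple_cokernel_of_covBy {X : C} {A A' : Subobject X} (h : A ⋖ A') :
    Simple (cokernel (Subobject.ofLE A A' h.le)) where
  mono_isIso_iff_nonzero {Y} f _ := by
    let j := Subobject.ofLE A A' h.le
    have hj : j ≫ A'.arrow = A.arrow := Subobject.ofLE_arrow h.le
    change Y ⟶ cokernel j at f
    constructor
    · rintro _ rfl
      have h0 : IsZero (cokernel j) := IsZero.of_epi_zero Y (cokernel j)
      have : Epi j := Preadditive.epi_of_cokernel_zero (h0.eq_of_tgt _ _)
      have : IsIso j := isIso_of_mono_of_epi j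
      refine h.lt.not_ge (Subobject.le_of_comm (inv j) ?_)
      rw [← hj, IsIso.inv_hom_id_assoc]
    · intro hf
      let a : pullback (cokernel.π j) f ⟶ A' := pullback.fst _ _
      have hA : A ≤ Subobject.mk (a ≫ A'.arrow) :=
        Subobject.le_mk_of_comm (pullback.lift j 0 (by simp)) (by
          rw [← Category.assoc, pullback.lift_fst, hj])
      have hA' : Subobject.mk (a ≫ A'.arrow) ≤ A' := Subobject.mk_le_of_comm a rfl
      rcases hA.lt_or_eq with hlt | heq
      · have heq : Subobject.mk (a ≫ A'.arrow) = A' :=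
          hA'.lt_or_eq.resolve_left fun h' => h.2 hlt h'
        let t := Subobject.ofLEMk _ _ heq.ge
        have ht : t ≫ a = 𝟙 _ := by
          rw [← cancel_mono A'.arrow, Category.assoc, Subobject.ofLEMk_comp, Category.id_comp]
        have hπ : (t ≫ pullback.snd _ _) ≫ f = cokernel.π j := by
          rw [Category.assoc, ← pullback.condition, ← Category.assoc]
          exact (congrArg (· ≫ cokernel.π j) ht).trans (Category.id_comp _)
        have : Epi ((t ≫ pullback.snd _ _) ≫ f) := by rw [hπ]; infer_instance
        have : Epi f := epi_of_epi (t ≫ pullback.snd _ _) f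
        exact isIso_of_mono_of_epi f
      · refine absurd ?_ hf
        let t := Subobject.ofMkLE _ _ heq.ge
        have ht : t ≫ j = a := by
          rw [← cancel_mono A'.arrow, Category.assoc, hj]
          exact Subobject.ofMkLE_arrow _
        have h0 : pullback.snd (cokernel.π j) f ≫ f = 0 := by
          rw [← pullback.condition]
          change a ≫ cokernel.π j = 0
          rw [← ht, Category.assoc, cokernel.condition, comp_zero]
        exact zero_of_epi_comp _ h0

lemma fin_telescope (n : ℕ) (f : Fin (n + 1) → ℕ) (g : Fin n → ℕ)
    (h : ∀ i, f i.succ = f i.castSucc + g i) : f (Fin.last n) = f 0 + ∑ i, g i := by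
  induction n with
  | zero => simp
  | succ n ih =>
    have h' := ih (fun i => f i.castSucc) (fun i => g i.castSucc) fun i => h i.castSucc
    rw [Fin.sum_univ_castSucc, ← add_assoc, ← Fin.succ_last, h]
    exact congrArg (· + g (Fin.last n)) h'

/-- The composition multiplicity of `L` agrees with any additive function on subquotients taking
the value `1` on `L` and `0` on the other simple objects. -/
lemma compositionMultiplicity_eq [∀ X : C, IsArtinianObject X] [∀ X : C, IsNoetherianObject X]
    {L : C} (d : C → ℕ) (hiso : ∀ {X Y : C}, (X ≅ Y) → d X = d Y)
    (hadd : ∀ T : ShortComplex C, T.ShortExact → d T.X₂ = d T.X₁ + d T.X₃)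
    (hL : d L = 1) (hsimple : ∀ X : C, Simple X → ¬ Nonempty (X ≅ L) → d X = 0) (X : C) :
    compositionMultiplicity X L = d X := by
  classical
  have hzero : ∀ Y : C, IsZero Y → d Y = 0 := fun Y hY => by
    have : Epi (0 : Y ⟶ Y) := ⟨fun _ _ _ => hY.eq_of_src _ _⟩
    have h := hadd (ShortComplex.mk (𝟙 Y) (0 : Y ⟶ Y) comp_zero)
      ⟨ShortComplex.exact_of_isZero_X₂ _ hY⟩
    have : d Y = d Y + d Y := h
    omega
  -- Telescoping along a filtration expresses `d X` through the sections. Keeping only those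
  -- isomorphic to `L` bounds the count from above, and for a maximal chain nothing is lost.
  have hsum : ∀ s : LTSeries (Subobject X), s.head = ⊥ → s.last = ⊤ →
      d X = ∑ i : Fin s.length,
        d (cokernel (Subobject.ofLE (s i.castSucc) (s i.succ) (s.step i).le)) := by
    intro s hbot htop
    have h := fin_telescope s.length (fun i => d (s i : C)) _ fun i =>
      hadd _ (shortExact_of_mono (Subobject.ofLE (s i.castSucc) (s i.succ) (s.step i).le))
    have h0 : d ((s 0 : Subobject X) : C) = 0 := by
      refine hzero _ ?_
      rw [show s 0 = ⊥ from hbot]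
      exact (isZero_zero C).of_iso Subobject.botCoeIsoZero
    have h1 : d ((s (Fin.last _) : Subobject X) : C) = d X := by
      rw [show s (Fin.last _) = ⊤ from htop]
      exact hiso (asIso (⊤ : Subobject X).arrow)
    rw [← h1]
    dsimp only at h
    rw [h, h0, zero_add]
  refine le_antisymm (iSup_le fun s => ?_) ?_
  · rw [hsum s.1 s.2.1 s.2.2, Finset.card_eq_sum_ones, Finset.sum_filter]
    refine Nat.cast_le.2 (Finset.sum_le_sum fun i _ => ?_)
    split_ifs with h
    · obtain ⟨e⟩ := h
      rw [hiso e, hL]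
    · exact Nat.zero_le _
  · obtain ⟨a, ha, n, hn, hcov⟩ :=
      exists_covBy_seq_of_wellFoundedLT_wellFoundedGT (Subobject X)
    let s : LTSeries (Subobject X) := ⟨n, fun i => a i, fun i => (hcov i i.2).lt⟩
    have hbot : s.head = ⊥ := ha.eq_bot
    have htop : s.last = ⊤ := hn.eq_top
    refine le_trans (le_of_eq ?_) (le_iSup _ ⟨s, hbot, htop⟩)
    rw [hsum s hbot htop, Finset.card_eq_sum_ones, Finset.sum_filter]
    refine congrArg _ (Finset.sum_congr rfl fun i _ => ?_)
    split_ifs with h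
    · obtain ⟨e⟩ := h
      rw [hiso e, hL]
    · exact hsimple _ (simple_cokernel_of_covBy (hcov i i.2)) h

end CompositionSeries

/-! ### Injective hulls and reciprocity. -/

namespace Stratification

open Abelian Module

variable {k : Type w} [Field k] {R : Type u} [SmallCategory R] [Abelian R] [Linear k R]
  [∀ X : R, IsArtinianObject X] [∀ X : R, IsNoetherianObject X]
  {B : Type x} {Λ : Type y} [PartialOrder Λ] {S : Stratification R B Λ} {ε : Λ → Sign}

attribute [local instance] homModule

section InjectiveHull

variable {b : B} {I : Ind R} {i : toInd (S.L b) ⟶ I} (hi : IsInjectiveHull i)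

include hi

-- The image of a nonzero morphism from a simple object contains the essential subobject `L b`,
-- hence is isomorphic to it.
omit [∀ X : R, IsArtinianObject X] in
lemma hom_injectiveHull_eq_zero {d : B} (h : d ≠ b) (f : toInd (S.L d) ⟶ I) : f = 0 := by
  obtain ⟨_, _, hess⟩ := hi
  by_contra hf
  have := mono_of_nonzero_from_simple hf
  obtain ⟨j, hj⟩ := exists_mono_image_of_essential hess hf
  have hj0 : j ≠ 0 := by
    rintro rfl
    rw [zero_comp] at hj
    exact Simple.not_isZero (toInd (S.L b)) (IsZero.of_mono_eq_zero i hj.symm)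
  have : IsIso (Abelian.factorThruImage f) := isIso_of_mono_of_epi _
  have hne : j ≫ inv (Abelian.factorThruImage f) ≠ 0 := fun h0 => hj0 (by
    rw [← cancel_mono (inv (Abelian.factorThruImage f)), h0, zero_comp])
  have := isIso_of_hom_simple hne
  exact h (S.eq_of_iso b d
    ⟨Ind.yoneda.preimageIso (asIso (j ≫ inv (Abelian.factorThruImage f)))⟩).symm

variable [IsAlgClosed k] (hfin : ∀ X Y : R, Module.Finite k (X ⟶ Y))

include hfin

omit [∀ X : R, IsArtinianObject X] in
lemma exists_hom_injectiveHull (f : toInd (S.L b) ⟶ I) :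
    ∃ a : k, f = Ind.yoneda.map (a • 𝟙 _) ≫ i := by
  obtain ⟨_, _, hess⟩ := hi
  by_cases hf : f = 0
  · exact ⟨0, by rw [hf, zero_smul, Functor.map_zero, zero_comp]⟩
  obtain ⟨j, hj⟩ := exists_endo_of_essential_mono hess hf
  obtain ⟨j, rfl⟩ := Ind.yoneda.map_surjective j
  have := hfin (S.L b) (S.L b)
  obtain ⟨a, rfl⟩ := endomorphism_simple_eq_smul_id k j
  have ha : a ≠ 0 := by
    rintro rfl
    rw [zero_smul, Functor.map_zero, zero_comp] at hj
    exact Simple.not_isZero (toInd (S.L b)) (IsZero.of_mono_eq_zero i hj)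
  refine ⟨a⁻¹, ?_⟩
  rw [hj, ← Category.assoc, ← Functor.map_comp]
  simp [smul_smul, mul_inv_cancel₀ ha]

lemma homFiniteDimensional_injectiveHull (X : R) : HomFiniteDimensional k X I := by
  have hzero : ∀ Y : R, (∀ f : toInd Y ⟶ I, f = 0) → HomFiniteDimensional k Y I := fun Y hY => by
    have : Subsingleton (toInd Y ⟶ I) := subsingleton_of_forall_eq 0 hY
    exact Module.Finite.of_finite
  have hb : HomFiniteDimensional k (S.L b) I :=
    Module.Finite.of_surjective (LinearMap.toSpanSingleton k _ i) fun f =>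
      (exists_hom_injectiveHull hi hfin f).imp fun _ h => h.symm
  refine serre_induction (S := S) (T := Set.univ) (P := fun X => HomFiniteDimensional k X I)
    (fun X hX => hzero X fun f => (Ind.yoneda.map_isZero hX).eq_of_src _ _) ?_
    (fun U hU => homFiniteDimensional_X₂_left k hU) (fun _ _ => Set.mem_univ _)
  rintro X d - ⟨e⟩
  by_cases hd : d = b
  · subst hd
    have : Module.Finite k (toInd (S.L d) ⟶ I) := hb
    exact Module.Finite.of_injective (homPre k e.inv I) fun _ _ h =>
      (cancel_epi (Ind.yoneda.map e.inv)).1 h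
  · refine hzero X fun f => zero_of_epi_comp (Ind.yoneda.map e.inv) ?_
    exact hom_injectiveHull_eq_zero hi hd _

/-- The dimension of the space of morphisms to the injective hull of an irreducible object is a
composition multiplicity. -/
lemma homDim_injectiveHull (X : R) :
    (homDim k X I : ℕ∞) = compositionMultiplicity X (S.L b) := by
  have : Injective I := hi.1
  refine (compositionMultiplicity_eq (fun X => homDim k X I) (fun e => homDim_of_iso_left k e I)
    (fun T hT => homDim_X₂_left k hT (homFiniteDimensional_injectiveHull hi hfin _)) ?_ ?_ X).symm
  · refine homDim_eq_one k (f₀ := i) (fun h => ?_) (exists_hom_injectiveHull hi hfin)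
    have := hi.2.1
    exact Simple.not_isZero (toInd (S.L b)) (IsZero.of_mono_eq_zero i h)
  · intro Y hY hne
    obtain ⟨d, ⟨e⟩⟩ := S.exists_iso Y hY
    refine (homDim_of_iso_left k e I).trans (homDim_eq_zero k (hom_injectiveHull_eq_zero hi ?_))
    rintro rfl
    exact hne ⟨e⟩

end InjectiveHull

open Classical in
lemma homDim_standard_costandard [IsAlgClosed k] (hfin : ∀ X Y : R, Module.Finite k (X ⟶ Y))
    {b c : B} {X Y : R} (hX : S.IsEpsStandard ε b X) (hY : S.IsEpsCostandard ε c Y) :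
    homDim k X (toInd Y) = if c = b then 1 else 0 := by
  have h : homDim k X (toInd Y) = finrank k (X ⟶ Y) := (homToIndEquiv k X Y).finrank_eq.symm
  rw [h]
  split_ifs with hcb
  · subst hcb
    obtain ⟨f₀, h₀, h⟩ := exists_hom_basis (k := k) hX.like hY.like
    exact finrank_eq_one f₀ h₀ fun f => (h f).imp fun _ h => h.symm
  · have : Subsingleton (X ⟶ Y) := subsingleton_of_forall_eq 0
      (hom_eq_zero hX.like hY.like fun h => hcb h.symm)
    exact finrank_zero_of_subsingleton

open Classical in
/-- The multiplicity of a section in a flag is the dimension of the space of morphisms from the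
corresponding standard object. -/
lemma homDim_hasFlag [IsAlgClosed k] (hS : S.IsLowerFiniteEpsStratified ε)
    (hfin : ∀ X Y : R, Module.Finite k (X ⟶ Y)) {c : B} {X : R} (hX : S.IsEpsStandard ε c X)
    {W : R} {bs : List B} (hW : HasFlag (S.IsEpsCostandard ε) W bs) :
    homDim k X (toInd W) = bs.count c := by
  induction hW with
  | nil Y hY =>
    exact homDim_eq_zero k fun f => (Ind.yoneda.map_isZero hY).eq_of_tgt _ _
  | cons T hT b bs hb _ ih =>
    have hT' := hT.map_of_exact (Ind.yoneda (C := R))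
    have hext := ext_one_standard_costandard hS hX hb
    have h := @homDim_X₂_right k _ _ _ _ _ X _ hT' hext (homFiniteDimensional_toInd k X T.X₂)
    refine h.trans ?_
    rw [List.count_cons, ← ih, add_comm]
    congr 1
    refine (homDim_standard_costandard hfin hX hb).trans ?_
    simp

/-- Reciprocity for an ascending flag in an ind-object with finite-dimensional morphism spaces. -/
lemma flagMultiplicity_eq_homDim [IsAlgClosed k] (hS : S.IsLowerFiniteEpsStratified ε)
    (hfin : ∀ X Y : R, Module.Finite k (X ⟶ Y)) {V : Ind R} {F : Set (Subobject V)}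
    (hF : S.IsAscendingFlag ε V F) {sec : Subobject V → List B}
    (hsec : ∀ W ∈ F, S.HasCostandardFlag ε (W : Ind R) (sec W)) {c : B} {X : R}
    (hX : S.IsEpsStandard ε c X) (hV : HomFiniteDimensional k X V) :
    flagMultiplicity F sec c = homDim k X V := by
  classical
  have hcount : ∀ W ∈ F, (sec W).count c = homDim k X (W : Ind R) := fun W hW => by
    obtain ⟨Y, ⟨e⟩, hY⟩ := hsec W hW
    rw [← homDim_of_iso_right k X e, homDim_hasFlag hS hfin hX hY]
  refine le_antisymm (iSup₂_le fun W hW => ?_) ?_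
  · have h := homDim_le_of_mono k W.arrow hV
    rw [← hcount W hW] at h
    exact_mod_cast h
  -- A single member already receives a finite generating set of the morphisms to `V`, so the
  -- supremum is attained.
  · obtain ⟨W, hW, h⟩ := exists_homDim_le k hV hF.nonempty hF.directed hF.sum_eq
    rw [← hcount W hW] at h
    refine le_trans (Nat.cast_le.2 h) ?_
    exact_mod_cast le_iSup₂ (f := fun W (_ : W ∈ F) => ((sec W).count c : ℕ∞)) W hW

end Stratification

end Strat

theorem theorem2 {k : Type w} [Field k] [IsAlgClosed k]
    {R : Type u} [SmallCategory R] [Abelian R] [Linear k R] [Strat.IsLocallyFiniteAbelian k R]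
    {B : Type x} {Λ : Type y} [PartialOrder Λ] (S : Strat.Stratification R B Λ)
    (ε : Λ → Strat.Sign) (hS : S.IsLowerFiniteEpsStratified ε) :
    -- the objects `Δ_ε(b)` and `∇_ε(b)` exist
    (∀ b : B, (∃ X : R, S.IsEpsStandard ε b X) ∧ ∃ X : R, S.IsEpsCostandard ε b X) ∧
    -- the homological criterion
    (∀ V : Ind R,
      (∀ (b : B) (X : R), S.IsEpsStandard ε b X → Strat.HomFiniteDimensional k X V) →
      List.TFAE [
        ∃ F : Set (Subobject V), S.IsAscendingFlag ε V F,
        ∀ (b : B) (X : R), S.IsEpsStandard ε b X →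
          Subsingleton (Abelian.Ext (Strat.toInd X) V 1),
        ∀ (b : B) (X : R), S.IsEpsStandard ε b X →
          ∀ n : ℕ, 1 ≤ n → Subsingleton (Abelian.Ext (Strat.toInd X) V n)]) ∧
    -- injective hulls of irreducible objects and reciprocity
    (∀ (b : B) (I : Ind R) (i : Strat.toInd (S.L b) ⟶ I), Strat.IsInjectiveHull i →
      (∃ F : Set (Subobject I), S.IsAscendingFlag ε I F) ∧
      ∀ F : Set (Subobject I), S.IsAscendingFlag ε I F →
        ∀ sec : Subobject I → List B,
          (∀ W ∈ F, S.HasCostandardFlag ε (W : Ind R) (sec W)) →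
          ∀ (c : B) (X : R), S.IsEpsStandard ε c X →
            Strat.flagMultiplicity F sec c = Strat.compositionMultiplicity X (S.L b) ∧
            Strat.flagMultiplicity F sec c ≠ ⊤) := by
  have hA : ∀ X : R, IsArtinianObject X := Strat.IsLocallyFiniteAbelian.artinian k
  have hN : ∀ X : R, IsNoetherianObject X := Strat.IsLocallyFiniteAbelian.noetherian k
  have hfin : ∀ X Y : R, Module.Finite k (X ⟶ Y) := Strat.IsLocallyFiniteAbelian.finite_hom
  refine ⟨fun b => ⟨?_, ?_⟩, fun V hV => ?_, fun b I i hi => ?_⟩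
  · obtain ⟨X, hX, -⟩ := Strat.Stratification.exists_isEpsStandard S ε hA hN b
    exact ⟨X, hX⟩
  · obtain ⟨X, hX, -⟩ := Strat.Stratification.exists_isEpsCostandard S ε hA hN b
    exact ⟨X, hX⟩
  · tfae_have 1 → 3 := by
      rintro ⟨F, hF⟩ b X hX n hn
      obtain ⟨n, rfl⟩ := Nat.exists_eq_add_of_le' hn
      exact Strat.Stratification.ext_of_ascendingFlag hS hfin hF hX n
    tfae_have 3 → 2 := fun h b X hX => h b X hX 1 le_rfl
    tfae_have 2 → 1 := fun h => Strat.Stratification.exists_ascendingFlag (k := k) hS h hV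
    tfae_finish
  · have : Injective I := hi.1
    have hI := Strat.Stratification.homFiniteDimensional_injectiveHull hi hfin
    -- Into an injective object Ext¹ vanishes, and the Hom spaces into the hull are
    -- finite-dimensional, so the criterion applies to it.
    refine ⟨Strat.Stratification.exists_ascendingFlag (k := k) hS
      (fun _ X _ => Abelian.Ext.subsingleton_of_injective _ _ 0) fun _ X _ => hI X,
      fun F hF sec hsec c X hX => ?_⟩
    rw [Strat.Stratification.flagMultiplicity_eq_homDim hS hfin hF hsec hX (hI X)]
    exact ⟨Strat.Stratification.homDim_injectiveHull hi hfin X, ENat.natCast_ne_top _⟩
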